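/- **Setting.** Let $(Y,d)$ be a proper geodesic metric space, $o\in Y$, and let $G$ be a non-elementary group (no finite index subgroup is trivial or isomorphic to $\mathbb Z$) acting properly by isometries on $Y$. For a closed set $X\subseteq Y$ let $\pi_X$ be the set-valued shortest projection. $X$ is *$C$-contracting* ($C\ge 1$) if $\mathrm{diam}\,\pi_X(\gamma)\le C$ for every geodesic $\gamma$ with $d(\gamma,X)\ge C$. An element $h\in G$ of infinite order is *contracting* if $\langle h\rangle o$ is a contracting subset and $n\mapsto h^no$ is a quasi-isometric embedding of $\mathbb Z$; assume that $G$ contains a contracting element. Put $E(h)=\{g\in G: g\langle h\rangle o \text{ and }\langle h\rangle o\text{ have finite Hausdorff distance}\}$ and $\mathrm{Ax}(h)=E(h)o$. Contracting elements $h,k$ are *independent* if the $G$-translates of $\mathrm{Ax}(h)$ and of $\mathrm{Ax}(k)$ are uniformly contracting and have uniformly bounded intersection: for some function $\tau$ and every $r\ge 0$, the intersection of the $r$-neighbourhoods of any two of them has diameter at most $\tau(r)$ (a translate of $\mathrm{Ax}(h)$ and a translate of $\mathrm{Ax}(k)$ always being counted as two members). Let $\overline Y=Y\sqcup\partial Y$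 be a metrizable compactification ($Y$ open and dense) to which the action of $G$ extends by homeomorphisms, and let $[\cdot]$ be a $G$-invariant partition of $\partial Y$. A sequence tends to $[\xi]$ if all of its accumulation points lie in $[\xi]$; a sequence of subsets of $Y$ is *exiting* if its distance to $o$ tends to infinity. Let $\mathcal C$ be the set of *non-pinched* points: those $\xi\in\partial Y$ such that, whenever $x_n,y_n\in Y$ tend to $[\xi]$, the geodesics $[x_n,y_n]$ are exiting. Assume that $\partial Y$ is a *nontrivial convergence boundary*: (A) for every contracting geodesic ray $\gamma$ there is a class $[\xi]$ to which every sequence $y_n\in Y$ with exiting projections $\pi_\gamma(y_n)$ tends; (B) if $X_n$ is an exiting sequence of $C$-contracting quasi-geodesics (with a common quasi-geodesic constant) and $x\in Y$, then along a subsequence the cones $\{y\in Y: \text{some geodesic } [x,y] \text{ meets } X_n\}$ accumulate into one class; (C) $\mathcal C\neq\emptyset$. For a contracting element $h$ let $[h^{+}]$, $[h^-]$ be the unions of the classes of the accumulation points of $h^{n}o$, respectively $h^{-n}o$ ($n\to\infty$); $h$ is *non-pinched* if $[h^+]\cup[h^-]\subseteq\mathcal C$. Assume finally that * either every contracting element of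 $G$ is non-pinched, or the partition is closed (as a relation on $\partial Y$) and $G$ contains a non-pinched contracting element. **Myrberg points.** A point $\xi\in\mathcal C$ is a *Myrberg point* if from every point of $Y$ there is a geodesic ray ending at $[\xi]$, and for all accumulation points $a,b\in\partial Y$ of $Go$ with $[a]\ne[b]$ there are $g_n\in G$ with $g_n\xi\to[a]$ and $g_nx\to[b]$ for every $x\in Y$. Let $\Lambda_mG$ be the set of Myrberg points. **Conical points.** Let $F\subseteq G$ be a set of three mutually independent non-pinched contracting elements, and $\mathscr F=\mathscr F(F)=\{g\,\mathrm{Ax}(f): g\in G, f\in F\}$. * For $L\ge 0$, let $\Lambda_L^{\mathscr F}(Go)$ be the set of $\xi\in\mathcal C$ for which there are $x\in Y$ and infinitely many distinct $X\in\mathscr F$ with $\xi\notin[\Lambda X]$ ($\Lambda X$ being the limit set of $X$ in $\partial Y$, and $[\Lambda X]$ the union of the classes of its points) and $d_X(x,\xi):=\mathrm{diam}(\pi_X(x)\cup\pi_X(\xi))\ge L$. Here $\pi_X(\xi)$ is the set of all points that occur in $\pi_X(y)$ for points $y\in Y$ arbitrarily close to $\xi$. * For $r\in\mathbb R$, let $\Lambda_r^F(G)$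 be the set of $\xi\in\mathcal C$ for which there are $x\in Go$ and infinitely many $y\in Go$ such that $\xi$ lies in the closure of the set of all $z\in Y$ with the following property: for some geodesic $\gamma=[x,z]$, some $f\in F$ and some $h\in G$ with $y=ho$, both $d(ho,\gamma)\le r$ and $d(hfo,\gamma)\le r$. **Proposition.** There are only countably many sets $F\subseteq G$ of three mutually independent non-pinched contracting elements, and the following two equalities hold. 1. For any choice of thresholds $L_0(\mathscr F)\in\mathbb N$, $$\Lambda_mG=\bigcap_{F}\ \bigcap_{L\in\mathbb N,\ L\ge L_0(\mathscr F)}\Lambda_L^{\mathscr F}(Go).$$ 2. There are constants $R(\mathscr F)$, depending only on the system $\mathscr F$, such that for any choice of numbers $r(\mathscr F)\ge R(\mathscr F)$ and of thresholds $\ell(\mathscr F)\in\mathbb R$, $$\Lambda_mG=\bigcap_{F:\ \min_{f\in F}d(o,fo)\ \ge\ \ell(\mathscr F)}\Lambda^F_{r(\mathscr F)}(G).$$ In both equalities $F$ ranges over the sets of three mutually independent non-pinched contracting elements of $G$. -/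

import Mathlib

open Set Filter Topology

namespace ConvBdry

section MetricNotions

variable {Y : Type*} [MetricSpace Y]

/-- `γ` is (the image of) a geodesic segment from `x` to `y`. -/
def IsGeodSegment (γ : Set Y) (x y : Y) : Prop :=
  ∃ c : ℝ → Y, c 0 = x ∧ c (dist x y) = y ∧
    (∀ s ∈ Icc (0 : ℝ) (dist x y), ∀ t ∈ Icc (0 : ℝ) (dist x y), dist (c s) (c t) = |s - t|) ∧
    γ = c '' Icc (0 : ℝ) (dist x y)

/-- Any two points of `Y` are joined by a geodesic segment. -/
def IsGeodesicSpace (Y : Type*) [MetricSpace Y] : Prop :=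
  ∀ x y : Y, ∃ γ : Set Y, IsGeodSegment γ x y

/-- `c`, restricted to `[0, ∞)`, is a geodesic ray starting at `x`. -/
def IsGeodRay (c : ℝ → Y) (x : Y) : Prop :=
  c 0 = x ∧ ∀ s ∈ Ici (0 : ℝ), ∀ t ∈ Ici (0 : ℝ), dist (c s) (c t) = |s - t|

/-- The shortest (set-valued) projection of the point `y` to `X`. -/
def proj (X : Set Y) (y : Y) : Set Y :=
  {p | p ∈ X ∧ dist y p = Metric.infDist y X}

/-- `X` is a `C`-contracting subset: a geodesic at distance at least `C` from `X` has shortest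
projection to `X` of diameter at most `C`. -/
def IsContracting (C : ℝ) (X : Set Y) : Prop :=
  1 ≤ C ∧ IsClosed X ∧
    ∀ (γ : Set Y) (a b : Y), IsGeodSegment γ a b → (∀ p ∈ γ, C ≤ Metric.infDist p X) →
      ∀ p ∈ γ, ∀ q ∈ γ, ∀ u ∈ proj X p, ∀ v ∈ proj X q, dist u v ≤ C

/-- `X` is (the image of) a `c`-quasi-geodesic: a path defined on a nonempty interval, not
increasing distances (as an arc-length parametrization does), such that the parameter length of
each subpath is at most `c` times the distance of its endpoints plus `c`. -/
def IsQuasiGeodesic (c : ℝ) (X : Set Y) : Prop :=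
  ∃ (J : Set ℝ) (γ : ℝ → Y), J.Nonempty ∧ J.OrdConnected ∧ LipschitzOnWith 1 γ J ∧
    (∀ s ∈ J, ∀ t ∈ J, |s - t| ≤ c * dist (γ s) (γ t) + c) ∧ X = γ '' J

/-- The sequence of subsets `X n` leaves every bounded set. -/
def Exiting (X : ℕ → Set Y) : Prop :=
  ∀ (o : Y) (R : ℝ), ∀ᶠ n in atTop, ∀ p ∈ X n, R ≤ dist o p

/-- The cone of all `y` such that some geodesic from `o` to `y` meets `X`. -/
def cone (o : Y) (X : Set Y) : Set Y :=
  {y | ∃ γ : Set Y, IsGeodSegment γ o y ∧ (γ ∩ X).Nonempty}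

/-- The closed `r`-neighbourhoods of `U` and `V` intersect in a set of diameter at most `τ r`,
for each `r ≥ 0`. -/
def BoundedIntersection (τ : ℝ → ℝ) (U V : Set Y) : Prop :=
  ∀ r : ℝ, 0 ≤ r → ∀ p ∈ Metric.cthickening r U ∩ Metric.cthickening r V,
    ∀ q ∈ Metric.cthickening r U ∩ Metric.cthickening r V, dist p q ≤ τ r

end MetricNotions

section Groups

/-- No finite index subgroup is trivial or infinite cyclic. -/
def IsNonelementary (G : Type*) [Group G] : Prop :=
  ∀ H : Subgroup G, H.FiniteIndex → H ≠ ⊥ ∧ IsEmpty (H ≃* Multiplicative ℤ)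

variable {G Y : Type*} [Group G] [MetricSpace Y] [MulAction G Y]

/-- Each bounded set meets only finitely many of its translates. -/
def IsProperAction (G Y : Type*) [Group G] [MetricSpace Y] [MulAction G Y] : Prop :=
  ∀ (x : Y) (R : ℝ), {g : G | dist x (g • x) ≤ R}.Finite

/-- The orbit of `o` under the cyclic group generated by `h`. -/
def cyclicOrbit (o : Y) (h : G) : Set Y := range fun n : ℤ => (h ^ n) • o

/-- `h` is a contracting element: it has infinite order, its orbit is a contracting subset, and
the orbit map is a quasi-isometric embedding of `ℤ`. -/
def IsContractingElt (o : Y) (h : G) : Prop :=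
  ¬ IsOfFinOrder h ∧ (∃ C : ℝ, IsContracting C (cyclicOrbit o h)) ∧
    ∃ c : ℝ, 1 ≤ c ∧ ∀ m n : ℤ,
      |(m : ℝ) - n| / c - c ≤ dist ((h ^ m) • o) ((h ^ n) • o) ∧
      dist ((h ^ m) • o) ((h ^ n) • o) ≤ c * |(m : ℝ) - n| + c

/-- `E(h)`: the elements `g` such that the orbits `⟨h⟩o` and `g⟨h⟩o` are at finite Hausdorff
distance. -/
def elemClosure (o : Y) (h : G) : Set G :=
  {g | ∃ r : ℝ, 0 < r ∧
    (fun y => g • y) '' cyclicOrbit o h ⊆ Metric.cthickening r (cyclicOrbit o h) ∧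
    cyclicOrbit o h ⊆ Metric.cthickening r ((fun y => g • y) '' cyclicOrbit o h)}

/-- `Ax(h) = E(h) o`. -/
def axis (o : Y) (h : G) : Set Y := {y | ∃ f ∈ elemClosure o h, y = f • o}

/-- The system of all translates `g Ax(f)`, for `f ∈ F` and `g ∈ G`. -/
def axisSystem (o : Y) (F : Set G) : Set (Set Y) :=
  {X | ∃ f ∈ F, ∃ g : G, X = (fun y => g • y) '' axis o f}

/-- `h` and `k` are independent: the translates of their axes form a contracting system with
bounded intersection. (A translate of `Ax(h)` and a translate of `Ax(k)` always count as two
different members.) -/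
def Independent (o : Y) (h k : G) : Prop :=
  (∃ C : ℝ, ∀ X ∈ axisSystem o {h, k}, IsContracting C X) ∧
  ∃ τ : ℝ → ℝ,
    (∀ U ∈ axisSystem o {h}, ∀ V ∈ axisSystem o {k}, BoundedIntersection τ U V) ∧
    (∀ U ∈ axisSystem o {h}, ∀ V ∈ axisSystem o {h}, U ≠ V → BoundedIntersection τ U V) ∧
    (∀ U ∈ axisSystem o {k}, ∀ V ∈ axisSystem o {k}, U ≠ V → BoundedIntersection τ U V)

/-- `y` is an `(r, F)`-barrier on `γ`: for some `f ∈ F` and some `h` with `y = h o`, both `h o` and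
`h f o` are at distance at most `r` from `γ`. -/
def IsBarrier (o : Y) (r : ℝ) (F : Set G) (y : Y) (γ : Set Y) : Prop :=
  ∃ f ∈ F, ∃ h : G, y = h • o ∧ Metric.infDist (h • o) γ ≤ r ∧ Metric.infDist (h • f • o) γ ≤ r

/-- The `(r, F)`-cone: all `z` such that `y` is an `(r, F)`-barrier on some geodesic `[x, z]`. -/
def partialCone (o : Y) (r : ℝ) (F : Set G) (x y : Y) : Set Y :=
  {z | ∃ γ : Set Y, IsGeodSegment γ x z ∧ IsBarrier o r F y γ}

end Groups

section Boundary

variable {Y Z : Type*} [MetricSpace Y] [TopologicalSpace Z]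

/-- The boundary of `Y` in `Z`, where `Y` is embedded by `ι`. -/
def bdry (ι : Y → Z) : Set Z := (range ι)ᶜ

/-- The class `[ξ]` in the boundary. A partition of the boundary is given by an equivalence
relation on `Z`, of which only the restriction to the boundary is ever used. -/
def cls (ι : Y → Z) (S : Setoid Z) (ξ : Z) : Set Z := {η | η ∈ bdry ι ∧ S.r η ξ}

/-- The locus `[A]`: the union of the classes of the boundary points in `A`. -/
def locus (ι : Y → Z) (S : Setoid Z) (A : Set Z) : Set Z :=
  {η | ∃ ξ ∈ A ∩ bdry ι, η ∈ cls ι S ξ}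

/-- Every accumulation point of the sequence `u` lies in `A`. -/
def AccumulatesInto (u : ℕ → Z) (A : Set Z) : Prop :=
  ∀ p : Z, MapClusterPt p atTop u → p ∈ A

/-- The set of limit points in the boundary of the subset `X` of `Y`. -/
def limitSet (ι : Y → Z) (X : Set Y) : Set Z := closure (ι '' X) ∩ bdry ι

/-- The partition is closed, as a relation on the boundary. -/
def IsClosedPartition (ι : Y → Z) (S : Setoid Z) : Prop :=
  ∀ (ξ η : ℕ → Z) (a b : Z), (∀ n, ξ n ∈ bdry ι) → (∀ n, η n ∈ bdry ι) →
    (∀ n, S.r (ξ n) (η n)) → a ∈ bdry ι → b ∈ bdry ι →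
    Tendsto ξ atTop (𝓝 a) → Tendsto η atTop (𝓝 b) → S.r a b

/-- The set of non-pinched boundary points: if `x n` and `y n` tend to `[ξ]`, then the geodesics
`[x n, y n]` are exiting. -/
def nonpinched (ι : Y → Z) (S : Setoid Z) : Set Z :=
  {ξ | ξ ∈ bdry ι ∧ ∀ (x y : ℕ → Y) (γ : ℕ → Set Y),
    AccumulatesInto (fun n => ι (x n)) (cls ι S ξ) →
    AccumulatesInto (fun n => ι (y n)) (cls ι S ξ) →
    (∀ n, IsGeodSegment (γ n) (x n) (y n)) → Exiting γ}

/-- `Z` is a compactification of `Y` with an equivariant action of `G` by homeomorphisms, and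
`S` is a `G`-invariant partition of the boundary. (Compactness and metrizability of `Z` and
continuity of the action are instance arguments of the theorem.) -/
structure IsCompactification (G : Type*) [Group G] [MulAction G Y] [MulAction G Z]
    (ι : Y → Z) (S : Setoid Z) : Prop where
  openEmbedding : IsOpenEmbedding ι
  dense : DenseRange ι
  equivariant : ∀ (g : G) (y : Y), ι (g • y) = g • ι y
  invariant : ∀ (g : G) (ξ η : Z), ξ ∈ bdry ι → η ∈ bdry ι → S.r ξ η → S.r (g • ξ) (g • η)

/-- A nontrivial convergence boundary, with respect to the partition `S`. -/
structure IsConvergenceBoundary (ι : Y → Z) (S : Setoid Z) : Prop where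
  /-- A contracting geodesic ray `γ` determines a class `[ξ]`, into which every sequence of points
  with exiting projections to `γ` accumulates (in particular every sequence tending to infinity
  along `γ`). -/
  ray : ∀ (c : ℝ → Y) (x : Y), IsGeodRay c x → (∃ C : ℝ, IsContracting C (c '' Ici 0)) →
    ∃ ξ ∈ bdry ι, ∀ y : ℕ → Y, Exiting (fun n => proj (c '' Ici 0) (y n)) →
      AccumulatesInto (fun n => ι (y n)) (cls ι S ξ)
  /-- For an exiting sequence of `C`-contracting quasi-geodesics, a subsequence of the cones from
  any given point accumulates into one class. -/
  cones : ∀ (C c : ℝ) (X : ℕ → Set Y), 1 ≤ c → (∀ n, IsContracting C (X n)) →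
    (∀ n, IsQuasiGeodesic c (X n)) → Exiting X →
    ∀ o : Y, ∃ φ : ℕ → ℕ, StrictMono φ ∧ ∃ ξ ∈ bdry ι, ∀ y : ℕ → Y,
      (∀ n, y n ∈ cone o (X (φ n))) → AccumulatesInto (fun n => ι (y n)) (cls ι S ξ)
  /-- There is a non-pinched point. -/
  nontrivial : (nonpinched ι S).Nonempty

/-- `ξ` is visual: from each point of `Y` there is a geodesic ray terminating at `[ξ]`. -/
def IsVisual (ι : Y → Z) (S : Setoid Z) (ξ : Z) : Prop :=
  ∀ x : Y, ∃ c : ℝ → Y, IsGeodRay c x ∧ ∀ t : ℕ → ℝ, Tendsto t atTop atTop →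
    AccumulatesInto (fun n => ι (c (t n))) (cls ι S ξ)

/-- The shortest projection of a boundary point `ξ` to `X`: all points that occur in the
projections of points of `Y` arbitrarily close to `ξ`. (If `X` is a contracting orbit of `E(h)` and
`ξ` is non-pinched and not in the locus of the limit set of `X`, then this is a bounded set, and it
contains `proj X (y n)` for all large `n` whenever `y n` tends to `ξ`.) -/
def bdryProj (ι : Y → Z) (X : Set Y) (ξ : Z) : Set Y :=
  {p | ∀ U ∈ 𝓝 ξ, ∃ y : Y, ι y ∈ U ∧ p ∈ proj X y}

/-- `d_X(x, ξ) ≥ L`: the union of the projections of `x` and `ξ` to `X` has diameter at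
least `L`. -/
def ProjDistGE (ι : Y → Z) (X : Set Y) (x : Y) (ξ : Z) (L : ℝ) : Prop :=
  ∃ u ∈ proj X x ∪ bdryProj ι X ξ, ∃ v ∈ proj X x ∪ bdryProj ι X ξ, L ≤ dist u v

/-- The `L`-conical points relative to the collection `𝓕` of subsets of `Y`: for some `x` there
are infinitely many `X ∈ 𝓕` with `d_X(x, ξ) ≥ L`. -/
def projConical (ι : Y → Z) (S : Setoid Z) (𝓕 : Set (Set Y)) (L : ℝ) : Set Z :=
  {ξ | ξ ∈ nonpinched ι S ∧ ∃ x : Y,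
    {X | X ∈ 𝓕 ∧ ξ ∉ locus ι S (limitSet ι X) ∧ ProjDistGE ι X x ξ L}.Infinite}

variable {G : Type*} [Group G] [MulAction G Y]

/-- The attracting set `[h⁺]`: the locus of the accumulation points of `h ^ n o`, `n → ∞`. The
repelling set is the attracting set of `h⁻¹`. -/
def attracting (ι : Y → Z) (S : Setoid Z) (o : Y) (h : G) : Set Z :=
  locus ι S {ζ | MapClusterPt ζ atTop (fun n : ℕ => ι ((h ^ n) • o))}

/-- `h` is non-pinched: its attracting and repelling sets consist of non-pinched points. -/
def IsNonpinchedElt (ι : Y → Z) (S : Setoid Z) (o : Y) (h : G) : Prop :=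
  attracting ι S o h ⊆ nonpinched ι S ∧ attracting ι S o h⁻¹ ⊆ nonpinched ι S

/-- The sets of three mutually independent non-pinched contracting elements. -/
def triples (G : Type*) [Group G] [MulAction G Y] (ι : Y → Z) (S : Setoid Z) (o : Y) :
    Set (Finset G) :=
  {F | F.card = 3 ∧ (∀ f ∈ F, IsContractingElt o f ∧ IsNonpinchedElt ι S o f) ∧
    ∀ f ∈ F, ∀ k ∈ F, f ≠ k → Independent o f k}

/-- The `(r, F)`-shadow of `y` seen from `x`: the part in the boundary of the closure of the
`(r, F)`-cone. -/
def partialShadow (ι : Y → Z) (o : Y) (r : ℝ) (F : Set G) (x y : Y) : Set Z :=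
  closure (ι '' partialCone o r F x y) ∩ bdry ι

/-- The `(r, F)`-conical points: non-pinched points that lie, for some `x` in the orbit of `o`, in
the `(r, F)`-shadows of infinitely many points of the orbit. -/
def conical (ι : Y → Z) (S : Setoid Z) (o : Y) (r : ℝ) (F : Set G) : Set Z :=
  {ξ | ξ ∈ nonpinched ι S ∧ ∃ x ∈ MulAction.orbit G o,
    {y | y ∈ MulAction.orbit G o ∧ ξ ∈ partialShadow ι o r F x y}.Infinite}

/-- The Myrberg set: visual non-pinched points `ξ` such that, for any two distinct classes
`[a]`, `[b]` of limit points of the orbit, there are `g n` in `G` with `g n ξ → [a]` and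
`g n x → [b]` for every `x` in `Y`. -/
def myrberg (G : Type*) [Group G] [MulAction G Y] [MulAction G Z]
    (ι : Y → Z) (S : Setoid Z) (o : Y) : Set Z :=
  {ξ | ξ ∈ nonpinched ι S ∧ IsVisual ι S ξ ∧
    ∀ a ∈ limitSet ι (MulAction.orbit G o), ∀ b ∈ limitSet ι (MulAction.orbit G o), ¬ S.r a b →
      ∃ g : ℕ → G, AccumulatesInto (fun n => g n • ξ) (cls ι S a) ∧
        ∀ x : Y, AccumulatesInto (fun n => ι (g n • x)) (cls ι S b)}

end Boundary

end ConvBdry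

set_option linter.unusedSectionVars false

/-! Everything is compared through one notion. A point ξ is recurrent for F (`Recurrent`) if
geodesics from some x to points near ξ follow arbitrarily long pieces of translated orbits g⟨f⟩o, f
∈ F, arbitrarily far from x.

Myrberg implies conical. The attracting and repelling classes of a non-pinched contracting f are
different (`not_rel_of_attracting`), so the Myrberg condition provides g_n that carry ξ to [f⁺] and
all of Y to [f⁻]. By the Morse property, geodesics from o to points near ξ then run along g_n⁻¹Ax(f)
for longer and longer times. This yields large projections (`myrberg_subset_projConical`) as well as
barriers (`exists_myrberg_subset_conical`).

Conical implies recurrent. A large projection to a translated axis forces geodesics to follow it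
(`recurrent_of_projConical`). For barriers, replace F by its k-th powers: the axes, and with them
the radius r(𝓕), do not change, every lower bound on d(o, f^k o) holds for large k, and a barrier
for f^k marks the two ends of k steps along an orbit of f (`recurrent_of_conical`).

Recurrent for all F implies Myrberg (`mem_myrberg_of_recurrent`); this is the core. Let u_n o → a
and v_n o → b with [a] ≠ [b]. Fix one non-pinched contracting h and three distinct translates of
Ax(h). By the Behrstock inequality a point projects far from o to at most one of them, so any two
points leave one of the three usable (`Frame.good₂`). Put p = v_n⁻¹u_n and take long elements e₁, e₂
along two usable axes. Then E = p e₁ p⁻¹ e₂ shifts a periodic chain of translates of Ax(h), each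
separating its neighbours by a long gap. The calculus of chains, again based on Behrstock, shows
that E is contracting. Three sufficiently different exponents give independent elements
(`Frame.exists_mem_triples`), which are non-pinched: either by assumption, or because pinching would
make one class approachable from both sides of an arbitrarily long member, contrary to the
closedness of the partition. Recurrence for this triple gives geodesics towards ξ that follow an
axis of some E over more than a period. A suitable translation k_n moves the crossed period to v_n
o, u_n o. Then [o, k_n x] passes near v_n o for all x in a large ball, while [o, k_n z] passes near
u_n o for points z close to ξ.

Condition (B), applied to short segments, turns "passes near" into "tends to the same class"
(`accumulatesInto_of_fellow`). The same lemma shows that visuality is automatic (`isVisual`). -/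

namespace ConvBdry

open scoped Pointwise

/-! ### Geodesic segments and their subsegments -/

section Geodesics

variable {Y : Type*} [MetricSpace Y]

namespace IsGeodSegment

variable {γ : Set Y} {x y p q w : Y}

theorem left_mem (h : IsGeodSegment γ x y) : x ∈ γ := by
  obtain ⟨c, h0, _, _, rfl⟩ := h
  exact ⟨0, ⟨le_rfl, dist_nonneg⟩, h0⟩

theorem right_mem (h : IsGeodSegment γ x y) : y ∈ γ := by
  obtain ⟨c, _, h1, _, rfl⟩ := h
  exact ⟨_, ⟨dist_nonneg, le_rfl⟩, h1⟩

theorem symm (h : IsGeodSegment γ x y) : IsGeodSegment γ y x := by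
  obtain ⟨c, h0, h1, hc, rfl⟩ := h
  have key : ∀ s ∈ Icc (0 : ℝ) (dist x y), dist x y - s ∈ Icc (0 : ℝ) (dist x y) := by
    rintro s ⟨hs0, hs1⟩; constructor <;> linarith
  refine ⟨fun s => c (dist x y - s), by simpa using h1, by simp [dist_comm y x, h0], ?_, ?_⟩
  · intro s hs t ht
    rw [dist_comm y x] at hs ht
    rw [hc _ (key s hs) _ (key t ht), abs_sub_comm]
    congr 1; ring
  · rw [dist_comm y x]
    ext w; constructor
    · rintro ⟨s, hs, rfl⟩
      exact ⟨_, key s hs, by simp⟩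
    · rintro ⟨s, hs, rfl⟩
      exact ⟨_, key s hs, rfl⟩

theorem dist_eq_abs (h : IsGeodSegment γ x y) (hp : p ∈ γ) (hq : q ∈ γ) :
    dist p q = |dist x p - dist x q| := by
  obtain ⟨c, h0, h1, hc, rfl⟩ := h
  obtain ⟨s, hs, rfl⟩ := hp
  obtain ⟨t, ht, rfl⟩ := hq
  have h0m : (0 : ℝ) ∈ Icc (0 : ℝ) (dist x y) := ⟨le_rfl, dist_nonneg⟩
  have e1 : dist x (c s) = s := by
    rw [← h0, hc 0 h0m s hs]; simp [abs_of_nonneg hs.1]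
  have e2 : dist x (c t) = t := by
    rw [← h0, hc 0 h0m t ht]; simp [abs_of_nonneg ht.1]
  rw [hc s hs t ht, e1, e2]

theorem dist_add (h : IsGeodSegment γ x y) (hp : p ∈ γ) : dist x p + dist p y = dist x y := by
  obtain ⟨c, h0, h1, hc, rfl⟩ := h
  obtain ⟨s, hs, rfl⟩ := hp
  have e1 := hc 0 ⟨le_rfl, dist_nonneg⟩ s hs
  have e2 := hc s hs _ ⟨dist_nonneg, le_rfl⟩
  rw [h0, zero_sub, abs_neg, abs_of_nonneg hs.1] at e1
  rw [h1, abs_sub_comm, abs_of_nonneg (sub_nonneg.2 hs.2)] at e2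
  linarith

theorem dist_add_of_le (h : IsGeodSegment γ x y) (hp : p ∈ γ) (hq : q ∈ γ)
    (hpq : dist x p ≤ dist x q) : dist x p + dist p q = dist x q := by
  rw [h.dist_eq_abs hp hq, abs_sub_comm, abs_of_nonneg (by linarith)]; ring

theorem eq_of_dist_eq (h : IsGeodSegment γ x y) (hp : p ∈ γ) (hq : q ∈ γ)
    (hpq : dist x p = dist x q) : p = q := by
  have := h.dist_eq_abs hp hq
  rw [hpq] at this; simpa using this

theorem isCompact (h : IsGeodSegment γ x y) : IsCompact γ := by
  obtain ⟨c, h0, h1, hc, rfl⟩ := h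
  refine isCompact_Icc.image_of_continuousOn ?_
  refine LipschitzOnWith.continuousOn (K := 1) (LipschitzOnWith.of_dist_le_mul ?_)
  intro s hs t ht
  simp [hc s hs t ht, Real.dist_eq]

theorem isPreconnected (h : IsGeodSegment γ x y) : IsPreconnected γ := by
  obtain ⟨c, h0, h1, hc, rfl⟩ := h
  refine isPreconnected_Icc.image _ ?_
  refine LipschitzOnWith.continuousOn (K := 1) (LipschitzOnWith.of_dist_le_mul ?_)
  intro s hs t ht
  simp [hc s hs t ht, Real.dist_eq]

theorem sub (h : IsGeodSegment γ x y) (hp : p ∈ γ) (hq : q ∈ γ) (hpq : dist x p ≤ dist x q) :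
    ∃ γ' ⊆ γ, IsGeodSegment γ' p q ∧
      ∀ w ∈ γ, w ∈ γ' ↔ dist x p ≤ dist x w ∧ dist x w ≤ dist x q := by
  have hpq' := h.dist_add_of_le hp hq hpq
  obtain ⟨c, h0, h1, hc, rfl⟩ := h
  obtain ⟨s, hs, rfl⟩ := hp
  obtain ⟨t, ht, rfl⟩ := hq
  have h0m : (0 : ℝ) ∈ Icc (0 : ℝ) (dist x y) := ⟨le_rfl, dist_nonneg⟩
  have e : ∀ s ∈ Icc (0 : ℝ) (dist x y), dist x (c s) = s := by
    intro s hs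
    rw [← h0, hc 0 h0m s hs]; simp [abs_of_nonneg hs.1]
  rw [e s hs, e t ht] at hpq hpq'
  have hd : dist (c s) (c t) = t - s := by linarith
  have hsub : ∀ u ∈ Icc (0 : ℝ) (t - s), s + u ∈ Icc (0 : ℝ) (dist x y) := by
    rintro u ⟨hu0, hu1⟩; constructor <;> linarith [hs.1, ht.2]
  refine ⟨(fun u => c (s + u)) '' Icc 0 (t - s), ?_, ⟨fun u => c (s + u), by simp, ?_, ?_, ?_⟩, ?_⟩
  · rintro _ ⟨u, hu, rfl⟩
    exact ⟨_, hsub u hu, rfl⟩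
  · simp [hd]
  · rw [hd]; intro u hu v hv
    rw [hc _ (hsub u hu) _ (hsub v hv)]; congr 1; ring
  · rw [hd]
  · rintro _ ⟨v, hv, rfl⟩
    rw [e s hs, e t ht, e v hv]
    constructor
    · rintro ⟨u, hu, huv⟩
      have := congrArg (dist x) huv
      simp only [e _ (hsub u hu), e v hv] at this
      constructor <;> linarith [hu.1, hu.2]
    · rintro ⟨h1, h2⟩
      exact ⟨v - s, ⟨by linarith, by linarith⟩, by simp⟩

theorem sub_left (h : IsGeodSegment γ x y) (hq : q ∈ γ) :
    ∃ γ' ⊆ γ, IsGeodSegment γ' x q ∧ ∀ w ∈ γ, w ∈ γ' ↔ dist x w ≤ dist x q := by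
  obtain ⟨γ', h1, h2, h3⟩ := h.sub h.left_mem hq (by simp)
  exact ⟨γ', h1, h2, fun w hw => by rw [h3 w hw]; simp⟩

theorem sub_right (h : IsGeodSegment γ x y) (hq : q ∈ γ) :
    ∃ γ' ⊆ γ, IsGeodSegment γ' q y ∧ ∀ w ∈ γ, w ∈ γ' ↔ dist x q ≤ dist x w := by
  have hm : ∀ w ∈ γ, dist x w ≤ dist x y := fun w hw => by
    linarith [h.dist_add hw, dist_nonneg (x := w) (y := y)]
  obtain ⟨γ', h1, h2, h3⟩ := h.sub hq h.right_mem (hm q hq)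
  exact ⟨γ', h1, h2, fun w hw => by rw [h3 w hw]; simp [hm w hw]⟩

theorem smul {G : Type*} [Group G] [MulAction G Y] [IsIsometricSMul G Y]
    (h : IsGeodSegment γ x y) (g : G) : IsGeodSegment (g • γ) (g • x) (g • y) := by
  obtain ⟨c, h0, h1, hc, rfl⟩ := h
  refine ⟨fun t => g • c t, by simp [h0], by simp [h1], ?_, ?_⟩
  · simpa using hc
  · rw [dist_smul, ← Set.image_smul, Set.image_image]

end IsGeodSegment

end Geodesics

/-! ### Contracting sets: bounded geodesic image, quasi-convexity, Behrstock inequality -/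

section Projections

variable {Y : Type*} [MetricSpace Y]

theorem proj_nonempty [ProperSpace Y] {X : Set Y} (hc : IsClosed X) (hX : X.Nonempty) (y : Y) :
    (proj X y).Nonempty := by
  obtain ⟨p, hp, h⟩ := hc.exists_infDist_eq_dist hX y
  exact ⟨p, hp, h.symm⟩

theorem self_mem_proj {X : Set Y} {y : Y} (hy : y ∈ X) : y ∈ proj X y :=
  ⟨hy, by rw [Metric.infDist_zero_of_mem hy, dist_self]⟩

/-- A point of `X` closer to `q` than `v` would also be closer to `y`, since `q` lies on the way
from `y` to `v`. -/
theorem proj_subgeod {X γ : Set Y} {y v q : Y} (hv : v ∈ proj X y) (hγ : IsGeodSegment γ y v)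
    (hq : q ∈ γ) : v ∈ proj X q := by
  refine ⟨hv.1, le_antisymm ?_ (Metric.infDist_le_dist_of_mem hv.1)⟩
  have h1 := hγ.dist_add hq
  have h2 := hv.2
  have h3 := Metric.infDist_le_infDist_add_dist (s := X) (x := y) (y := q)
  linarith

theorem infDist_smul_set {G : Type*} [Group G] [MulAction G Y] [IsIsometricSMul G Y] (g : G)
    (X : Set Y) (y : Y) : Metric.infDist (g • y) (g • X) = Metric.infDist y X := by
  simp [Metric.infDist, Metric.infEDist_smul]

theorem smul_mem_proj {G : Type*} [Group G] [MulAction G Y] [IsIsometricSMul G Y] {g : G}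
    {X : Set Y} {y u : Y} (hu : u ∈ proj X y) : g • u ∈ proj (g • X) (g • y) :=
  ⟨Set.smul_mem_smul_set hu.1, by rw [dist_smul, infDist_smul_set, hu.2]⟩

theorem mem_proj_smul_iff {G : Type*} [Group G] [MulAction G Y] [IsIsometricSMul G Y] {g : G}
    {X : Set Y} {y u : Y} : u ∈ proj (g • X) y ↔ g⁻¹ • u ∈ proj X (g⁻¹ • y) := by
  constructor
  · intro h
    simpa using smul_mem_proj (g := g⁻¹) h
  · intro h
    simpa using smul_mem_proj (g := g) h

/-- Every shortest projection of `y` to `A` is at distance at most `κ` from `q`. -/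
def ProjNear (A : Set Y) (y q : Y) (κ : ℝ) : Prop := ∀ u ∈ proj A y, dist u q ≤ κ

theorem ProjNear.mono {A : Set Y} {y q : Y} {κ κ' : ℝ} (h : ProjNear A y q κ) (hk : κ ≤ κ') :
    ProjNear A y q κ' := fun u hu => (h u hu).trans hk

theorem projNear_smul_iff {G : Type*} [Group G] [MulAction G Y] [IsIsometricSMul G Y] {g : G}
    {A : Set Y} {y q : Y} {κ : ℝ} :
    ProjNear (g • A) y q κ ↔ ProjNear A (g⁻¹ • y) (g⁻¹ • q) κ := by
  constructor
  · intro h u hu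
    have := h (g • u) (by rw [mem_proj_smul_iff]; simpa using hu)
    rwa [← dist_smul g, smul_inv_smul]
  · intro h u hu
    have := h _ (mem_proj_smul_iff.1 hu)
    rwa [dist_smul] at this

theorem projNear_smul {G : Type*} [Group G] [MulAction G Y] [IsIsometricSMul G Y] {g : G}
    {A : Set Y} {y q : Y} {κ : ℝ} :
    ProjNear (g • A) (g • y) (g • q) κ ↔ ProjNear A y q κ := by
  simp [projNear_smul_iff]

/-- The first point, coming from `x`, of the closed `r`-neighbourhood of `A`. -/
theorem first_hit {A γ : Set Y} {x y : Y} {r : ℝ} (hγ : IsGeodSegment γ x y)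
    (hx : r ≤ Metric.infDist x A) (hy : Metric.infDist y A ≤ r) :
    ∃ p ∈ γ, Metric.infDist p A = r ∧
      ∀ w ∈ γ, dist x w ≤ dist x p → r ≤ Metric.infDist w A := by
  have hcont : Continuous fun w => Metric.infDist w A := Metric.continuous_infDist_pt A
  have hcpt : IsCompact (γ ∩ {w | Metric.infDist w A ≤ r}) :=
    hγ.isCompact.inter_right (isClosed_le hcont continuous_const)
  obtain ⟨p, ⟨hp, hpr⟩, hmin⟩ := hcpt.exists_isMinOn ⟨y, hγ.right_mem, hy⟩
    (f := fun w => dist x w) (by fun_prop)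
  obtain ⟨γ', hsub, hγ', hw'⟩ := hγ.sub_left hp
  obtain ⟨w, hw, hwr⟩ := hγ'.isPreconnected.intermediate_value hγ'.right_mem hγ'.left_mem
    hcont.continuousOn ⟨hpr, hx⟩
  have h1 : dist x w ≤ dist x p := (hw' w (hsub hw)).1 hw
  have h2 : dist x p ≤ dist x w := hmin ⟨hsub hw, le_of_eq hwr⟩
  have h3 : w = p := hγ.eq_of_dist_eq (hsub hw) hp (le_antisymm h1 h2)
  subst h3
  refine ⟨w, hp, hwr, fun v hv hvw => ?_⟩
  by_contra hlt
  push Not at hlt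
  have h4 : dist x w ≤ dist x v := hmin ⟨hv, hlt.le⟩
  have h5 : v = w := hγ.eq_of_dist_eq hv hp (le_antisymm hvw h4)
  subst h5
  exact absurd hwr (ne_of_lt hlt)

theorem IsContracting.mono {A : Set Y} {C C' : ℝ} (hA : IsContracting C A) (h : C ≤ C') : IsContracting C' A :=
  ⟨hA.1.trans h, hA.2.1, fun γ a b hγ ho p hp q hq u hu v hv =>
    (hA.2.2 γ a b hγ (fun z hz => h.trans (ho z hz)) p hp q hq u hu v hv).trans h⟩

theorem IsContracting.smul {G : Type*} [Group G] [MulAction G Y] [IsIsometricSMul G Y]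
    {A : Set Y} {C : ℝ} (hA : IsContracting C A) (g : G) : IsContracting C (g • A) := by
  refine ⟨hA.1, hA.2.1.smul g, fun γ a b hγ ho p hp q hq u hu v hv => ?_⟩
  have := hA.2.2 _ _ _ (hγ.smul g⁻¹) (fun z hz => by
    obtain ⟨z, hz, rfl⟩ := hz
    have := ho z hz
    rwa [← infDist_smul_set g⁻¹, inv_smul_smul] at this) _ (Set.smul_mem_smul_set hp) _
    (Set.smul_mem_smul_set hq) _ (mem_proj_smul_iff.1 hu) _ (mem_proj_smul_iff.1 hv)
  rwa [dist_smul] at this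

variable [ProperSpace Y] {A : Set Y} {C : ℝ}

/-- Let `p` be the first point of `γ` in the closed `C`-neighbourhood of `A`. Up to `p` the geodesic
stays far from `A`, so a projection of `p`, which is at distance `C` from `p`, is `C`-close to `u`.
If `a` already lies in that neighbourhood, take `p = a`. -/
theorem bgi_left (hA : IsContracting C A) {γ : Set Y} {a y u : Y}
    (hγ : IsGeodSegment γ a y) (hy : Metric.infDist y A ≤ C) (hu : u ∈ proj A a) :
    ∃ p ∈ γ, dist p u ≤ 2 * C ∧ Metric.infDist p A ≤ C := by
  have hC := hA.1
  by_cases ha : Metric.infDist a A ≤ C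
  · exact ⟨a, hγ.left_mem, by rw [hu.2]; linarith, ha⟩
  push Not at ha
  obtain ⟨p, hp, hpC, hout⟩ := first_hit hγ ha.le hy
  obtain ⟨γ', hsub, hγ', hw'⟩ := hγ.sub_left hp
  obtain ⟨v, hv⟩ := proj_nonempty hA.2.1 ⟨u, hu.1⟩ p
  have := hA.2.2 γ' a p hγ' (fun w hw => hout w (hsub hw) ((hw' w (hsub hw)).1 hw)) a hγ'.left_mem
    p hγ'.right_mem u hu v hv
  refine ⟨p, hp, ?_, hpC.le⟩
  calc dist p u ≤ dist p v + dist v u := dist_triangle _ _ _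
    _ ≤ C + C := by rw [hv.2, hpC, dist_comm v u]; linarith
    _ = 2 * C := by ring

/-- A geodesic whose endpoints have distant projections to a contracting set passes close to
both projections. -/
theorem bgi (hA : IsContracting C A) {γ : Set Y} {a b u v : Y} (hγ : IsGeodSegment γ a b)
    (hu : u ∈ proj A a) (hv : v ∈ proj A b) (huv : C < dist u v) :
    ∃ p ∈ γ, ∃ q ∈ γ, dist p u ≤ 2 * C ∧ dist q v ≤ 2 * C ∧ Metric.infDist p A ≤ C ∧
      Metric.infDist q A ≤ C ∧ dist a p ≤ dist a q := by
  obtain ⟨y, hy, hyC⟩ : ∃ y ∈ γ, Metric.infDist y A ≤ C := by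
    by_contra hcon
    push Not at hcon
    exact absurd (hA.2.2 γ a b hγ (fun p hp => (hcon p hp).le) a hγ.left_mem b hγ.right_mem
      u hu v hv) (not_le.2 huv)
  obtain ⟨γ₁, hs₁, hγ₁, hw₁⟩ := hγ.sub_left hy
  obtain ⟨γ₂, hs₂, hγ₂, hw₂⟩ := hγ.sub_right hy
  obtain ⟨p, hp, hpu, hpC⟩ := bgi_left hA hγ₁ hyC hu
  obtain ⟨q, hq, hqv, hqC⟩ := bgi_left hA hγ₂.symm hyC hv
  exact ⟨p, hs₁ hp, q, hs₂ hq, hpu, hqv, hpC, hqC,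
    ((hw₁ p (hs₁ hp)).1 hp).trans ((hw₂ q (hs₂ hq)).1 hq)⟩

/-- If the projections are more than `C` apart, a geodesic from `a` to `b` passes `2 * C`-close to
both of them by `bgi`. -/
theorem proj_lip (hY : IsGeodesicSpace Y) (hA : IsContracting C A) {a b u v : Y}
    (hu : u ∈ proj A a) (hv : v ∈ proj A b) : dist u v ≤ dist a b + 4 * C := by
  have hC := hA.1
  by_contra hcon
  push Not at hcon
  obtain ⟨γ, hγ⟩ := hY a b
  obtain ⟨p, hp, q, hq, hpu, hqv, -, -, hpq⟩ := bgi hA hγ hu hv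
    (by linarith [dist_nonneg (x := a) (y := b)])
  have h1 := hγ.dist_add_of_le hp hq hpq
  have h2 := hγ.dist_add hq
  have h3 := dist_triangle4 u p q v
  rw [dist_comm u p] at h3
  linarith [dist_nonneg (x := a) (y := p), dist_nonneg (x := q) (y := b)]

/-- Neighbourhoods of contracting sets are quasi-convex. -/
theorem quasiconvex (hA : IsContracting C A) (hne : A.Nonempty) {γ : Set Y} {a b w : Y} {r : ℝ}
    (hγ : IsGeodSegment γ a b) (hr : C ≤ r) (ha : Metric.infDist a A ≤ r)
    (hb : Metric.infDist b A ≤ r) (hw : w ∈ γ) : Metric.infDist w A ≤ 2 * r + C := by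
  have hC := hA.1
  by_cases hwr : Metric.infDist w A ≤ r
  · linarith
  push Not at hwr
  obtain ⟨γ₁, hs₁, hγ₁, hw₁⟩ := hγ.sub_left hw
  obtain ⟨γ₂, hs₂, hγ₂, hw₂⟩ := hγ.sub_right hw
  -- Here `p` is the last point before `w`, and `q` the first point after `w`, in the
  -- `r`-neighbourhood. In between the geodesic is far from `A`, whence `dist p q ≤ 2 * r + C`, and
  -- `w` lies between them.
  obtain ⟨p, hp, hpr, hpo⟩ := first_hit hγ₁.symm hwr.le ha
  obtain ⟨q, hq, hqr, hqo⟩ := first_hit hγ₂ hwr.le hb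
  have hpw : dist a p ≤ dist a w := (hw₁ p (hs₁ hp)).1 hp
  have hwq : dist a w ≤ dist a q := (hw₂ q (hs₂ hq)).1 hq
  obtain ⟨γ', hs', hγ', hw'⟩ := hγ.sub (hs₁ hp) (hs₂ hq) (hpw.trans hwq)
  obtain ⟨u, hu⟩ := proj_nonempty hA.2.1 hne p
  obtain ⟨v, hv⟩ := proj_nonempty hA.2.1 hne q
  have hout : ∀ z ∈ γ', C ≤ Metric.infDist z A := by
    intro z hz
    have hz' := (hw' z (hs' hz)).1 hz
    refine hr.trans ?_
    rcases le_total (dist a z) (dist a w) with hzw | hzw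
    · have hz1 : z ∈ γ₁ := (hw₁ z (hs' hz)).2 hzw
      refine hpo z hz1 ?_
      have h1 := hγ.dist_add_of_le (hs' hz) hw hzw
      have h2 := hγ.dist_add_of_le (hs₁ hp) hw hpw
      rw [dist_comm w z, dist_comm w p]; linarith [hz'.1]
    · have hz1 : z ∈ γ₂ := (hw₂ z (hs' hz)).2 hzw
      refine hqo z hz1 ?_
      have h1 := hγ.dist_add_of_le hw (hs' hz) hzw
      have h2 := hγ.dist_add_of_le hw (hs₂ hq) hwq
      linarith [hz'.2]
  have huv := hA.2.2 γ' p q hγ' hout p hγ'.left_mem q hγ'.right_mem u hu v hv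
  have h1 := dist_triangle4 p u v q
  have h2 := hu.2
  have h3 := hv.2
  rw [dist_comm q v] at h3
  have h4 := hγ.dist_add_of_le (hs₁ hp) hw hpw
  have h5 := hγ.dist_add_of_le hw (hs₂ hq) hwq
  have h6 := hγ.dist_add_of_le (hs₁ hp) (hs₂ hq) (hpw.trans hwq)
  have h7 := Metric.infDist_le_infDist_add_dist (s := A) (x := w) (y := p)
  have h8 := Metric.infDist_le_infDist_add_dist (s := A) (x := w) (y := q)
  rw [dist_comm w p] at h7
  linarith

/-- The Behrstock inequality for two contracting sets, each of which has small projection to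
the other. -/
theorem behrstock (hY : IsGeodesicSpace Y) {B : Set Y} (hA : IsContracting C A)
    (hB : IsContracting C B) (hAne : A.Nonempty) (hBne : B.Nonempty) {qA qB : Y} {θ : ℝ}
    (hBA : ∀ y ∈ B, ProjNear A y qA θ) (hAB : ∀ y ∈ A, ProjNear B y qB θ) {y u : Y}
    (hu : u ∈ proj A y) (hfar : θ + C < dist u qA) : ProjNear B y qB (θ + 6 * C) := by
  intro v hv
  -- As `v ∈ B`, its projection `u'` to `A` is close to `qA`, hence far from `u`. So the geodesic
  -- from `y` to `v` passes by `u'` at a point `q`. Now `v` is a projection of `q` too, and `u' ∈ A`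
  -- projects to `B` close to `qB`. The `6 * C` is `2 * C` from `bgi` plus `4 * C` from `proj_lip`.
  obtain ⟨u', hu'⟩ := proj_nonempty hA.2.1 hAne v
  have h1 := hBA v hv.1 u' hu'
  obtain ⟨γ, hγ⟩ := hY y v
  obtain ⟨-, -, q, hq, -, hqu, -⟩ := bgi hA hγ hu hu' (by
    linarith [dist_triangle u u' qA])
  have hvq := proj_subgeod hv hγ hq
  obtain ⟨v', hv'⟩ := proj_nonempty hB.2.1 hBne u'
  have h2 := hAB u' hu'.1 v' hv'
  have h3 := proj_lip hY hB hvq hv'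
  linarith [dist_triangle v v' qB]

/-- Projections to closed sets at finite Hausdorff distance are close, if one of the sets is
contracting. -/
theorem proj_dist_of_close (hY : IsGeodesicSpace Y) {B : Set Y} {D : ℝ} (hA : IsContracting C A)
    (hne : A.Nonempty) (hBA : ∀ y ∈ B, Metric.infDist y A ≤ D)
    (hAB : ∀ y ∈ A, Metric.infDist y B ≤ D) {p u v : Y} (hu : u ∈ proj A p) (hv : v ∈ proj B p) :
    dist u v ≤ D + 4 * C := by
  have hC := hA.1
  obtain ⟨w, hw⟩ := proj_nonempty hA.2.1 hne v
  have h1 := hBA v hv.1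
  have h1' := hw.2
  have hD : 0 ≤ D := Metric.infDist_nonneg.trans h1
  by_cases huw : dist u w ≤ C
  · linarith [dist_triangle u w v, dist_comm v w]
  push Not at huw
  obtain ⟨γ, hγ⟩ := hY p v
  obtain ⟨q, hq, -, -, hqu, -⟩ := bgi hA hγ hu hw huw
  have h2 := hγ.dist_add hq
  have h3 : dist p v ≤ dist p u + D := by
    rw [hv.2]
    have := Metric.infDist_le_infDist_add_dist (s := B) (x := p) (y := u)
    linarith [hAB u hu.1]
  linarith [dist_triangle p q u, dist_triangle u q v, dist_comm u q]

/-- Far from `B` means far from `A`. Replacing the two projections to `B` by projections to `A`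
costs `D + 4 * C` each, in addition to the bound `C` for `A`. -/
theorem IsContracting.of_close (hY : IsGeodesicSpace Y) {B : Set Y} {D : ℝ}
    (hA : IsContracting C A)
    (hne : A.Nonempty) (hBne : B.Nonempty) (hB : IsClosed B) (hBA : ∀ y ∈ B, Metric.infDist y A ≤ D)
    (hAB : ∀ y ∈ A, Metric.infDist y B ≤ D) : IsContracting (2 * D + 9 * C) B := by
  have hC := hA.1
  have hD : 0 ≤ D := by
    obtain ⟨y, hy⟩ := hBne
    exact Metric.infDist_nonneg.trans (hBA y hy)
  refine ⟨by linarith, hB, fun γ a b hγ hout p hp q hq u hu v hv => ?_⟩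
  obtain ⟨u', hu'⟩ := proj_nonempty hA.2.1 hne p
  obtain ⟨v', hv'⟩ := proj_nonempty hA.2.1 hne q
  have hout' : ∀ z ∈ γ, C ≤ Metric.infDist z A := by
    intro z hz
    obtain ⟨z', hz'⟩ := proj_nonempty hA.2.1 hne z
    have h1 := Metric.infDist_le_infDist_add_dist (s := B) (x := z) (y := z')
    linarith [hAB z' hz'.1, hout z hz, hz'.2]
  have h1 := hA.2.2 γ a b hγ hout' p hp q hq u' hu' v' hv'
  have h2 := proj_dist_of_close hY hA hne hBA hAB hu' hu
  have h3 := proj_dist_of_close hY hA hne hBA hAB hv' hv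
  rw [dist_comm] at h2
  linarith [dist_triangle4 u u' v' v]

end Projections

/-! ### Chains of contracting sets and their gates -/

section Chains

variable {Y : Type*} [MetricSpace Y]

theorem IsGeodSegment.exists_sub {γ : Set Y} {x y p q : Y} (h : IsGeodSegment γ x y) (hp : p ∈ γ)
    (hq : q ∈ γ) : ∃ γ' ⊆ γ, IsGeodSegment γ' p q := by
  rcases le_total (dist x p) (dist x q) with h1 | h1
  · obtain ⟨γ', h2, h3, -⟩ := h.sub hp hq h1
    exact ⟨γ', h2, h3⟩
  · obtain ⟨γ', h2, h3, -⟩ := h.sub hq hp h1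
    exact ⟨γ', h2, h3.symm⟩

/-- A bi-infinite sequence of contracting sets, such that the predecessor of a set projects to it
close to the point `l t`, and the successor close to a distant point `r t`. -/
structure Chain (C θ : ℝ) (B : ℤ → Set Y) (l r : ℤ → Y) : Prop where
  contr : ∀ t, IsContracting C (B t)
  ne : ∀ t, (B t).Nonempty
  nonneg : 0 ≤ θ
  left : ∀ t, ∀ y ∈ B (t - 1), ProjNear (B t) y (l t) θ
  right : ∀ t, ∀ y ∈ B (t + 1), ProjNear (B t) y (r t) θ
  sep : ∀ t, 100 * (C + θ) < dist (l t) (r t)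

/-- The point `y` projects to the member `B t` of a chain close to the gate `l t`. -/
def Gate (C θ : ℝ) (B : ℤ → Set Y) (l : ℤ → Y) (t : ℤ) (y : Y) : Prop :=
  ProjNear (B t) y (l t) (θ + 6 * C)

namespace Chain

variable {C θ : ℝ} {B : ℤ → Set Y} {l r : ℤ → Y}

theorem one_le (ch : Chain C θ B l r) : 1 ≤ C := (ch.contr 0).1

theorem reverse (ch : Chain C θ B l r) :
    Chain C θ (fun t => B (-t)) (fun t => r (-t)) (fun t => l (-t)) where
  contr t := ch.contr _
  ne t := ch.ne _
  nonneg := ch.nonneg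
  left t y hy := ch.right _ y (by rwa [show -(t - 1) = -t + 1 by ring] at hy)
  right t y hy := ch.left _ y (by rwa [show -(t + 1) = -t - 1 by ring] at hy)
  sep t := by rw [dist_comm]; exact ch.sep _

variable [ProperSpace Y]

theorem proj_nonempty (ch : Chain C θ B l r) (t : ℤ) (y : Y) : (proj (B t) y).Nonempty :=
  ConvBdry.proj_nonempty (ch.contr t).2.1 (ch.ne t) y

theorem not_gate_right (ch : Chain C θ B l r) {t : ℤ} {y : Y} (h : Gate C θ B l t y) :
    ¬ Gate C θ B r t y := by
  intro h'
  obtain ⟨u, hu⟩ := ch.proj_nonempty t y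
  have h1 := h u hu
  have h2 := h' u hu
  have h3 := ch.sep t
  have h4 := ch.one_le
  have h5 := ch.nonneg
  linarith [dist_triangle_left (l t) (r t) u]

/-- By Behrstock, a point that projects to `B t` away from the gate `l t`, through which `B (t - 1)`
is seen, projects to `B (t - 1)` at the gate facing `B t`. As the two gates are far apart, it then
misses `l (t - 1)`, and the argument goes on to the left without loss in the constants. Thus every
point has a definite position along the chain, up to one index. -/
theorem gate_right_of_not_left (hY : IsGeodesicSpace Y) (ch : Chain C θ B l r) {t s : ℤ} {y : Y}
    (h : ¬ Gate C θ B l t y) (hs : s < t) : Gate C θ B r s y := by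
  have step : ∀ t, ¬ Gate C θ B l t y → Gate C θ B r (t - 1) y := by
    intro t ht
    simp only [Gate, ProjNear] at ht
    push Not at ht
    obtain ⟨u, hu, hfar⟩ := ht
    have h4 := ch.one_le
    refine behrstock hY (ch.contr t) (ch.contr (t - 1)) (ch.ne _) (ch.ne _) (ch.left t)
      (fun y hy => ch.right (t - 1) y (by simpa using hy)) hu (by linarith)
  have main : ∀ n : ℕ, Gate C θ B r (t - 1 - n) y := by
    intro n
    induction n with
    | zero => simpa using step t h
    | succ n ih =>
      have := step (t - 1 - n) (fun hl => ch.not_gate_right hl ih)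
      rwa [show t - 1 - ((n + 1 : ℕ) : ℤ) = t - 1 - n - 1 by push_cast; ring]
  have := main (t - 1 - s).toNat
  rwa [Int.toNat_of_nonneg (by omega), show t - 1 - (t - 1 - s) = s by ring] at this

theorem gate_left_of_not_right (hY : IsGeodesicSpace Y) (ch : Chain C θ B l r) {t s : ℤ} {y : Y}
    (h : ¬ Gate C θ B r t y) (hs : t < s) : Gate C θ B l s y := by
  have := ch.reverse.gate_right_of_not_left hY (t := -t) (s := -s) (y := y)
    (by simpa [Gate] using h) (by omega)
  simpa [Gate] using this

theorem gate_left_mono (hY : IsGeodesicSpace Y) (ch : Chain C θ B l r) {t s : ℤ} {y : Y}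
    (h : Gate C θ B l t y) (hs : t ≤ s) : Gate C θ B l s y := by
  rcases hs.eq_or_lt with rfl | hs
  · exact h
  · exact ch.gate_left_of_not_right hY (ch.not_gate_right h) hs

theorem gate_right_mono (hY : IsGeodesicSpace Y) (ch : Chain C θ B l r) {t s : ℤ} {y : Y}
    (h : Gate C θ B r t y) (hs : s ≤ t) : Gate C θ B r s y := by
  rcases hs.eq_or_lt with rfl | hs
  · exact h
  · exact ch.gate_right_of_not_left hY (fun h' => ch.not_gate_right h' h) hs

theorem gate_left_of_mem (hY : IsGeodesicSpace Y) (ch : Chain C θ B l r) {t s : ℤ} {y : Y}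
    (hy : y ∈ B s) (hs : s < t) : Gate C θ B l t y := by
  refine ch.gate_left_mono hY (t := s + 1) ?_ hs
  exact (ch.left (s + 1) y (by simpa using hy)).mono (by linarith [ch.one_le])

theorem gate_right_of_mem (hY : IsGeodesicSpace Y) (ch : Chain C θ B l r) {t s : ℤ} {y : Y}
    (hy : y ∈ B s) (hs : t < s) : Gate C θ B r t y := by
  refine ch.gate_right_mono hY (t := s - 1) ?_ (by omega)
  exact (ch.right (s - 1) y (by simpa using hy)).mono (by linarith [ch.one_le])

theorem crossing (ch : Chain C θ B l r) {t : ℤ} {x y : Y} {γ : Set Y} (hγ : IsGeodSegment γ x y)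
    (hx : Gate C θ B l t x) (hy : Gate C θ B r t y) :
    ∃ p ∈ γ, ∃ q ∈ γ, dist p (l t) ≤ θ + 8 * C ∧ dist q (r t) ≤ θ + 8 * C ∧
      dist x p ≤ dist x q := by
  obtain ⟨u, hu⟩ := ch.proj_nonempty t x
  obtain ⟨v, hv⟩ := ch.proj_nonempty t y
  have h1 := hx u hu
  have h2 := hy v hv
  have h3 := ch.sep t
  have h4 := ch.one_le
  have h5 := ch.nonneg
  have h6 := dist_triangle4 (l t) u v (r t)
  rw [dist_comm (l t) u] at h6
  obtain ⟨p, hp, q, hq, hpu, hqv, -, -, hpq⟩ := bgi (ch.contr t) hγ hu hv (by linarith)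
  exact ⟨p, hp, q, hq, by linarith [dist_triangle p u (l t)],
    by linarith [dist_triangle q v (r t)], hpq⟩

/-- A geodesic from `x` to `y` crosses the members one after the other, and each crossing has length
at least 1 because the gates are separated. -/
theorem le_dist (hY : IsGeodesicSpace Y) (ch : Chain C θ B l r) (n : ℕ) : ∀ {s : ℤ} {x y : Y},
    Gate C θ B l s x → Gate C θ B r (s + n) y → (n + 1 : ℝ) ≤ dist x y := by
  have h4 := ch.one_le
  have h5 := ch.nonneg
  induction n with
  | zero =>
    intro s x y hx hy
    simp only [Nat.cast_zero, add_zero] at hy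
    obtain ⟨u, hu⟩ := ch.proj_nonempty s x
    obtain ⟨v, hv⟩ := ch.proj_nonempty s y
    have h1 := hx u hu
    have h2 := hy v hv
    have h3 := ch.sep s
    have h6 := dist_triangle4 (l s) u v (r s)
    rw [dist_comm (l s) u] at h6
    have h7 := proj_lip hY (ch.contr s) hu hv
    push_cast
    linarith
  | succ n ih =>
    intro s x y hx hy
    have hys : Gate C θ B r s y := ch.gate_right_mono hY hy (by push_cast; omega)
    obtain ⟨γ, hγ⟩ := hY x y
    obtain ⟨u, hu⟩ := ch.proj_nonempty s x
    obtain ⟨v, hv⟩ := ch.proj_nonempty s y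
    have h1 := hx u hu
    have h2 := hys v hv
    have h3 := ch.sep s
    have h6 := dist_triangle4 (l s) u v (r s)
    rw [dist_comm (l s) u] at h6
    obtain ⟨p, hp, q, hq, hpu, hqv, -, -, hpq⟩ := bgi (ch.contr s) hγ hu hv (by linarith)
    have h7 := hγ.dist_add_of_le hp hq hpq
    have h8 := dist_triangle4 u p q v
    rw [dist_comm u p] at h8
    -- After the crossing, `q` is `2 * C`-close to `v ∈ B s`, so `q` projects to the next member
    -- near its left gate. The error `2 * C + 4 * C` is exactly the one allowed in `Gate`, which
    -- keeps the induction going.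
    have hq' : Gate C θ B l (s + 1) q := by
      intro z hz
      obtain ⟨z', hz'⟩ := ch.proj_nonempty (s + 1) v
      have h9 := ch.left (s + 1) v (by simpa using hv.1) z' hz'
      have h10 := proj_lip hY (ch.contr (s + 1)) hz hz'
      linarith [dist_triangle z z' (l (s + 1))]
    have h11 := ih hq' (y := y) (by
      rwa [show s + 1 + (n : ℤ) = s + ((n + 1 : ℕ) : ℤ) by push_cast; ring])
    have h12 := hγ.dist_add hq
    push_cast
    linarith [dist_nonneg (x := x) (y := p)]

theorem le_dist' (hY : IsGeodesicSpace Y) (ch : Chain C θ B l r) {s t : ℤ} {x y : Y}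
    (hx : Gate C θ B l s x) (hy : Gate C θ B r t y) : (t - s + 1 : ℝ) ≤ dist x y := by
  rcases le_or_gt s t with h | h
  · have := ch.le_dist hY (t - s).toNat hx (y := y) (by
      rw [Int.toNat_of_nonneg (by omega)]; simpa using hy)
    have h2 : (((t - s).toNat : ℤ) : ℝ) = ((t - s : ℤ) : ℝ) := by
      rw [Int.toNat_of_nonneg (by omega)]
    push_cast at h2
    linarith
  · have : ((t + 1 : ℤ) : ℝ) ≤ s := by exact_mod_cast h
    push_cast at this
    linarith [dist_nonneg (x := x) (y := y)]

/-- Otherwise `x` would lie on the right of `B t`, and the geodesic would visit `r t`, then `l t`,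
then `r t` again, contradicting that it is geodesic, since `l t` is far from `r t`. One index is
lost in the alternative of `gate_right_of_not_left`. -/
theorem no_backtrack (hY : IsGeodesicSpace Y) (ch : Chain C θ B l r) {t : ℤ} {x z w₁ w₂ : Y}
    {γ : Set Y} (hγ : IsGeodSegment γ x z) (h₁ : w₁ ∈ γ) (h₂ : w₂ ∈ γ)
    (h₁₂ : dist x w₁ ≤ dist x w₂) (hw₁ : Gate C θ B l t w₁) (hw₂ : Gate C θ B r t w₂) :
    Gate C θ B l (t + 1) x := by
  by_contra hcon
  have hx := ch.gate_right_of_not_left hY hcon (s := t) (by omega)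
  obtain ⟨γ₁, hs₁, hγ₁, hm₁⟩ := hγ.sub_left h₁
  obtain ⟨γ₂, hs₂, hγ₂, hm₂⟩ := hγ.sub h₁ h₂ h₁₂
  obtain ⟨p, hp, q, hq, hpl, hqr, hpq⟩ := ch.crossing hγ₁.symm hw₁ hx
  obtain ⟨-, -, q', hq', -, hqr', -⟩ := ch.crossing hγ₂ hw₁ hw₂
  have h3 := ch.sep t
  have h4 := ch.one_le
  have h5 := ch.nonneg
  have e1 := hγ₁.dist_add hp
  have e2 := hγ₁.dist_add hq
  rw [dist_comm p] at e1
  rw [dist_comm q] at e2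
  have e3 := (hm₂ q' (hs₂ hq')).1 hq'
  have e4 := hγ.dist_add_of_le (hs₁ hq) (hs₁ hp) (by linarith)
  have e5 := hγ.dist_add_of_le (hs₁ hq) (hs₂ hq') (by linarith [(hm₁ q (hs₁ hq)).1 hq])
  have e6 := dist_triangle4 (l t) p q (r t)
  rw [dist_comm (l t) p, dist_comm p q] at e6
  have e7 := dist_triangle q (r t) q'
  rw [dist_comm (r t) q'] at e7
  linarith [(hm₁ p (hs₁ hp)).1 hp]

theorem no_backtrack' (hY : IsGeodesicSpace Y) (ch : Chain C θ B l r) {t : ℤ} {x z w₁ w₂ : Y}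
    {γ : Set Y} (hγ : IsGeodSegment γ x z) (h₁ : w₁ ∈ γ) (h₂ : w₂ ∈ γ)
    (h₁₂ : dist x w₁ ≤ dist x w₂) (hw₁ : Gate C θ B l t w₁) (hw₂ : Gate C θ B r t w₂) :
    Gate C θ B r (t - 1) z := by
  have e1 := hγ.dist_add h₁
  have e2 := hγ.dist_add h₂
  have := ch.reverse.no_backtrack hY (t := -t) hγ.symm h₂ h₁
    (by rw [dist_comm z, dist_comm z]; linarith)
    (by simpa [Gate] using hw₂) (by simpa [Gate] using hw₁)
  simpa [Gate, sub_eq_add_neg, add_comm] using this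

end Chain

end Chains

/-! ### Periodic chains; an element shifting a chain is contracting -/

section Periodic

variable {G Y : Type*} [Group G] [MetricSpace Y] [MulAction G Y]

/-- A chain on which `f` acts as the shift by `P`. -/
structure PeriodicChain (f : G) (P : ℤ) (C θ : ℝ) (B : ℤ → Set Y) (l r : ℤ → Y) : Prop
    extends Chain C θ B l r where
  pos : 0 < P
  smul_set : ∀ t, B (t + P) = f • B t
  smul_left : ∀ t, l (t + P) = f • l t
  smul_right : ∀ t, r (t + P) = f • r t

theorem finite_dist_smul_le {o : Y} (hproper : IsProperAction G Y) (x : Y) (R : ℝ) :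
    {g : G | dist x (g • o) ≤ R}.Finite := by
  refine (hproper o (dist o x + R)).subset fun g hg => ?_
  exact (dist_triangle o x _).trans (by have : dist x (g • o) ≤ R := hg; linarith)

/-- By properness, a ball meets the orbit in a finite set, so every subset of the orbit is closed.
-/
theorem isClosed_orbit_subset {o : Y} (hproper : IsProperAction G Y) (T : Set G) :
    IsClosed ((fun g : G => g • o) '' T) := by
  refine isClosed_of_closure_subset fun y hy => ?_
  have hfin : (((fun g : G => g • o) '' T) ∩ Metric.closedBall y 1).Finite := by
    refine ((finite_dist_smul_le (o := o) hproper y 1).image (fun g : G => g • o)).subset ?_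
    rintro _ ⟨⟨g, -, rfl⟩, hg⟩
    exact ⟨g, by simpa [dist_comm] using hg, rfl⟩
  have : y ∈ closure (((fun g : G => g • o) '' T) ∩ Metric.closedBall y 1) := by
    rw [mem_closure_iff_nhds] at hy ⊢
    intro U hU
    obtain ⟨z, ⟨hz1, hz2⟩, hz3⟩ := hy _ (inter_mem hU (Metric.closedBall_mem_nhds y one_pos))
    exact ⟨z, hz1, hz3, hz2⟩
  rw [hfin.isClosed.closure_eq] at this
  exact this.1

theorem cyclicOrbit_eq (o : Y) (h : G) :
    cyclicOrbit o h = (fun g : G => g • o) '' range (fun n : ℤ => h ^ n) := by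
  rw [← range_comp]; rfl

theorem isClosed_cyclicOrbit {o : Y} (hproper : IsProperAction G Y) (h : G) :
    IsClosed (cyclicOrbit o h) := by
  rw [cyclicOrbit_eq]; exact isClosed_orbit_subset hproper _

theorem zpow_mem_cyclicOrbit (o : Y) (h : G) (n : ℤ) : h ^ n • o ∈ cyclicOrbit o h := ⟨n, rfl⟩

theorem cyclicOrbit_nonempty (o : Y) (h : G) : (cyclicOrbit o h).Nonempty :=
  ⟨_, zpow_mem_cyclicOrbit o h 0⟩

theorem cyclicOrbit_inv (o : Y) (h : G) : cyclicOrbit o h⁻¹ = cyclicOrbit o h := by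
  ext y; constructor
  · rintro ⟨n, rfl⟩; exact ⟨-n, by simp⟩
  · rintro ⟨n, rfl⟩; exact ⟨-n, by simp⟩

variable [IsIsometricSMul G Y]

theorem dist_zpow_zpow (o : Y) (h : G) (m n : ℤ) :
    dist (h ^ m • o) (h ^ n • o) = dist o (h ^ (n - m) • o) := by
  rw [← dist_smul (h ^ m) o, ← mul_smul, ← zpow_add]; simp

theorem dist_zpow_le (o : Y) (h : G) (m n : ℤ) :
    dist (h ^ m • o) (h ^ n • o) ≤ |(m : ℝ) - n| * dist o (h • o) := by
  have key : ∀ k : ℕ, dist o (h ^ k • o) ≤ k * dist o (h • o) := by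
    intro k
    induction k with
    | zero => simp
    | succ k ih =>
      have h1 : dist (h ^ k • o) (h ^ (k + 1) • o) = dist o (h • o) := by
        rw [pow_succ, mul_smul, dist_smul]
      push_cast
      linarith [dist_triangle o (h ^ k • o) (h ^ (k + 1) • o)]
  rcases le_total m n with hmn | hmn
  · rw [dist_zpow_zpow]
    obtain ⟨k, hk⟩ := Int.eq_ofNat_of_zero_le (sub_nonneg.2 hmn)
    have : |(m : ℝ) - n| = k := by
      rw [abs_sub_comm, ← Int.cast_sub, hk]; simp
    rw [hk, this]; simpa using key k
  · rw [dist_comm, dist_zpow_zpow]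
    obtain ⟨k, hk⟩ := Int.eq_ofNat_of_zero_le (sub_nonneg.2 hmn)
    have : |(m : ℝ) - n| = k := by
      rw [← Int.cast_sub, hk]; simp
    rw [hk, this]; simpa using key k

namespace PeriodicChain

variable {f : G} {P : ℤ} {C θ : ℝ} {B : ℤ → Set Y} {l r : ℤ → Y}

theorem reverse (ch : PeriodicChain f P C θ B l r) :
    PeriodicChain f⁻¹ P C θ (fun t => B (-t)) (fun t => r (-t)) (fun t => l (-t)) where
  toChain := ch.toChain.reverse
  pos := ch.pos
  smul_set t := by
    have := ch.smul_set (-(t + P))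
    rw [show -(t + P) + P = -t by ring] at this
    simp [this]
  smul_left t := by
    have := ch.smul_right (-(t + P))
    rw [show -(t + P) + P = -t by ring] at this
    simp [this]
  smul_right t := by
    have := ch.smul_left (-(t + P))
    rw [show -(t + P) + P = -t by ring] at this
    simp [this]

theorem zpow_aux {α : Type*} [MulAction G α] {f : G} {P : ℤ} {u : ℤ → α}
    (h : ∀ t, u (t + P) = f • u t) (t n : ℤ) : u (t + P * n) = f ^ n • u t := by
  induction n using Int.induction_on with
  | zero => simp
  | succ n ih =>
    rw [show t + P * ((n : ℤ) + 1) = t + P * n + P by ring, h, ih, ← mul_smul, ← zpow_one_add,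
      add_comm]
  | pred n ih =>
    have := h (t + P * (-(n : ℤ) - 1))
    rw [show t + P * (-(n : ℤ) - 1) + P = t + P * -n by ring, ih] at this
    apply MulAction.injective f
    simp only
    rw [← this, ← mul_smul, ← zpow_one_add]
    congr 2; ring

theorem set_zpow (ch : PeriodicChain f P C θ B l r) (t n : ℤ) : B (t + P * n) = f ^ n • B t :=
  zpow_aux ch.smul_set t n

theorem left_zpow (ch : PeriodicChain f P C θ B l r) (t n : ℤ) : l (t + P * n) = f ^ n • l t :=
  zpow_aux ch.smul_left t n

theorem right_zpow (ch : PeriodicChain f P C θ B l r) (t n : ℤ) : r (t + P * n) = f ^ n • r t :=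
  zpow_aux ch.smul_right t n

theorem gate_left_zpow (ch : PeriodicChain f P C θ B l r) {t n : ℤ} {y : Y} :
    Gate C θ B l (t + P * n) (f ^ n • y) ↔ Gate C θ B l t y := by
  rw [Gate, ch.set_zpow, ch.left_zpow, projNear_smul, Gate]

theorem gate_right_zpow (ch : PeriodicChain f P C θ B l r) {t n : ℤ} {y : Y} :
    Gate C θ B r (t + P * n) (f ^ n • y) ↔ Gate C θ B r t y := by
  rw [Gate, ch.set_zpow, ch.right_zpow, projNear_smul, Gate]

variable [ProperSpace Y]

/-- Gates of points close to an orbit of `f`. -/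
theorem exists_gate_of_near (hY : IsGeodesicSpace Y) (ch : PeriodicChain f P C θ B l r) (o : Y)
    (ρ : ℝ) : ∃ c : ℤ, 0 < c ∧ ∀ (n : ℤ) (w : Y), dist w (f ^ n • o) ≤ ρ →
      (∀ t, P * n + c ≤ t → Gate C θ B l t w) ∧ (∀ t, t ≤ P * n - c → Gate C θ B r t w) := by
  obtain ⟨b, hb⟩ := ch.ne 0
  obtain ⟨c, hc⟩ := exists_nat_gt (ρ + dist o b + 1)
  refine ⟨c + 1, by positivity, fun n w hw => ?_⟩
  have hd : dist (f ^ n • b) w ≤ ρ + dist o b := by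
    have : dist (f ^ n • o) (f ^ n • b) = dist o b := dist_smul _ _ _
    rw [dist_comm]
    linarith [dist_triangle w (f ^ n • o) (f ^ n • b)]
  have hbm : f ^ n • b ∈ B (P * n) := by
    have := ch.set_zpow 0 n
    rw [zero_add] at this
    rw [this]; exact Set.smul_mem_smul_set hb
  constructor
  · intro t ht
    -- If the gate fails at `t`, then `w` lies on the right of all members between `P * n` and `t`.
    -- These separate it from `f ^ n • b ∈ B (P * n)`, and `le_dist'` contradicts the bound `hd`.
    by_contra hcon
    have h1 := ch.gate_right_of_not_left hY hcon (s := t - 1) (by omega)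
    have h2 := ch.gate_left_of_mem hY hbm (t := P * n + 1) (by omega)
    have h3 := ch.le_dist' hY h2 h1
    have h4 : ((P * n + (c + 1) : ℤ) : ℝ) ≤ t := by exact_mod_cast ht
    push_cast at h3 h4
    linarith
  · intro t ht
    by_contra hcon
    have h1 := ch.gate_left_of_not_right hY hcon (s := t + 1) (by omega)
    have h2 := ch.gate_right_of_mem hY hbm (t := P * n - 1) (by omega)
    have h3 := ch.le_dist' hY h1 h2
    have h4 : (t : ℝ) ≤ ((P * n - (c + 1) : ℤ) : ℝ) := by exact_mod_cast ht
    push_cast at h3 h4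
    rw [dist_comm] at h3
    linarith

theorem exists_le_dist (hY : IsGeodesicSpace Y) (ch : PeriodicChain f P C θ B l r) (o : Y) :
    ∃ c : ℝ, ∀ m n : ℤ, |(m : ℝ) - n| - c ≤ dist (f ^ m • o) (f ^ n • o) := by
  obtain ⟨c, -, hc⟩ := ch.exists_gate_of_near hY o 0
  have key : ∀ m n : ℤ, m ≤ n → |(m : ℝ) - n| - 2 * c ≤ dist (f ^ m • o) (f ^ n • o) := by
    intro m n hmn
    have h1 := ((hc m _ (dist_self _).le).1 _ le_rfl)
    have h2 := ((hc n _ (dist_self _).le).2 _ le_rfl)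
    have h3 := ch.le_dist' hY h1 h2
    have h4 : (m : ℝ) ≤ n := by exact_mod_cast hmn
    have h5 : (1 : ℝ) ≤ P := by exact_mod_cast ch.pos
    rw [abs_sub_comm, abs_of_nonneg (sub_nonneg.2 h4)]
    push_cast at h3
    nlinarith
  refine ⟨2 * c, fun m n => ?_⟩
  rcases le_total m n with h | h
  · exact key m n h
  · rw [dist_comm, abs_sub_comm]; exact key n m h

/-- If `y` were far to the right of its nearest orbit point `f ^ i • o`, the geodesic from that
point to `y` would cross a member near `f ^ (i + m) • o`, for a large fixed `m`. That orbit point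
would then be closer to `y`. -/
theorem exists_gate_left_of_proj (hY : IsGeodesicSpace Y) (ch : PeriodicChain f P C θ B l r)
    (o : Y) : ∃ c : ℤ, 0 < c ∧ ∀ (y : Y) (i : ℤ), f ^ i • o ∈ proj (cyclicOrbit o f) y →
      ∀ t, P * i + c ≤ t → Gate C θ B l t y := by
  obtain ⟨c₀, hc₀, h₀⟩ := ch.exists_gate_of_near hY o 0
  obtain ⟨c₁, h₁⟩ := ch.exists_le_dist hY o
  set D := θ + 8 * C + dist (r 0) o with hD
  obtain ⟨k, hk⟩ := exists_nat_gt (2 * D + c₁)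
  set m : ℤ := c₀ + k
  have hm : 0 < m := by omega
  have hP := ch.pos
  refine ⟨P * m + 1, by positivity, fun y i hi t ht => ?_⟩
  by_contra hcon
  have e : P * (i + m) = P * i + P * m := by ring
  have hPm : m ≤ P * m := by nlinarith
  have h2 := ch.gate_right_of_not_left hY hcon (s := P * (i + m)) (by omega)
  have h3 := (h₀ i _ (dist_self _).le).1 (P * (i + m)) (by omega)
  obtain ⟨γ, hγ⟩ := hY (f ^ i • o) y
  obtain ⟨-, -, q, hq, -, hqr, -⟩ := ch.crossing hγ h3 h2
  have h4 := ch.right_zpow 0 (i + m)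
  rw [zero_add] at h4
  have h5 : dist q (f ^ (i + m) • o) ≤ D := by
    have : dist (r (P * (i + m))) (f ^ (i + m) • o) = dist (r 0) o := by rw [h4, dist_smul]
    linarith [dist_triangle q (r (P * (i + m))) (f ^ (i + m) • o)]
  have h6 := h₁ i (i + m)
  have h7 : (k : ℝ) ≤ |(i : ℝ) - (i + m : ℤ)| := by
    have : (k : ℝ) ≤ m := by exact_mod_cast (show (k : ℤ) ≤ m by omega)
    push_cast
    rw [abs_sub_comm, add_sub_cancel_left]
    exact this.trans (le_abs_self _)
  have h8 := hγ.dist_add hq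
  have h9 : dist y (f ^ i • o) ≤ dist y (f ^ (i + m) • o) := by
    rw [hi.2]; exact Metric.infDist_le_dist_of_mem (zpow_mem_cyclicOrbit o f _)
  have h10 := dist_triangle y q (f ^ (i + m) • o)
  have h11 := dist_triangle (f ^ i • o) q (f ^ (i + m) • o)
  rw [dist_comm y q] at h10
  rw [dist_comm y] at h9
  linarith

theorem exists_gate_of_proj (hY : IsGeodesicSpace Y) (ch : PeriodicChain f P C θ B l r)
    (o : Y) : ∃ c : ℤ, 0 < c ∧ ∀ (y : Y) (i : ℤ), f ^ i • o ∈ proj (cyclicOrbit o f) y →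
      (∀ t, P * i + c ≤ t → Gate C θ B l t y) ∧ (∀ t, t ≤ P * i - c → Gate C θ B r t y) := by
  obtain ⟨c, hc, h⟩ := ch.exists_gate_left_of_proj hY o
  obtain ⟨c', hc', h'⟩ := ch.reverse.exists_gate_left_of_proj hY o
  refine ⟨max c c', by positivity, fun y i hi => ⟨fun t ht => h y i hi t
    (by have := le_max_left c c'; omega), fun t ht => ?_⟩⟩
  have := h' y (-i) (by rwa [cyclicOrbit_inv, inv_zpow', neg_neg]) (-t)
    (by have := le_max_right c c'; rw [mul_neg]; omega)
  simpa [Gate] using this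

/-- The chain gives a linear lower bound for the orbit map, hence infinite order and the
quasi-isometric embedding. A geodesic with two projections to the orbit of far apart indices crosses
a member in between, so it passes within `D` of the orbit; far from the orbit this is impossible. -/
theorem isContractingElt (hY : IsGeodesicSpace Y) (hproper : IsProperAction G Y)
    (ch : PeriodicChain f P C θ B l r) (o : Y) : IsContractingElt o f := by
  obtain ⟨c₁, h₁⟩ := ch.exists_le_dist hY o
  obtain ⟨c, hc, h⟩ := ch.exists_gate_of_proj hY o
  refine ⟨?_, ?_, ?_⟩
  · intro hfin
    obtain ⟨n, hn, hfn⟩ := isOfFinOrder_iff_pow_eq_one.1 hfin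
    obtain ⟨k, hk⟩ := exists_nat_gt c₁
    have h2 := h₁ 0 (n * k)
    have h3 : f ^ ((n : ℤ) * k) = 1 := by
      rw [zpow_mul, zpow_natCast f n, hfn, one_zpow]
    have h4 : (1 : ℝ) ≤ n := by exact_mod_cast hn
    rw [h3] at h2
    simp only [Int.cast_zero, zero_sub, abs_neg, zpow_zero, dist_self, Int.cast_mul,
      Int.cast_natCast] at h2
    rw [abs_of_nonneg (by positivity)] at h2
    nlinarith [Nat.cast_nonneg (α := ℝ) k]
  · set D := θ + 8 * C + dist (r 0) o with hD
    have hD0 : 0 ≤ D := by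
      have := ch.one_le
      have := ch.nonneg
      positivity
    refine ⟨D + 1 + 2 * c * dist o (f • o), ?_, isClosed_cyclicOrbit hproper f, ?_⟩
    · have : (0 : ℝ) ≤ c := by exact_mod_cast hc.le
      have : 0 ≤ 2 * c * dist o (f • o) := by positivity
      linarith
    intro γ a b hγ hout p hp q hq u hu v hv
    obtain ⟨i, rfl⟩ := hu.1
    obtain ⟨j, rfl⟩ := hv.1
    have main : ∀ (p q : Y) (i j : ℤ), p ∈ γ → q ∈ γ → f ^ i • o ∈ proj (cyclicOrbit o f) p →
        f ^ j • o ∈ proj (cyclicOrbit o f) q → j - i ≤ 2 * c := by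
      intro p q i j hp hq hi hj
      by_contra hcon
      push Not at hcon
      have hP := ch.pos
      have e1 : P * i + c ≤ P * (i + c) := by nlinarith
      have e2 : P * (i + c) ≤ P * j - c := by nlinarith
      obtain ⟨γ', hs', hγ'⟩ := hγ.exists_sub hp hq
      obtain ⟨-, -, w, hw, -, hwr, -⟩ :=
        ch.crossing hγ' ((h p i hi).1 _ e1) ((h q j hj).2 _ e2)
      have h4 := ch.right_zpow 0 (i + c)
      rw [zero_add] at h4
      have h5 : dist w (f ^ (i + c) • o) ≤ D := by
        have : dist (r (P * (i + c))) (f ^ (i + c) • o) = dist (r 0) o := by rw [h4, dist_smul]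
        linarith [dist_triangle w (r (P * (i + c))) (f ^ (i + c) • o)]
      have h6 := hout w (hs' hw)
      have h7 := Metric.infDist_le_dist_of_mem (x := w) (zpow_mem_cyclicOrbit o f (i + c))
      have : (0 : ℝ) ≤ c := by exact_mod_cast hc.le
      have : 0 ≤ 2 * c * dist o (f • o) := by positivity
      linarith
    have h2 := main p q i j hp hq hu hv
    have h3 := main q p j i hq hp hv hu
    have h4 : |(i : ℝ) - j| ≤ 2 * c := by
      rw [abs_le]
      have h2' : ((j - i : ℤ) : ℝ) ≤ ((2 * c : ℤ) : ℝ) := by exact_mod_cast h2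
      have h3' : ((i - j : ℤ) : ℝ) ≤ ((2 * c : ℤ) : ℝ) := by exact_mod_cast h3
      push_cast at h2' h3'
      constructor <;> linarith
    have h5 := dist_zpow_le o f i j
    have h6 : |(i : ℝ) - j| * dist o (f • o) ≤ 2 * c * dist o (f • o) :=
      mul_le_mul_of_nonneg_right h4 dist_nonneg
    simp only
    linarith
  · refine ⟨max 1 (max c₁ (dist o (f • o))), le_max_left _ _, fun m n => ?_⟩
    set k := max 1 (max c₁ (dist o (f • o)))
    have k1 : 1 ≤ k := le_max_left _ _
    have k2 : c₁ ≤ k := (le_max_left _ _).trans (le_max_right _ _)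
    have k3 : dist o (f • o) ≤ k := (le_max_right _ _).trans (le_max_right _ _)
    constructor
    · have := h₁ m n
      have h2 : |(m : ℝ) - n| / k ≤ |(m : ℝ) - n| := div_le_self (abs_nonneg _) k1
      linarith
    · have := dist_zpow_le o f m n
      have h2 : |(m : ℝ) - n| * dist o (f • o) ≤ |(m : ℝ) - n| * k :=
        mul_le_mul_of_nonneg_left k3 (abs_nonneg _)
      linarith

/-- If a geodesic passes close to two distant points of an orbit of `f`, then it crosses the
members of the chain in between, and so does each geodesic with the same endpoint, the starting
point of which is much closer to the old one than the orbit points are. -/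
theorem exists_window (hY : IsGeodesicSpace Y) (ch : PeriodicChain f P C θ B l r) (o : Y)
    (ρ : ℝ) : ∃ c : ℤ, ∀ (x z : Y) (γ : Set Y) (w₁ w₂ : Y) (i j t : ℤ), IsGeodSegment γ x z →
      w₁ ∈ γ → w₂ ∈ γ → dist x w₁ ≤ dist x w₂ → dist w₁ (f ^ i • o) ≤ ρ →
      dist w₂ (f ^ j • o) ≤ ρ → P * i + c ≤ t → t ≤ P * j - c →
      Gate C θ B r t z ∧
        ∀ x', dist x x' + 2 * (θ + 8 * C) < dist x w₁ → Gate C θ B l t x' := by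
  obtain ⟨c, hc, h⟩ := ch.exists_gate_of_near hY o ρ
  -- Two spare indices: `no_backtrack` loses one, and so does passing from a failed left gate to a
  -- right gate.
  refine ⟨c + 2, fun x z γ w₁ w₂ i j t hγ h₁ h₂ h₁₂ hw₁ hw₂ hi hj => ⟨?_, fun x' hx' => ?_⟩⟩
  · have := ch.no_backtrack' hY hγ h₁ h₂ h₁₂ ((h i w₁ hw₁).1 (t + 1) (by omega))
      ((h j w₂ hw₂).2 (t + 1) (by omega))
    simpa using this
  -- Otherwise `x` and `x'` lie on different sides of `B (t - 1)`, so a geodesic from `x` to `x'`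
  -- passes near `l (t - 1)`. The geodesic `γ` passes there too, but only after `w₁`. So `w₁` is
  -- hardly farther from `x` than `x'` is.
  · by_contra hcon
    have g1 := ch.gate_right_of_not_left hY hcon (s := t - 1) (by omega)
    have g2 := ch.no_backtrack hY hγ h₁ h₂ h₁₂ ((h i w₁ hw₁).1 (t - 2) (by omega))
      ((h j w₂ hw₂).2 (t - 2) (by omega))
    rw [show t - 2 + 1 = t - 1 by ring] at g2
    obtain ⟨γ', hγ'⟩ := hY x x'
    obtain ⟨p, hp, -, -, hpl, -⟩ := ch.crossing hγ' g2 g1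
    obtain ⟨γ₂, hs₂, hγ₂, hm₂⟩ := hγ.sub h₁ h₂ h₁₂
    obtain ⟨p', hp', -, -, hpl', -⟩ := ch.crossing hγ₂ ((h i w₁ hw₁).1 (t - 1) (by omega))
      ((h j w₂ hw₂).2 (t - 1) (by omega))
    have e1 := (hm₂ p' (hs₂ hp')).1 hp'
    have e2 := hγ'.dist_add hp
    have e3 := dist_triangle4 x p (l (t - 1)) p'
    rw [dist_comm (l (t - 1)) p'] at e3
    linarith [dist_nonneg (x := p) (y := x')]

end PeriodicChain

end Periodic

/-! ### Finite Hausdorff distance -/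

section Close

variable {Y : Type*} [MetricSpace Y]

/-- `U` and `V` are at finite Hausdorff distance. -/
def Close (U V : Set Y) : Prop :=
  ∃ r : ℝ, (∀ y ∈ U, Metric.infDist y V ≤ r) ∧ ∀ y ∈ V, Metric.infDist y U ≤ r

theorem Close.refl (U : Set Y) : Close U U :=
  ⟨0, fun _ hy => (Metric.infDist_zero_of_mem hy).le,
    fun _ hy => (Metric.infDist_zero_of_mem hy).le⟩

theorem Close.symm {U V : Set Y} (h : Close U V) : Close V U := by
  obtain ⟨r, h1, h2⟩ := h
  exact ⟨r, h2, h1⟩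

theorem infDist_le_trans {V W : Set Y} {r r' : ℝ} (hV : V.Nonempty)
    (h2 : ∀ y ∈ V, Metric.infDist y W ≤ r') {y : Y} (hy : Metric.infDist y V ≤ r) :
    Metric.infDist y W ≤ r + r' := by
  refine le_of_forall_pos_le_add fun ε hε => ?_
  obtain ⟨z, hz, hyz⟩ := (Metric.infDist_lt_iff hV).1 (hy.trans_lt (lt_add_of_pos_right r hε))
  have := Metric.infDist_le_infDist_add_dist (s := W) (x := y) (y := z)
  linarith [h2 z hz]

theorem Close.trans {U V W : Set Y} (hV : V.Nonempty) (h : Close U V) (h' : Close V W) :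
    Close U W := by
  obtain ⟨r, h1, h2⟩ := h
  obtain ⟨r', h1', h2'⟩ := h'
  refine ⟨r + r', fun y hy => infDist_le_trans hV h1' (h1 y hy), fun y hy => ?_⟩
  rw [add_comm]
  exact infDist_le_trans hV h2 (h2' y hy)

theorem mem_cthickening_iff_infDist_le {U : Set Y} (hU : U.Nonempty) {r : ℝ} (hr : 0 ≤ r) {y : Y} :
    y ∈ Metric.cthickening r U ↔ Metric.infDist y U ≤ r := by
  rw [Metric.mem_cthickening_iff, Metric.infDist,
    ENNReal.le_ofReal_iff_toReal_le (Metric.infEDist_ne_top hU) hr]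

variable {G : Type*} [Group G] [MulAction G Y] [IsIsometricSMul G Y]

theorem Close.smul {U V : Set Y} (h : Close U V) (g : G) : Close (g • U) (g • V) := by
  obtain ⟨r, h1, h2⟩ := h
  refine ⟨r, ?_, ?_⟩
  · rintro _ ⟨y, hy, rfl⟩
    simpa [infDist_smul_set] using h1 y hy
  · rintro _ ⟨y, hy, rfl⟩
    simpa [infDist_smul_set] using h2 y hy

theorem smul_mem_cthickening_iff {g : G} {U : Set Y} {r : ℝ} {y : Y} :
    y ∈ Metric.cthickening r (g • U) ↔ g⁻¹ • y ∈ Metric.cthickening r U := by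
  rw [Metric.mem_cthickening_iff, Metric.mem_cthickening_iff, ← Metric.infEDist_smul g (g⁻¹ • y) U,
    smul_inv_smul]

end Close

/-! ### Contracting elements: Morse property, axes, commensurability and independence -/

section Elements

variable {G Y : Type*} [Group G] [MetricSpace Y] [MulAction G Y] [IsIsometricSMul G Y]

theorem mem_elemClosure_iff {o : Y} {g h : G} :
    g ∈ elemClosure o h ↔ Close (g • cyclicOrbit o h) (cyclicOrbit o h) := by
  have hne := cyclicOrbit_nonempty o h
  have hne' : (g • cyclicOrbit o h).Nonempty := hne.smul_set
  constructor
  · rintro ⟨r, hr, h1, h2⟩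
    refine ⟨r, fun y hy => ?_, fun y hy => ?_⟩
    · exact (mem_cthickening_iff_infDist_le hne hr.le).1 (h1 hy)
    · exact (mem_cthickening_iff_infDist_le hne' hr.le).1 (h2 hy)
  · rintro ⟨r, h1, h2⟩
    have hr : 0 < max r 1 := lt_max_of_lt_right one_pos
    refine ⟨max r 1, hr, fun y hy => ?_, fun y hy => ?_⟩
    · exact (mem_cthickening_iff_infDist_le hne hr.le).2 ((h1 y hy).trans (le_max_left _ _))
    · exact (mem_cthickening_iff_infDist_le hne' hr.le).2 ((h2 y hy).trans (le_max_left _ _))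

theorem mul_mem_elemClosure {o : Y} {g g' h : G} (hg : g ∈ elemClosure o h)
    (hg' : g' ∈ elemClosure o h) : g * g' ∈ elemClosure o h := by
  rw [mem_elemClosure_iff] at *
  rw [mul_smul]
  exact (hg'.smul g).trans (cyclicOrbit_nonempty o h).smul_set hg

theorem inv_mem_elemClosure {o : Y} {g h : G} (hg : g ∈ elemClosure o h) :
    g⁻¹ ∈ elemClosure o h := by
  rw [mem_elemClosure_iff] at *
  simpa using (hg.smul g⁻¹).symm

theorem smul_cyclicOrbit (o : Y) (h : G) (n : ℤ) : h ^ n • cyclicOrbit o h = cyclicOrbit o h := by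
  ext y
  rw [Set.mem_smul_set_iff_inv_smul_mem]
  constructor
  · rintro ⟨m, hm⟩
    refine ⟨n + m, ?_⟩
    simp only at hm ⊢
    rw [zpow_add, mul_smul, hm, smul_inv_smul]
  · rintro ⟨m, rfl⟩
    exact ⟨-n + m, by simp [zpow_add, mul_smul]⟩

theorem zpow_mem_elemClosure (o : Y) (h : G) (n : ℤ) : h ^ n ∈ elemClosure o h := by
  rw [mem_elemClosure_iff, smul_cyclicOrbit]
  exact Close.refl _

theorem axis_eq (o : Y) (h : G) : axis o h = (fun g : G => g • o) '' elemClosure o h := by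
  ext y; constructor
  · rintro ⟨g, hg, rfl⟩; exact ⟨g, hg, rfl⟩
  · rintro ⟨g, hg, rfl⟩; exact ⟨g, hg, rfl⟩

theorem smul_axis {o : Y} {g h : G} (hg : g ∈ elemClosure o h) : g • axis o h = axis o h := by
  ext y
  rw [Set.mem_smul_set_iff_inv_smul_mem]
  constructor
  · rintro ⟨e, he, hy⟩
    exact ⟨g * e, mul_mem_elemClosure hg he, by rw [mul_smul, ← hy, smul_inv_smul]⟩
  · rintro ⟨e, he, rfl⟩
    exact ⟨g⁻¹ * e, mul_mem_elemClosure (inv_mem_elemClosure hg) he, by rw [mul_smul]⟩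

theorem cyclicOrbit_subset_axis (o : Y) (h : G) : cyclicOrbit o h ⊆ axis o h := by
  rintro _ ⟨n, rfl⟩
  exact ⟨_, zpow_mem_elemClosure o h n, rfl⟩

theorem self_mem_axis (o : Y) (h : G) : o ∈ axis o h :=
  cyclicOrbit_subset_axis o h ⟨0, by simp⟩

theorem axis_nonempty (o : Y) (h : G) : (axis o h).Nonempty := ⟨o, self_mem_axis o h⟩

theorem isClosed_axis {o : Y} (hproper : IsProperAction G Y) (h : G) : IsClosed (axis o h) := by
  rw [axis_eq]; exact isClosed_orbit_subset hproper _

theorem IsContractingElt.inv {o : Y} {h : G} (hh : IsContractingElt o h) :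
    IsContractingElt o h⁻¹ := by
  obtain ⟨h1, ⟨C, h2⟩, c, hc, h3⟩ := hh
  refine ⟨by rwa [isOfFinOrder_inv_iff], ⟨C, by rwa [cyclicOrbit_inv]⟩, c, hc, fun m n => ?_⟩
  have := h3 (-m) (-n)
  rw [inv_zpow', inv_zpow']
  have e : |((-m : ℤ) : ℝ) - ((-n : ℤ) : ℝ)| = |(m : ℝ) - n| := by
    push_cast
    rw [abs_sub_comm]; congr 1; ring
  rwa [e] at this

theorem elemClosure_inv (o : Y) (h : G) : elemClosure o h⁻¹ = elemClosure o h := by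
  simp only [elemClosure, cyclicOrbit_inv]

theorem axis_inv (o : Y) (h : G) : axis o h⁻¹ = axis o h := by
  simp only [axis, elemClosure_inv]

theorem IsContractingElt.zpow_ne_one {o : Y} {h : G} (hh : IsContractingElt o h) {n : ℤ}
    (hn : n ≠ 0) : h ^ n ≠ 1 := fun h1 =>
  hh.1 (isOfFinOrder_iff_zpow_eq_one.2 ⟨n, hn, h1⟩)

theorem IsContractingElt.exists_lt_dist {o : Y} {h : G} (hh : IsContractingElt o h) (R : ℝ) :
    ∃ K : ℤ, 0 < K ∧ ∀ m n : ℤ, K ≤ |m - n| → R < dist (h ^ m • o) (h ^ n • o) := by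
  obtain ⟨-, -, c, hc, hqi⟩ := hh
  obtain ⟨K, hK⟩ := exists_nat_gt (c * (R + c))
  refine ⟨K + 1, by positivity, fun m n hmn => ?_⟩
  have h1 := (hqi m n).1
  have h2 : ((K + 1 : ℤ) : ℝ) ≤ |(m : ℝ) - n| := by exact_mod_cast hmn
  push_cast at h2
  have h3 : R + c < |(m : ℝ) - n| / c := by
    rw [lt_div_iff₀ (by linarith)]; linarith
  linarith

/-- The Morse property of an orbit of a contracting element. -/
theorem IsContractingElt.morse [ProperSpace Y] {o : Y} {h : G} (hh : IsContractingElt o h) :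
    ∃ (D : ℝ) (K : ℤ), ∀ (a b : Y) (γ : Set Y) (i j k : ℤ), IsGeodSegment γ a b →
      h ^ i • o ∈ proj (cyclicOrbit o h) a → h ^ k • o ∈ proj (cyclicOrbit o h) b →
      i ≤ j → j ≤ k → K ≤ k - i → ∃ w ∈ γ, dist w (h ^ j • o) ≤ D := by
  obtain ⟨-, ⟨C, hC⟩, c, hc, hqi⟩ := id hh
  obtain ⟨K, -, hK⟩ := hh.exists_lt_dist C
  refine ⟨3 * C + 1 + (c * (c * (6 * C + 2 + c)) + c), K,
    fun a b γ i j k hγ hi hk hij hjk hKk => ?_⟩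
  have hC1 := hC.1
  obtain ⟨p, hp, q, hq, hpu, hqv, hpC, hqC, hpq⟩ := bgi hC hγ hi hk
    (hK i k (by rw [abs_sub_comm]; exact hKk.trans (le_abs_self _)))
  obtain ⟨γ', hs, hγ', -⟩ := hγ.sub hp hq hpq
  set U : Set Y := (fun n : ℤ => h ^ n • o) '' Iic j
  set V : Set Y := (fun n : ℤ => h ^ n • o) '' Ici j
  have hUi : h ^ i • o ∈ U := ⟨i, hij, rfl⟩
  have hVk : h ^ k • o ∈ V := ⟨k, hjk, rfl⟩
  have hcl : ∀ W : Set Y, IsClosed {w | Metric.infDist w W ≤ 3 * C} := fun W =>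
    isClosed_le (Metric.continuous_infDist_pt W) continuous_const
  have hcov : γ' ⊆ {w | Metric.infDist w U ≤ 3 * C} ∪ {w | Metric.infDist w V ≤ 3 * C} := by
    intro w hw
    have h1 := quasiconvex hC (cyclicOrbit_nonempty o h) hγ' le_rfl hpC hqC hw
    obtain ⟨u, hu⟩ := proj_nonempty hC.2.1 (cyclicOrbit_nonempty o h) w
    obtain ⟨n, rfl⟩ := hu.1
    have h2 : dist w (h ^ n • o) ≤ 3 * C := by
      have := hu.2
      simp only at this
      linarith
    rcases le_total n j with hn | hn
    · exact Or.inl ((Metric.infDist_le_dist_of_mem (s := U) ⟨n, hn, rfl⟩).trans h2)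
    · exact Or.inr ((Metric.infDist_le_dist_of_mem (s := V) ⟨n, hn, rfl⟩).trans h2)
  -- The geodesic piece is covered by neighbourhoods of the two halves of the orbit, up to and from
  -- the index `j`, and starts in one and ends in the other. By connectedness some `w` is close to
  -- orbit points of indices `m ≤ j ≤ n`; the lower quasi-isometry bound makes `n - m`, hence also
  -- `j - m`, bounded.
  obtain ⟨w, hw, hwU, hwV⟩ := isPreconnected_closed_iff.1 hγ'.isPreconnected _ _ (hcl U) (hcl V)
    hcov ⟨p, hγ'.left_mem, (Metric.infDist_le_dist_of_mem hUi).trans (by linarith)⟩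
    ⟨q, hγ'.right_mem, (Metric.infDist_le_dist_of_mem hVk).trans (by linarith)⟩
  obtain ⟨_, ⟨m, hm, rfl⟩, hmw⟩ := (Metric.infDist_lt_iff ⟨_, hUi⟩).1
    (lt_of_le_of_lt hwU (lt_add_one _))
  obtain ⟨_, ⟨n, hn, rfl⟩, hnw⟩ := (Metric.infDist_lt_iff ⟨_, hVk⟩).1
    (lt_of_le_of_lt hwV (lt_add_one _))
  refine ⟨w, hs hw, ?_⟩
  have e1 := (hqi m n).1
  have e2 := dist_triangle_left (h ^ m • o) (h ^ n • o) w
  have e3 := (hqi m j).2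
  have hmj : (m : ℝ) ≤ j := by exact_mod_cast hm
  have hjn : (j : ℝ) ≤ n := by exact_mod_cast hn
  have e4 : |(m : ℝ) - n| ≤ c * (6 * C + 2 + c) := by
    have : |(m : ℝ) - n| / c ≤ 6 * C + 2 + c := by linarith
    rw [div_le_iff₀ (by linarith)] at this
    linarith
  have e5 : |(m : ℝ) - j| ≤ |(m : ℝ) - n| := by
    rw [abs_sub_comm, abs_of_nonneg (by linarith), abs_sub_comm, abs_of_nonneg (by linarith)]
    linarith
  have e6 : c * |(m : ℝ) - j| ≤ c * (c * (6 * C + 2 + c)) :=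
    mul_le_mul_of_nonneg_left (e5.trans e4) (by linarith)
  linarith [dist_triangle w (h ^ m • o) (h ^ j • o)]

/-- The axis of a contracting element lies in a bounded neighbourhood of the cyclic orbit. -/
theorem IsContractingElt.exists_axis_bound [ProperSpace Y] (hY : IsGeodesicSpace Y) {o : Y}
    {h : G} (hh : IsContractingElt o h) :
    ∃ D : ℝ, ∀ y ∈ axis o h, Metric.infDist y (cyclicOrbit o h) ≤ D := by
  obtain ⟨-, ⟨C, hC⟩, -⟩ := id hh
  obtain ⟨D, K, hD⟩ := hh.morse
  refine ⟨D + 3 * C, ?_⟩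
  rintro _ ⟨g, hg, rfl⟩
  rw [mem_elemClosure_iff] at hg
  obtain ⟨r, hr, -⟩ := hg
  have hr0 : 0 ≤ r :=
    Metric.infDist_nonneg.trans (hr _ (Set.smul_mem_smul_set (zpow_mem_cyclicOrbit o h 0)))
  have hC1 := hC.1
  have hne := cyclicOrbit_nonempty o h
  obtain ⟨N, hN0, hN⟩ := hh.exists_lt_dist (D + r + 2 * C + C + 2 * r)
  set n := max N K
  have hnN : N ≤ n := le_max_left _ _
  have hnK : K ≤ n := le_max_right _ _
  -- The Hausdorff distance `r` depends on `g`, but only `n` is chosen in terms of it. By the Morse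
  -- property for the translated orbit, `γ` passes `D`-close to `g • o`. That place is far from both
  -- ends, so it lies in the part of `γ` that is `3 * C`-close to the orbit of `h`.
  obtain ⟨γ, hγ⟩ := hY (g • h ^ (-n) • o) (g • h ^ n • o)
  have hγ' := hγ.smul g⁻¹
  rw [inv_smul_smul, inv_smul_smul] at hγ'
  obtain ⟨w', hw', hwD⟩ := hD _ _ _ (-n) 0 n hγ' (self_mem_proj (zpow_mem_cyclicOrbit o h _))
    (self_mem_proj (zpow_mem_cyclicOrbit o h _)) (by omega) (by omega) (by omega)
  obtain ⟨w, hw, rfl⟩ := hw'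
  rw [← dist_smul g] at hwD
  simp only [smul_inv_smul, zpow_zero, one_smul] at hwD
  obtain ⟨u, hu⟩ := proj_nonempty hC.2.1 hne (g • h ^ (-n) • o)
  obtain ⟨v, hv⟩ := proj_nonempty hC.2.1 hne (g • h ^ n • o)
  have e1 := hr _ (Set.smul_mem_smul_set (zpow_mem_cyclicOrbit o h (-n)))
  have e2 := hr _ (Set.smul_mem_smul_set (zpow_mem_cyclicOrbit o h n))
  have hu2 := hu.2
  have hv2 := hv.2
  rw [← hu2] at e1
  rw [← hv2] at e2
  have d1 : D + r + 2 * C + C + 2 * r < dist (g • h ^ (-n) • o) (g • h ^ n • o) := by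
    rw [dist_smul]; exact hN _ _ (by rw [abs_sub_comm]; refine le_trans ?_ (le_abs_self _); omega)
  have d2 : D + r + 2 * C + C + 2 * r < dist (g • h ^ (-n) • o) (g • o) := by
    rw [dist_smul]
    have := hN (-n) 0 (by rw [abs_sub_comm]; refine le_trans ?_ (le_abs_self _); omega)
    simpa using this
  have d3 : D + r + 2 * C + C + 2 * r < dist (g • o) (g • h ^ n • o) := by
    rw [dist_smul]
    have := hN 0 n (by rw [abs_sub_comm]; refine le_trans ?_ (le_abs_self _); omega)
    simpa using this
  have hD0 : 0 ≤ D := dist_nonneg.trans hwD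
  obtain ⟨p, hp, q, hq, hpu, hqv, hpC, hqC, hpq⟩ := bgi hC hγ hu hv (by
    have := dist_triangle4 (g • h ^ (-n) • o) u v (g • h ^ n • o)
    rw [dist_comm v] at this
    linarith)
  obtain ⟨γ₂, hs₂, hγ₂, hm₂⟩ := hγ.sub hp hq hpq
  have hwm : w ∈ γ₂ := by
    rw [hm₂ w hw]
    have t1 := dist_triangle_right (g • h ^ (-n) • o) p u
    have t2 := dist_triangle_right (g • h ^ n • o) q v
    have t3 := hγ.dist_add hw
    have t4 := hγ.dist_add hq
    have t5 := dist_triangle (g • h ^ (-n) • o) w (g • o)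
    have t6 := dist_triangle_left (g • o) (g • h ^ n • o) w
    rw [dist_comm q] at t4
    constructor <;> linarith
  have h1 := quasiconvex hC hne hγ₂ le_rfl hpC hqC hwm
  have h2 := Metric.infDist_le_infDist_add_dist (s := cyclicOrbit o h) (x := g • o) (y := w)
  rw [dist_comm] at h2
  linarith

theorem IsContractingElt.close_axis [ProperSpace Y] (hY : IsGeodesicSpace Y) {o : Y}
    {h : G} (hh : IsContractingElt o h) : Close (axis o h) (cyclicOrbit o h) := by
  obtain ⟨D, hD⟩ := hh.exists_axis_bound hY
  refine ⟨max D 0, fun y hy => (hD y hy).trans (le_max_left _ _), fun y hy => ?_⟩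
  rw [Metric.infDist_zero_of_mem (cyclicOrbit_subset_axis o h hy)]
  exact le_max_right _ _

theorem IsContractingElt.exists_axis_near [ProperSpace Y] (hY : IsGeodesicSpace Y) {o : Y}
    {h : G} (hh : IsContractingElt o h) :
    ∃ D : ℝ, ∀ y ∈ axis o h, ∃ n : ℤ, dist y (h ^ n • o) ≤ D := by
  obtain ⟨D, hD⟩ := hh.exists_axis_bound hY
  refine ⟨D + 1, fun y hy => ?_⟩
  obtain ⟨_, ⟨n, rfl⟩, hn⟩ := (Metric.infDist_lt_iff (cyclicOrbit_nonempty o h)).1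
    ((hD y hy).trans_lt (lt_add_one D))
  exact ⟨n, hn.le⟩

theorem IsContractingElt.axis_contracting [ProperSpace Y] (hY : IsGeodesicSpace Y)
    (hproper : IsProperAction G Y) {o : Y} {h : G} (hh : IsContractingElt o h) :
    ∃ C, IsContracting C (axis o h) := by
  obtain ⟨D, h1, h2⟩ := hh.close_axis hY
  obtain ⟨C, hC⟩ := hh.2.1
  exact ⟨_, hC.of_close hY (cyclicOrbit_nonempty o h) (axis_nonempty o h)
    (isClosed_axis hproper h) h1 h2⟩

/-- With `smul_axis`, this identifies `E(h)` with the stabilizer of `Ax(h)`. -/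
theorem mem_elemClosure_of_smul_axis_eq [ProperSpace Y] (hY : IsGeodesicSpace Y) {o : Y}
    {g h : G} (hh : IsContractingElt o h) (hg : g • axis o h = axis o h) :
    g ∈ elemClosure o h := by
  have h1 := hh.close_axis hY
  have h2 := h1.smul g
  rw [hg] at h2
  rw [mem_elemClosure_iff]
  exact h2.symm.trans (axis_nonempty o h) h1

/-- Division with remainder of `i` by `m` writes `g * h ^ i` as a power of `k` times `g * h ^ s`
with `0 ≤ s < |m|`. So only finitely many distances matter, and their sum is a bound. -/
theorem close_of_zpow_conj {o : Y} {g h k : G} {m n : ℤ} (hm : m ≠ 0) (hn : n ≠ 0)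
    (e : g * h ^ m * g⁻¹ = k ^ n) : Close (g • cyclicOrbit o h) (cyclicOrbit o k) := by
  have key : ∀ (g h k : G) (m n : ℤ), m ≠ 0 → g * h ^ m * g⁻¹ = k ^ n →
      ∃ r, ∀ y ∈ g • cyclicOrbit o h, Metric.infDist y (cyclicOrbit o k) ≤ r := by
    intro g h k m n hm e
    refine ⟨∑ s ∈ Finset.Ico 0 |m|, dist (g • h ^ s • o) o, ?_⟩
    rintro _ ⟨_, ⟨i, rfl⟩, rfl⟩
    have e1 : g * h ^ i = k ^ (n * (i / m)) * (g * h ^ (i % m)) := by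
      rw [zpow_mul, ← e, conj_zpow, ← zpow_mul]
      conv_lhs => rw [← Int.mul_ediv_add_emod i m, zpow_add]
      group
    have e2 : g • h ^ i • o = k ^ (n * (i / m)) • g • h ^ (i % m) • o := by
      rw [← mul_smul, e1, mul_smul, mul_smul]
    simp only
    refine (Metric.infDist_le_dist_of_mem (zpow_mem_cyclicOrbit o k (n * (i / m)))).trans ?_
    rw [e2, dist_smul]
    exact Finset.single_le_sum (f := fun s : ℤ => dist (g • h ^ s • o) o)
      (fun s _ => dist_nonneg) (Finset.mem_Ico.2 ⟨Int.emod_nonneg i hm, Int.emod_lt_abs i hm⟩)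
  obtain ⟨r, hr⟩ := key g h k m n hm e
  obtain ⟨r', hr'⟩ := key g⁻¹ k h n m hn (by rw [← e]; group)
  refine ⟨max r r', fun y hy => (hr y hy).trans (le_max_left _ _), fun y hy => ?_⟩
  have := hr' (g⁻¹ • y) (Set.smul_mem_smul_set hy)
  rw [← infDist_smul_set g, smul_inv_smul] at this
  exact this.trans (le_max_right _ _)

/-- Long parallel pieces of the axes of two contracting elements produce a common power, up to
conjugation. -/
theorem exists_bound_of_not_conj [ProperSpace Y] (hY : IsGeodesicSpace Y)
    (hproper : IsProperAction G Y) {o : Y} {h k : G} (hh : IsContractingElt o h)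
    (hk : IsContractingElt o k) {r : ℝ} (hr : 0 ≤ r) :
    ∃ T : ℝ, ∀ g : G, (∀ m n : ℤ, m ≠ 0 → n ≠ 0 → g * k ^ m * g⁻¹ ≠ h ^ n) →
      ∀ p ∈ Metric.cthickening r (axis o h) ∩ Metric.cthickening r (g • axis o k),
      ∀ q ∈ Metric.cthickening r (axis o h) ∩ Metric.cthickening r (g • axis o k),
        dist p q ≤ T := by
  obtain ⟨D, K, hD⟩ := hk.morse
  obtain ⟨D₁, hD₁⟩ := hh.exists_axis_near hY
  obtain ⟨D₂, hD₂⟩ := hk.exists_axis_near hY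
  obtain ⟨C, hC⟩ := hh.2.1
  obtain ⟨c, hc, hqi⟩ := hk.2.2
  have hC1 := hC.1
  have hD₁0 : 0 ≤ D₁ := by obtain ⟨n, hn⟩ := hD₁ o (self_mem_axis o h); exact dist_nonneg.trans hn
  have hD₂0 : 0 ≤ D₂ := by obtain ⟨n, hn⟩ := hD₂ o (self_mem_axis o k); exact dist_nonneg.trans hn
  set ρ := r + 1 + D₁ + D₂ with hρ
  set ρ' := D + (2 * (2 * ρ + C) + C) + 1 with hρ'
  have hfin := finite_dist_smul_le (o := o) hproper o ρ'
  set S := hfin.toFinset with hS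
  refine ⟨2 * ρ + (c * (S.card + |(K : ℝ)|) + c), fun g hg p hp q hq => ?_⟩
  have near₁ : ∀ p ∈ Metric.cthickening r (axis o h), ∃ a : ℤ, dist p (h ^ a • o) ≤ ρ := by
    intro p hp
    rw [mem_cthickening_iff_infDist_le (axis_nonempty o h) hr] at hp
    obtain ⟨y, hy, hpy⟩ := (Metric.infDist_lt_iff (axis_nonempty o h)).1
      (hp.trans_lt (lt_add_one r))
    obtain ⟨n, hn⟩ := hD₁ y hy
    exact ⟨n, by linarith [dist_triangle p y (h ^ n • o)]⟩
  have near₂ : ∀ p ∈ Metric.cthickening r (g • axis o k), ∃ a : ℤ,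
      dist p (g • k ^ a • o) ≤ ρ := by
    intro p hp
    rw [smul_mem_cthickening_iff, mem_cthickening_iff_infDist_le (axis_nonempty o k) hr] at hp
    obtain ⟨y, hy, hpy⟩ := (Metric.infDist_lt_iff (axis_nonempty o k)).1
      (hp.trans_lt (lt_add_one r))
    obtain ⟨n, hn⟩ := hD₂ y hy
    refine ⟨n, ?_⟩
    rw [← dist_smul g⁻¹, inv_smul_smul]
    linarith [dist_triangle (g⁻¹ • p) y (k ^ n • o)]
  obtain ⟨a, ha⟩ := near₁ p hp.1
  obtain ⟨b, hb⟩ := near₁ q hq.1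
  obtain ⟨a', ha'⟩ := near₂ p hp.2
  obtain ⟨b', hb'⟩ := near₂ q hq.2
  have main : ∀ (a b a' b' : ℤ) (p q : Y), dist p (h ^ a • o) ≤ ρ → dist q (h ^ b • o) ≤ ρ →
      dist p (g • k ^ a' • o) ≤ ρ → dist q (g • k ^ b' • o) ≤ ρ →
      b' - a' ≤ S.card + |K| := by
    intro a b a' b' p q ha hb ha' hb'
    by_contra hcon
    push Not at hcon
    obtain ⟨γ, hγ⟩ := hY (g • k ^ a' • o) (g • k ^ b' • o)
    have hγ' := hγ.smul g⁻¹
    rw [inv_smul_smul, inv_smul_smul] at hγ'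
    have endp : ∀ (p : Y) (a a' : ℤ), dist p (h ^ a • o) ≤ ρ → dist p (g • k ^ a' • o) ≤ ρ →
        Metric.infDist (g • k ^ a' • o) (cyclicOrbit o h) ≤ 2 * ρ + C := by
      intro p a a' ha ha'
      have := Metric.infDist_le_dist_of_mem (x := g • k ^ a' • o) (zpow_mem_cyclicOrbit o h a)
      have h2 := dist_triangle_left (g • k ^ a' • o) (h ^ a • o) p
      linarith
    have hρ0 : 0 ≤ ρ := dist_nonneg.trans ha
    -- Along the overlap every `g • k ^ i • o` is close to some `h ^ j • o`. So `h ^ (-j) * g * k ^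
    -- i` lies in the finite set `S`, which does not depend on `g`.
    have pts : ∀ i : ℤ, ∃ j : ℤ, i ∈ Finset.Icc a' b' →
        dist o ((h ^ (-j) * g * k ^ i) • o) ≤ ρ' := by
      intro i
      by_cases hi : i ∈ Finset.Icc a' b'
      swap
      · exact ⟨0, fun h => absurd h hi⟩
      rw [Finset.mem_Icc] at hi
      obtain ⟨w', hw', hwD⟩ := hD _ _ _ a' i b' hγ' (self_mem_proj (zpow_mem_cyclicOrbit o k _))
        (self_mem_proj (zpow_mem_cyclicOrbit o k _)) hi.1 hi.2
        (by have := le_abs_self K; omega)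
      obtain ⟨w, hw, rfl⟩ := hw'
      rw [← dist_smul g] at hwD
      simp only [smul_inv_smul] at hwD
      have h1 := quasiconvex hC (cyclicOrbit_nonempty o h) hγ (by linarith)
        (endp p a a' ha ha') (endp q b b' hb hb') hw
      obtain ⟨_, ⟨j, rfl⟩, hj⟩ := (Metric.infDist_lt_iff (cyclicOrbit_nonempty o h)).1
        (h1.trans_lt (lt_add_one _))
      refine ⟨j, fun _ => ?_⟩
      rw [mul_smul, mul_smul, ← dist_smul (h ^ j), ← mul_smul (h ^ j), ← zpow_add, add_neg_cancel,
        zpow_zero, one_smul]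
      have := dist_triangle_left (h ^ j • o) (g • k ^ i • o) w
      linarith
    choose j hj using pts
    have hmaps : Set.MapsTo (fun i => h ^ (-j i) * g * k ^ i) (Finset.Icc a' b' : Finset ℤ) S := by
      intro i hi
      simpa [hS] using hj i hi
    have hcard : S.card < (Finset.Icc a' b').card := by
      rw [Int.card_Icc]
      have := abs_nonneg K
      omega
    -- There are more indices than elements of `S`. Two equal values give a relation between powers
    -- of `g k g⁻¹` and `h`; the exponent of `h` is not zero either, because `k` has infinite order.
    obtain ⟨i, -, i', -, hne, heq⟩ := Finset.exists_ne_map_eq_of_card_lt_of_maps_to hcard hmaps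
    have heq2 : g * k ^ (i - i') * g⁻¹ = h ^ (j i - j i') := by
      have : g * k ^ i = h ^ (j i) * (h ^ (-j i') * g * k ^ i') := by rw [← heq]; group
      rw [zpow_sub, ← mul_assoc g, this, zpow_sub]; group
    refine hg (i - i') (j i - j i') (sub_ne_zero.2 hne) (fun h0 => ?_) heq2
    rw [h0, zpow_zero] at heq2
    refine hk.zpow_ne_one (sub_ne_zero.2 hne) ?_
    have : k ^ (i - i') = g⁻¹ * (g * k ^ (i - i') * g⁻¹) * g := by group
    rw [this, heq2]; group
  have h1 := main a b a' b' p q ha hb ha' hb'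
  have h2 := main b a b' a' q p hb ha hb' ha'
  have h3 : |(a' : ℝ) - b'| ≤ S.card + |(K : ℝ)| := by
    have h1' : ((b' - a' : ℤ) : ℝ) ≤ ((S.card + |K| : ℤ) : ℝ) := by exact_mod_cast h1
    have h2' : ((a' - b' : ℤ) : ℝ) ≤ ((S.card + |K| : ℤ) : ℝ) := by exact_mod_cast h2
    push_cast at h1' h2'
    rw [abs_le]; constructor <;> linarith
  have h4 := (hqi a' b').2
  have h5 : c * |(a' : ℝ) - b'| ≤ c * (S.card + |(K : ℝ)|) :=
    mul_le_mul_of_nonneg_left h3 (by linarith)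
  have h6 := dist_triangle4 p (g • k ^ a' • o) (g • k ^ b' • o) q
  rw [dist_smul, dist_comm (g • k ^ b' • o) q] at h6
  linarith

theorem exists_boundedIntersection [ProperSpace Y] (hY : IsGeodesicSpace Y)
    (hproper : IsProperAction G Y) {o : Y} {h k : G} (hh : IsContractingElt o h)
    (hk : IsContractingElt o k) :
    ∃ τ : ℝ → ℝ, ∀ g g' : G, (∀ m n : ℤ, m ≠ 0 → n ≠ 0 → g⁻¹ * g' * k ^ m * (g⁻¹ * g')⁻¹ ≠ h ^ n) →
      BoundedIntersection τ (g • axis o h) (g' • axis o k) := by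
  have := fun r : {r : ℝ // 0 ≤ r} => exists_bound_of_not_conj hY hproper hh hk r.2
  choose T hT using this
  refine ⟨fun r => if hr : 0 ≤ r then T ⟨r, hr⟩ else 0, fun g g' hg r hr p hp q hq => ?_⟩
  simp only [dif_pos hr]
  have tr : ∀ p ∈ Metric.cthickening r (g • axis o h) ∩ Metric.cthickening r (g' • axis o k),
      g⁻¹ • p ∈ Metric.cthickening r (axis o h) ∩
        Metric.cthickening r ((g⁻¹ * g') • axis o k) := by
    rintro p ⟨h1, h2⟩
    refine ⟨smul_mem_cthickening_iff.1 h1, ?_⟩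
    rw [smul_mem_cthickening_iff] at h2 ⊢
    simpa [mul_smul] using h2
  have := hT ⟨r, hr⟩ (g⁻¹ * g') hg _ (tr p hp) _ (tr q hq)
  rwa [dist_smul] at this

theorem smul_axis_eq_of_zpow_conj {o : Y} {g h : G} {m n : ℤ}
    (hm : m ≠ 0) (hn : n ≠ 0) (e : g * h ^ m * g⁻¹ = h ^ n) : g • axis o h = axis o h :=
  smul_axis (mem_elemClosure_iff.2 (close_of_zpow_conj hm hn e))

theorem BoundedIntersection.mono {τ τ' : ℝ → ℝ} {U V : Set Y} (h : BoundedIntersection τ U V)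
    (hle : ∀ r, τ r ≤ τ' r) : BoundedIntersection τ' U V := fun r hr p hp q hq =>
  (h r hr p hp q hq).trans (hle r)

/-- The translates of the axis of a contracting element have uniformly bounded intersection. -/
theorem IsContractingElt.exists_boundedIntersection_self [ProperSpace Y] (hY : IsGeodesicSpace Y)
    (hproper : IsProperAction G Y) {o : Y} {h : G} (hh : IsContractingElt o h) :
    ∃ τ : ℝ → ℝ, ∀ g g' : G, g • axis o h ≠ g' • axis o h →
      BoundedIntersection τ (g • axis o h) (g' • axis o h) := by
  obtain ⟨τ, hτ⟩ := exists_boundedIntersection hY hproper hh hh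
  refine ⟨τ, fun g g' hne => hτ g g' fun m n hm hn e => hne ?_⟩
  have := smul_axis_eq_of_zpow_conj (o := o) hm hn e
  rw [mul_smul, inv_smul_eq_iff] at this
  exact this.symm

/-- Independence is always verified through this criterion: without a common power up to
conjugation, the overlaps of translates of the two axes are uniformly bounded. Distinct translates
of one axis have bounded overlap anyway, since a common power puts `g⁻¹ * g'` into `E(h)`. -/
theorem independent_of_not_conj [ProperSpace Y] (hY : IsGeodesicSpace Y)
    (hproper : IsProperAction G Y) {o : Y} {h k : G} (hh : IsContractingElt o h)
    (hk : IsContractingElt o k)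
    (hne : ∀ (g : G) (m n : ℤ), m ≠ 0 → n ≠ 0 → g * k ^ m * g⁻¹ ≠ h ^ n) :
    Independent o h k := by
  obtain ⟨C₁, hC₁⟩ := hh.axis_contracting hY hproper
  obtain ⟨C₂, hC₂⟩ := hk.axis_contracting hY hproper
  obtain ⟨τ, hτ⟩ := exists_boundedIntersection hY hproper hh hk
  obtain ⟨τ₁, hτ₁⟩ := hh.exists_boundedIntersection_self hY hproper
  obtain ⟨τ₂, hτ₂⟩ := hk.exists_boundedIntersection_self hY hproper
  refine ⟨⟨max C₁ C₂, ?_⟩, fun r => max (τ r) (max (τ₁ r) (τ₂ r)), ?_, ?_, ?_⟩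
  · rintro _ ⟨f, hf, g, rfl⟩
    rcases hf with rfl | hf
    · exact (hC₁.smul g).mono (le_max_left _ _)
    · rw [Set.mem_singleton_iff] at hf; subst hf
      exact (hC₂.smul g).mono (le_max_right _ _)
  · rintro _ ⟨f, rfl, g, rfl⟩ _ ⟨f', rfl, g', rfl⟩
    exact (hτ g g' fun m n hm hn => hne _ m n hm hn).mono fun r => le_max_left _ _
  · rintro _ ⟨f, rfl, g, rfl⟩ _ ⟨f', rfl, g', rfl⟩ huv
    exact (hτ₁ g g' huv).mono fun r => (le_max_left _ _).trans (le_max_right _ _)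
  · rintro _ ⟨f, rfl, g, rfl⟩ _ ⟨f', rfl, g', rfl⟩ huv
    exact (hτ₂ g g' huv).mono fun r => (le_max_right _ _).trans (le_max_right _ _)

/-- `Ax(h)` counts as two members here, and its intersection with itself is unbounded. This serves
to show that independent elements are different. -/
theorem IsContractingElt.not_independent_self {o : Y} {h : G} (hh : IsContractingElt o h) :
    ¬ Independent o h h := by
  rintro ⟨-, τ, hτ, -⟩
  have h1 : (1 : G) • axis o h ∈ axisSystem o {h} := ⟨h, rfl, 1, rfl⟩
  have h2 := hτ _ h1 _ h1 0 le_rfl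
  obtain ⟨K, -, hK⟩ := hh.exists_lt_dist (τ 0)
  have mem : ∀ n : ℤ, h ^ n • o ∈ Metric.cthickening 0 ((1 : G) • axis o h) := by
    intro n
    rw [one_smul]
    exact Metric.self_subset_cthickening _ (cyclicOrbit_subset_axis o h ⟨n, rfl⟩)
  have h3 := h2 _ ⟨mem K, mem K⟩ _ ⟨mem 0, mem 0⟩
  have h4 := hK K 0 (by simpa using le_abs_self K)
  linarith

theorem Independent.symm {o : Y} {h k : G} (hi : Independent o h k) : Independent o k h := by
  obtain ⟨⟨C, hC⟩, τ, h1, h2, h3⟩ := hi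
  refine ⟨⟨C, by rwa [Set.pair_comm]⟩, τ, fun U hU V hV r hr p hp q hq => ?_, h3, h2⟩
  exact h1 V hV U hU r hr p hp.symm q hq.symm

/-- A nonelementary group has infinitely many translates of the axis of a contracting element. -/
theorem IsContractingElt.infinite_translates [ProperSpace Y] (hY : IsGeodesicSpace Y)
    (hproper : IsProperAction G Y) (hnonel : IsNonelementary G) {o : Y} {h : G}
    (hh : IsContractingElt o h) : (range fun g : G => g • axis o h).Infinite := by
  intro hfin
  obtain ⟨D, hD⟩ := hh.exists_axis_near hY
  have hS := finite_dist_smul_le (o := o) hproper o D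
  have hreps : ∃ T : Set G, T.Finite ∧ ∀ g : G, ∃ t ∈ T, t • axis o h = g • axis o h := by
    have : ∀ X : Set Y, ∃ t : G, X ∈ range (fun g : G => g • axis o h) → t • axis o h = X := by
      intro X
      by_cases hX : X ∈ range (fun g : G => g • axis o h)
      · obtain ⟨t, ht⟩ := hX
        exact ⟨t, fun _ => ht⟩
      · exact ⟨1, fun h => absurd h hX⟩
    choose t ht using this
    exact ⟨_, hfin.image t, fun g => ⟨_, mem_image_of_mem t ⟨g, rfl⟩, ht _ ⟨g, rfl⟩⟩⟩
  obtain ⟨T, hT, hTr⟩ := hreps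
  set H := (zpowersHom G h).range with hH
  -- Up to a factor from the finite set `T` of coset representatives of the stabilizer, every
  -- element lies in `E(h)`, and a power of `h` brings it into the finite set of elements that move
  -- `o` by at most `D`. So `⟨h⟩ ≅ ℤ` would have finite index.
  have hfi : Finite (G ⧸ H) := by
    have hfin2 : (Set.image2 (fun t s : G => (QuotientGroup.mk (t * s) : G ⧸ H)) T
        {s : G | dist o (s • o) ≤ D}).Finite := hT.image2 _ hS
    rw [← Set.finite_univ_iff]
    refine hfin2.subset fun x _ => ?_
    obtain ⟨g, rfl⟩ := QuotientGroup.mk_surjective x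
    obtain ⟨t, ht, htg⟩ := hTr g
    have he : t⁻¹ * g ∈ elemClosure o h := by
      refine mem_elemClosure_of_smul_axis_eq hY hh ?_
      rw [mul_smul, ← htg, inv_smul_smul]
    obtain ⟨n, hn⟩ := hD _ ⟨_, inv_mem_elemClosure he, rfl⟩
    refine ⟨t, ht, t⁻¹ * g * h ^ n, ?_, ?_⟩
    · rw [← dist_smul (t⁻¹ * g), smul_inv_smul, ← mul_smul] at hn
      exact hn
    · simp only
      rw [show t * (t⁻¹ * g * h ^ n) = g * h ^ n by group]
      refine (QuotientGroup.eq.2 (MonoidHom.mem_range.2 ⟨Multiplicative.ofAdd n, by simp⟩)).symm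
  have hinj : Function.Injective (zpowersHom G h) := by
    intro a b hab
    have := injective_zpow_iff_not_isOfFinOrder.2 hh.1
    exact Multiplicative.toAdd.injective (this hab)
  exact (hnonel H Subgroup.finiteIndex_of_finite_quotient).2.false
    (MonoidHom.ofInjective hinj).symm

/-! ### Powers of contracting elements -/

section Powers

theorem close_cyclicOrbit_pow (o : Y) (f : G) {k : ℕ} (hk : k ≠ 0) :
    Close (cyclicOrbit o f) (cyclicOrbit o (f ^ k)) := by
  have := close_of_zpow_conj (o := o) (g := 1) (h := f) (k := f ^ k) (m := k) (n := 1)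
    (by exact_mod_cast hk) one_ne_zero (by simp)
  simpa using this

theorem elemClosure_pow (o : Y) (f : G) {k : ℕ} (hk : k ≠ 0) :
    elemClosure o (f ^ k) = elemClosure o f := by
  have h1 := close_cyclicOrbit_pow o f hk
  ext g
  rw [mem_elemClosure_iff, mem_elemClosure_iff]
  constructor
  · intro h
    exact ((h1.smul g).trans (cyclicOrbit_nonempty _ _).smul_set h).trans
      (cyclicOrbit_nonempty _ _) h1.symm
  · intro h
    exact ((h1.symm.smul g).trans (cyclicOrbit_nonempty _ _).smul_set h).trans
      (cyclicOrbit_nonempty _ _) h1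

/-- This allows the second equality to pass to powers: the axis system, and all constants attached
to it, stay the same while `d(o, f ^ k o)` grows. -/
theorem axis_pow (o : Y) (f : G) {k : ℕ} (hk : k ≠ 0) : axis o (f ^ k) = axis o f := by
  simp only [axis, elemClosure_pow o f hk]

theorem IsContractingElt.pow [ProperSpace Y] (hY : IsGeodesicSpace Y)
    (hproper : IsProperAction G Y) {o : Y} {f : G} (hf : IsContractingElt o f) {k : ℕ}
    (hk : k ≠ 0) : IsContractingElt o (f ^ k) := by
  obtain ⟨r, h1, h2⟩ := close_cyclicOrbit_pow o f hk
  obtain ⟨h3, ⟨C, hC⟩, c, hc, hqi⟩ := hf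
  refine ⟨fun h => h3 (h.of_pow hk), ⟨_, hC.of_close hY (cyclicOrbit_nonempty _ _)
    (cyclicOrbit_nonempty _ _) (isClosed_cyclicOrbit hproper _) h2 h1⟩, c * k, ?_, fun m n => ?_⟩
  · have : (1 : ℝ) ≤ k := by exact_mod_cast Nat.one_le_iff_ne_zero.2 hk
    nlinarith
  · have h4 := hqi (k * m) (k * n)
    rw [zpow_mul, zpow_mul, zpow_natCast] at h4
    have hk1 : (1 : ℝ) ≤ k := by exact_mod_cast Nat.one_le_iff_ne_zero.2 hk
    have e : |((k * m : ℤ) : ℝ) - ((k * n : ℤ) : ℝ)| = k * |(m : ℝ) - n| := by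
      push_cast
      rw [← mul_sub, abs_mul, abs_of_nonneg (by linarith)]
    rw [e] at h4
    have hpos : 0 ≤ |(m : ℝ) - n| := abs_nonneg _
    constructor
    · refine le_trans ?_ h4.1
      have e1 : |(m : ℝ) - n| / (c * k) ≤ k * |(m : ℝ) - n| / c := by
        rw [div_le_div_iff₀ (by positivity) (by positivity)]
        have : |(m : ℝ) - n| * c ≤ |(m : ℝ) - n| * c * (k * k) :=
          le_mul_of_one_le_right (by positivity) (by nlinarith)
        linarith
      nlinarith
    · refine h4.2.trans ?_
      nlinarith

end Powers

end Elements

/-! ### Accumulation of sequences in the compactification -/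

section Accumulation

variable {Z : Type*} [TopologicalSpace Z]

theorem mapClusterPt_of_subseq {u : ℕ → Z} {φ : ℕ → ℕ} {a : Z} (hφ : Tendsto φ atTop atTop)
    (h : Tendsto (u ∘ φ) atTop (𝓝 a)) : MapClusterPt a atTop u :=
  MapClusterPt.of_comp hφ h.mapClusterPt

theorem AccumulatesInto.comp {u : ℕ → Z} {A : Set Z} (h : AccumulatesInto u A) {φ : ℕ → ℕ}
    (hφ : Tendsto φ atTop atTop) : AccumulatesInto (u ∘ φ) A := fun p hp =>
  h p (MapClusterPt.of_comp hφ hp)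

theorem AccumulatesInto.mono {u : ℕ → Z} {A B : Set Z} (h : AccumulatesInto u A) (hAB : A ⊆ B) :
    AccumulatesInto u B := fun p hp => hAB (h p hp)

theorem accumulatesInto_of_tendsto [T2Space Z] {u : ℕ → Z} {A : Set Z} {a : Z}
    (h : Tendsto u atTop (𝓝 a)) (ha : a ∈ A) : AccumulatesInto u A := by
  intro p hp
  have : p = a := by
    by_contra hne
    obtain ⟨U, V, hU, hV, hpU, haV, hd⟩ := t2_separation hne
    have h1 := hp.frequently (hU.mem_nhds hpU)
    have h2 := h.eventually (hV.mem_nhds haV)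
    obtain ⟨n, hn1, hn2⟩ := (h1.and_eventually h2).exists
    exact hd.le_bot ⟨hn1, hn2⟩
  rwa [this]

theorem AccumulatesInto.exists_subseq [CompactSpace Z] [FirstCountableTopology Z] {u : ℕ → Z}
    {A : Set Z} (h : AccumulatesInto u A) :
    ∃ a ∈ A, ∃ φ : ℕ → ℕ, StrictMono φ ∧ Tendsto (u ∘ φ) atTop (𝓝 a) := by
  obtain ⟨a, φ, hφ, ha⟩ := CompactSpace.tendsto_subseq u
  exact ⟨a, h a (mapClusterPt_of_subseq hφ.tendsto_atTop ha), φ, hφ, ha⟩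

/-- Neighbourhoods shrinking uniformly in the point, from an auxiliary metric on `Z`. They let a
sequence of boundary points, whose terms vary, be replaced by points of `Y` without changing the
limits of subsequences. -/
theorem exists_approx (Z : Type*) [TopologicalSpace Z] [TopologicalSpace.MetrizableSpace Z] :
    ∃ U : ℕ → Z → Set Z, (∀ n z, U n z ∈ 𝓝 z) ∧ ∀ u v : ℕ → Z,
      (∀ᶠ n in atTop, v n ∈ U n (u n)) → ∀ (φ : ℕ → ℕ) (p : Z), Tendsto φ atTop atTop →
        (Tendsto (u ∘ φ) atTop (𝓝 p) ↔ Tendsto (v ∘ φ) atTop (𝓝 p)) := by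
  let := TopologicalSpace.metrizableSpaceMetric Z
  refine ⟨fun n z => Metric.ball z (1 / (n + 1)), fun n z =>
    Metric.ball_mem_nhds z Nat.one_div_pos_of_nat, fun u v huv φ p hφ => ?_⟩
  have hd : Tendsto (fun n => dist (u n) (v n)) atTop (𝓝 0) := by
    refine squeeze_zero' (Eventually.of_forall fun n => dist_nonneg) ?_
      tendsto_one_div_add_atTop_nhds_zero_nat
    filter_upwards [huv] with n hn
    rw [dist_comm]; exact (Metric.mem_ball.1 hn).le
  exact tendsto_iff_of_dist (hd.comp hφ)

theorem AccumulatesInto.of_approx [FirstCountableTopology Z] {u v : ℕ → Z} {A : Set Z}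
    (h : ∀ (φ : ℕ → ℕ) (p : Z), Tendsto φ atTop atTop →
      (Tendsto (u ∘ φ) atTop (𝓝 p) ↔ Tendsto (v ∘ φ) atTop (𝓝 p)))
    (hu : AccumulatesInto u A) : AccumulatesInto v A := by
  intro p hp
  obtain ⟨φ, hφ, hlim⟩ := hp.tendsto_subseq
  exact hu p (mapClusterPt_of_subseq hφ.tendsto_atTop ((h φ p hφ.tendsto_atTop).2 hlim))

end Accumulation

/-! ### Convergence to classes, visual points -/

section Boundary

variable {G Y Z : Type*} [Group G] [MetricSpace Y] [ProperSpace Y] [TopologicalSpace Z]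
  [CompactSpace Z] [TopologicalSpace.MetrizableSpace Z] [MulAction G Y] [IsIsometricSMul G Y]
  [MulAction G Z] [ContinuousConstSMul G Z] {ι : Y → Z} {S : Setoid Z} {o : Y}

theorem cls_subset_bdry {ξ : Z} : cls ι S ξ ⊆ bdry ι := fun _ h => h.1

theorem self_mem_cls {ξ : Z} (h : ξ ∈ bdry ι) : ξ ∈ cls ι S ξ := ⟨h, S.refl' ξ⟩

theorem cls_eq {ξ η : Z} (h : S.r ξ η) : cls ι S ξ = cls ι S η := by
  ext ζ
  exact and_congr_right fun _ => ⟨fun h1 => S.trans' h1 h, fun h1 => S.trans' h1 (S.symm' h)⟩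

theorem isClosed_bdry (he : IsOpenEmbedding ι) : IsClosed (bdry ι) :=
  he.isOpen_range.isClosed_compl

theorem tendsto_dist_of_accumulatesInto (he : IsOpenEmbedding ι) {y : ℕ → Y} {A : Set Z}
    (hA : A ⊆ bdry ι) (h : AccumulatesInto (fun n => ι (y n)) A) (x : Y) :
    Tendsto (fun n => dist x (y n)) atTop atTop := by
  rw [tendsto_atTop]
  intro R
  by_contra hcon
  rw [not_eventually] at hcon
  have hfr : ∃ᶠ n in atTop, y n ∈ Metric.closedBall x R := by
    refine hcon.mono fun n hn => ?_
    rw [Metric.mem_closedBall, dist_comm]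
    exact (not_le.1 hn).le
  obtain ⟨p, -, φ, hφ, hlim⟩ := (isCompact_closedBall x R).tendsto_subseq' hfr
  have := h (ι p) (mapClusterPt_of_subseq hφ.tendsto_atTop
    ((he.continuous.tendsto p).comp hlim))
  exact hA this ⟨p, rfl⟩

theorem accumulatesInto_bdry (he : IsOpenEmbedding ι) {y : ℕ → Y} {x : Y}
    (h : Tendsto (fun n => dist x (y n)) atTop atTop) :
    AccumulatesInto (fun n => ι (y n)) (bdry ι) := by
  rintro p hp ⟨z, rfl⟩
  obtain ⟨φ, hφ, hlim⟩ := hp.tendsto_subseq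
  have h1 : Tendsto (y ∘ φ) atTop (𝓝 z) := he.isInducing.tendsto_nhds_iff.2 hlim
  have h2 : Tendsto (fun n => dist x (y (φ n))) atTop (𝓝 (dist x z)) :=
    tendsto_const_nhds.dist h1
  exact not_tendsto_nhds_of_tendsto_atTop (h.comp hφ.tendsto_atTop) _ h2

theorem isContracting_of_bounded {X : Set Y} {r : ℝ} (hX : IsClosed X)
    (h : ∀ u ∈ X, ∀ v ∈ X, dist u v ≤ r) : IsContracting (max 1 r) X :=
  ⟨le_max_left _ _, hX, fun _ _ _ _ _ _ _ _ _ u hu v hv =>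
    (h u hu.1 v hv.1).trans (le_max_right _ _)⟩

theorem IsGeodSegment.isQuasiGeodesic {γ : Set Y} {x y : Y} (h : IsGeodSegment γ x y) :
    IsQuasiGeodesic 1 γ := by
  obtain ⟨c, h0, h1, hc, rfl⟩ := h
  refine ⟨Icc 0 (dist x y), c, ⟨0, le_rfl, dist_nonneg⟩, ordConnected_Icc, ?_, ?_, rfl⟩
  · refine LipschitzOnWith.of_dist_le_mul fun s hs t ht => ?_
    simp [hc s hs t ht, Real.dist_eq]
  · intro s hs t ht
    rw [hc s hs t ht]; linarith

/-- If the geodesics from `x` to `y n` and to `y' n` pass close to each other far away from `x`,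
then `y n` tends to the same class as `y' n`. -/
theorem accumulatesInto_of_fellow (hY : IsGeodesicSpace Y)
    (hconv : IsConvergenceBoundary ι S) {x : Y} {y y' : ℕ → Y} {ρ : ℕ → ℝ} {r : ℝ} {ζ : Z}
    (hρ : Tendsto ρ atTop atTop)
    (h : ∀ᶠ n in atTop, ∃ (γ γ' : Set Y) (q q' : Y), IsGeodSegment γ x (y n) ∧
      IsGeodSegment γ' x (y' n) ∧ q ∈ γ ∧ q' ∈ γ' ∧ dist q q' ≤ r ∧ ρ n ≤ dist x q)
    (h' : AccumulatesInto (fun n => ι (y' n)) (cls ι S ζ)) :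
    AccumulatesInto (fun n => ι (y n)) (cls ι S ζ) := by
  intro p hp
  obtain ⟨N, hN⟩ := eventually_atTop.1 h
  obtain ⟨ψ₁, hψ₁, hlim₁⟩ := hp.tendsto_subseq
  have hs1 : Tendsto (fun n => n + N) atTop atTop := tendsto_add_atTop_nat N
  obtain ⟨b, hb, ψ₂, hψ₂, hlim₂⟩ :=
    (h'.comp (hψ₁.tendsto_atTop.comp hs1)).exists_subseq
  set σ : ℕ → ℕ := fun n => ψ₁ (ψ₂ n + N) with hσ
  have hσt : Tendsto σ atTop atTop := hψ₁.tendsto_atTop.comp (hs1.comp hψ₂.tendsto_atTop)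
  have hσN : ∀ n, N ≤ σ n := fun n => (Nat.le_add_left N _).trans (hψ₁.id_le _)
  have hyp : Tendsto (fun n => ι (y (σ n))) atTop (𝓝 p) :=
    hlim₁.comp (hs1.comp hψ₂.tendsto_atTop)
  have hyb : Tendsto (fun n => ι (y' (σ n))) atTop (𝓝 b) := hlim₂
  have hdata := fun n => hN (σ n) (hσN n)
  choose γ γ' q q' hγ hγ' hq hq' hqq hρq using hdata
  -- Condition (B) is applied to the segments from `q n` to `q' n`. They are contracting because
  -- they are short, they are exiting, and both geodesics meet them, so `y` and `y'` lie in their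
  -- cones. The limits `p` and `b` were fixed before, so the further subsequence in (B) does no
  -- harm.
  choose X hX using fun n => hY (q n) (q' n)
  have hXd : ∀ n, ∀ u ∈ X n, dist (q n) u ≤ r := by
    intro n u hu
    linarith [(hX n).dist_add hu, dist_nonneg (x := u) (y := q' n), hqq n]
  have hXc : ∀ n, IsContracting (max 1 r) (X n) := by
    intro n
    refine isContracting_of_bounded (hX n).isCompact.isClosed fun u hu v hv => ?_
    rw [(hX n).dist_eq_abs hu hv]
    have h1 := hXd n u hu
    have h2 := hXd n v hv
    rw [abs_le]
    constructor <;> linarith [dist_nonneg (x := q n) (y := u), dist_nonneg (x := q n) (y := v)]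
  have hexit : Exiting X := by
    intro o R
    have h1 : Tendsto (fun n => ρ (σ n)) atTop atTop := hρ.comp hσt
    filter_upwards [h1.eventually_ge_atTop (R + dist x o + r)] with n hn p hp
    have h2 := hXd n p hp
    have h3 := dist_triangle4 x o p (q n)
    rw [dist_comm p] at h3
    linarith [hρq n]
  obtain ⟨φ, hφ, ξ, hξ, hcone⟩ := hconv.cones (max 1 r) 1 X le_rfl hXc
    (fun n => (hX n).isQuasiGeodesic) hexit x
  have h1 := hcone (fun n => y (σ (φ n)))
    (fun n => ⟨γ (φ n), hγ (φ n), q (φ n), hq _, (hX _).left_mem⟩)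
  have h2 := hcone (fun n => y' (σ (φ n)))
    (fun n => ⟨γ' (φ n), hγ' (φ n), q' (φ n), hq' _, (hX _).right_mem⟩)
  have h3 := h1 p (hyp.comp hφ.tendsto_atTop).mapClusterPt
  have h4 := h2 b (hyb.comp hφ.tendsto_atTop).mapClusterPt
  exact ⟨h3.1, S.trans' h3.2 (S.trans' (S.symm' h4.2) hb.2)⟩

theorem exists_seq_tendsto (hd : DenseRange ι) (ξ : Z) :
    ∃ y : ℕ → Y, Tendsto (fun n => ι (y n)) atTop (𝓝 ξ) := by
  obtain ⟨u, hu, hlim⟩ := mem_closure_iff_seq_limit.1 (hd ξ)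
  choose y hy using hu
  exact ⟨y, by simpa [hy] using hlim⟩

theorem IsGeodRay.segment {c : ℝ → Y} {x : Y} (hc : IsGeodRay c x) {t : ℝ} (ht : 0 ≤ t) :
    IsGeodSegment (c '' Icc 0 t) x (c t) := by
  have h1 : dist x (c t) = t := by
    rw [← hc.1, hc.2 0 (by simp) t ht]; simp [abs_of_nonneg ht]
  exact ⟨c, hc.1, by rw [h1], fun s hs t ht => hc.2 s hs.1 t ht.1, by rw [h1]⟩

/-- A limit of the geodesics from `x` to points tending to `ξ`, taken pointwise along an
ultrafilter, is a ray. Each of its points is close to one of these geodesics with a late endpoint,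
so `accumulatesInto_of_fellow` applies. Hence visuality in the Myrberg condition is automatic. -/
theorem isVisual (he : IsOpenEmbedding ι) (hd : DenseRange ι) (hY : IsGeodesicSpace Y)
    (hconv : IsConvergenceBoundary ι S) {ξ : Z} (hξ : ξ ∈ bdry ι) : IsVisual ι S ξ := by
  intro x
  obtain ⟨y, hy⟩ := exists_seq_tendsto hd ξ
  have hacc : AccumulatesInto (fun n => ι (y n)) (cls ι S ξ) :=
    accumulatesInto_of_tendsto hy (self_mem_cls hξ)
  have hdist := tendsto_dist_of_accumulatesInto he cls_subset_bdry hacc x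
  choose γ hγ using fun n => hY x (y n)
  choose c hc0 hc1 hciso hcγ using hγ
  set 𝒰 : Ultrafilter ℕ := hyperfilter ℕ
  have h𝒰 : (𝒰 : Filter ℕ) ≤ atTop := by
    rw [← Nat.cofinite_eq_atTop]; exact hyperfilter_le_cofinite
  have hev : ∀ t : ℝ, ∀ᶠ m in (𝒰 : Filter ℕ), t ≤ dist x (y m) := fun t =>
    (hdist.eventually_ge_atTop t).filter_mono h𝒰
  have hlim : ∀ t : ℝ, ∃ p : Y, 0 ≤ t → Tendsto (fun m => c m t) 𝒰 (𝓝 p) := by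
    intro t
    by_cases ht : 0 ≤ t
    swap
    · exact ⟨x, fun h => absurd h ht⟩
    have h1 : (𝒰.map fun m => c m t : Ultrafilter Y) ≤ 𝓟 (Metric.closedBall x t) := by
      rw [le_principal_iff]
      change ∀ᶠ m in (𝒰 : Filter ℕ), c m t ∈ Metric.closedBall x t
      filter_upwards [hev t] with m hm
      have := hciso m 0 ⟨le_rfl, dist_nonneg⟩ t ⟨ht, hm⟩
      rw [hc0, zero_sub, abs_neg, abs_of_nonneg ht, dist_comm] at this
      exact this.le
    obtain ⟨p, -, hp⟩ := (isCompact_closedBall x t).ultrafilter_le_nhds _ h1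
    exact ⟨p, fun _ => hp⟩
  choose c' hc' using hlim
  have hray : IsGeodRay c' x := by
    refine ⟨tendsto_nhds_unique (hc' 0 le_rfl) (by simp [hc0]), fun s hs t ht => ?_⟩
    refine tendsto_nhds_unique ((hc' s hs).dist (hc' t ht)) ?_
    refine tendsto_const_nhds.congr' ?_
    filter_upwards [hev s, hev t] with m hm1 hm2
    exact (hciso m s ⟨hs, hm1⟩ t ⟨ht, hm2⟩).symm
  refine ⟨c', hray, fun t ht => ?_⟩
  have hm : ∀ n, ∃ m : ℕ, n ≤ m ∧ (0 ≤ t n →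
      t n ≤ dist x (y m) ∧ dist (c' (t n)) (c m (t n)) ≤ 1) := by
    intro n
    by_cases h0 : 0 ≤ t n
    · have h1 : ∀ᶠ m in (𝒰 : Filter ℕ), dist (c' (t n)) (c m (t n)) < 1 := by
        have := (hc' (t n) h0).eventually (Metric.ball_mem_nhds _ one_pos)
        filter_upwards [this] with m hm
        rw [dist_comm]; exact hm
      obtain ⟨m, h2, h3, h4⟩ := (h1.and ((hev (t n)).and
        ((eventually_ge_atTop n).filter_mono h𝒰))).exists
      exact ⟨m, h4, fun _ => ⟨h3, h2.le⟩⟩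
    · exact ⟨n, le_rfl, fun h => absurd h h0⟩
  choose m hmn hm using hm
  have hmt : Tendsto m atTop atTop := tendsto_atTop_mono hmn tendsto_id
  refine accumulatesInto_of_fellow hY hconv (x := x) (y' := fun n => y (m n)) (r := 1) ht ?_
    (hacc.comp hmt)
  filter_upwards [ht.eventually_ge_atTop 0] with n hn
  refine ⟨_, _, c' (t n), c (m n) (t n), hray.segment hn,
    ⟨c (m n), hc0 _, hc1 _, hciso _, hcγ _⟩, ⟨t n, ⟨hn, le_rfl⟩, rfl⟩, ?_, (hm n hn).2, ?_⟩
  · rw [hcγ]; exact ⟨t n, ⟨hn, (hm n hn).1⟩, rfl⟩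
  · have := hray.2 0 (by simp) (t n) hn
    rw [hray.1, zero_sub, abs_neg, abs_of_nonneg hn] at this
    exact this.ge

/-! ### Attracting and repelling classes of contracting elements -/

section Attracting

variable {h : G}

theorem IsContractingElt.tendsto_dist (hh : IsContractingElt o h) :
    Tendsto (fun n : ℕ => dist o (h ^ n • o)) atTop atTop := by
  rw [tendsto_atTop]
  intro R
  obtain ⟨K, hK0, hK⟩ := hh.exists_lt_dist R
  filter_upwards [eventually_ge_atTop K.toNat] with n hn
  have := hK 0 n (by rw [zero_sub, abs_neg, Nat.abs_cast]; omega)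
  simpa using this.le

/-- The attracting set is a single class: by the Morse property the geodesics to `h ^ φ n • o` pass
near `h ^ n • o`, whatever subsequence `φ` is used to define the limit. -/
theorem accumulatesInto_attracting (hY : IsGeodesicSpace Y)
    (hconv : IsConvergenceBoundary ι S) (hh : IsContractingElt o h) {ζ : Z}
    (hζ : ζ ∈ attracting ι S o h) : AccumulatesInto (fun n : ℕ => ι (h ^ n • o)) (cls ι S ζ) := by
  obtain ⟨ζ₀, ⟨hcl, hb⟩, -, hr⟩ := hζ
  rw [cls_eq hr]
  obtain ⟨φ, hφ, hlim⟩ := MapClusterPt.tendsto_subseq hcl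
  obtain ⟨D, K, hD⟩ := hh.morse
  refine accumulatesInto_of_fellow hY hconv (x := o) (y' := fun n => h ^ φ n • o) (r := D)
    hh.tendsto_dist ?_ (accumulatesInto_of_tendsto hlim (self_mem_cls hb))
  filter_upwards [eventually_ge_atTop K.toNat] with n hn
  obtain ⟨γ, hγ⟩ := hY o (h ^ n • o)
  obtain ⟨γ', hγ'⟩ := hY o (h ^ φ n • o)
  have h1 : n ≤ φ n := hφ.id_le n
  obtain ⟨w, hw, hwD⟩ := hD o (h ^ φ n • o) γ' 0 n (φ n) hγ'
    (by simpa using self_mem_proj (zpow_mem_cyclicOrbit o h 0))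
    (by simpa using self_mem_proj (zpow_mem_cyclicOrbit o h (φ n))) (by omega) (by omega)
    (by omega)
  exact ⟨γ, γ', h ^ n • o, w, hγ, hγ', hγ.right_mem, hw, by simpa [dist_comm] using hwD, le_rfl⟩

theorem exists_mem_attracting (he : IsOpenEmbedding ι) (hh : IsContractingElt o h) :
    ∃ ζ ∈ limitSet ι (MulAction.orbit G o), ζ ∈ attracting ι S o h := by
  obtain ⟨ζ, φ, hφ, hlim⟩ := CompactSpace.tendsto_subseq (fun n : ℕ => ι (h ^ n • o))
  have hcl := mapClusterPt_of_subseq hφ.tendsto_atTop hlim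
  have hb := accumulatesInto_bdry he hh.tendsto_dist ζ hcl
  refine ⟨ζ, ⟨mem_closure_of_tendsto hlim (Eventually.of_forall fun n =>
    ⟨_, MulAction.mem_orbit _ _, rfl⟩), hb⟩, ζ, ⟨hcl, hb⟩, self_mem_cls hb⟩

/-- Sequences tending to the attracting class of a non-pinched contracting element project to
its orbit far in the positive direction. -/
theorem eventually_le_of_accumulatesInto (hY : IsGeodesicSpace Y)
    (hconv : IsConvergenceBoundary ι S) (hh : IsContractingElt o h)
    (hnp : attracting ι S o h ⊆ nonpinched ι S) {ζ : Z} (hζ : ζ ∈ attracting ι S o h)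
    {y : ℕ → Y} (hy : AccumulatesInto (fun n => ι (y n)) (cls ι S ζ)) (M : ℤ) :
    ∀ᶠ n in atTop, ∀ i : ℤ, h ^ i • o ∈ proj (cyclicOrbit o h) (y n) → M ≤ i := by
  by_contra hcon
  rw [not_eventually] at hcon
  obtain ⟨ψ, hψ, hψi⟩ := extraction_of_frequently_atTop hcon
  push Not at hψi
  choose i hi hiM using hψi
  obtain ⟨D, K, hD⟩ := hh.morse
  set k : ℕ → ℕ := fun n => n + (M.natAbs + K.natAbs) with hk
  choose γ hγ using fun n => hY (y (ψ n)) (h ^ k n • o)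
  have hkt : Tendsto k atTop atTop := tendsto_add_atTop_nat _
  -- If the indices stay below `M`, the geodesics from `y (ψ n)` to `h ^ k n • o` all pass near `h ^
  -- M • o`, although both endpoints tend to the non-pinched class.
  have hex := (hnp hζ).2 (fun n => y (ψ n)) (fun n => h ^ k n • o) γ
    (hy.comp hψ.tendsto_atTop) ((accumulatesInto_attracting hY hconv hh hζ).comp hkt) hγ
    (h ^ M • o) (D + 1)
  obtain ⟨n, hn⟩ := hex.exists
  obtain ⟨w, hw, hwD⟩ := hD _ _ _ (i n) M (k n) (hγ n) (hi n)
    (by simpa using self_mem_proj (zpow_mem_cyclicOrbit o h (k n))) (hiM n).le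
    (by simp only [hk]; omega) (by have := hiM n; simp only [hk]; omega)
  have := hn w hw
  rw [dist_comm] at this
  linarith

/-- If the attracting class of a contracting element is pinched, then it is the limit of points
with projections that do not go to infinity in the positive direction. -/
theorem exists_of_not_nonpinched (hY : IsGeodesicSpace Y) (hh : IsContractingElt o h)
    (hnp : ¬ attracting ι S o h ⊆ nonpinched ι S) :
    ∃ ζ ∈ attracting ι S o h, ∃ (M : ℤ) (x : ℕ → Y),
      AccumulatesInto (fun n => ι (x n)) (cls ι S ζ) ∧
      ∀ n, ∃ i ≤ M, h ^ i • o ∈ proj (cyclicOrbit o h) (x n) := by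
  rw [not_subset] at hnp
  obtain ⟨ζ, hζ, hζn⟩ := hnp
  have hb : ζ ∈ bdry ι := by obtain ⟨_, _, h1, _⟩ := hζ; exact h1
  by_contra hcon
  refine hζn ⟨hb, fun x y γ hx hy hγ => ?_⟩
  have key : ∀ x : ℕ → Y, AccumulatesInto (fun n => ι (x n)) (cls ι S ζ) → ∀ M : ℤ,
      ∀ᶠ n in atTop, ∀ i : ℤ, h ^ i • o ∈ proj (cyclicOrbit o h) (x n) → M < i := by
    intro x hx M
    by_contra hev
    rw [not_eventually] at hev
    obtain ⟨ψ, hψ, hψi⟩ := extraction_of_frequently_atTop hev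
    push Not at hψi
    refine hcon ⟨ζ, hζ, M, fun n => x (ψ n), hx.comp hψ.tendsto_atTop, fun n => ?_⟩
    obtain ⟨i, hi, hiM⟩ := hψi n
    exact ⟨i, hiM, hi⟩
  by_contra hexit
  simp only [Exiting] at hexit
  push Not at hexit
  obtain ⟨o', R, hfr⟩ := hexit
  obtain ⟨C, hC⟩ := hh.2.1
  obtain ⟨D, K, hD⟩ := hh.morse
  have hC1 := hC.1
  obtain ⟨K₁, hK₁0, hK₁⟩ := hh.exists_lt_dist (dist o o' + R + 4 * C + 3 * D)
  obtain ⟨n, ⟨p, hp, hpR⟩, hn1, hn2⟩ := (hfr.and_eventually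
    ((key x hx (K₁ + |K|)).and (key y hy (K₁ + |K|)))).exists
  obtain ⟨u, hu⟩ := proj_nonempty hC.2.1 (cyclicOrbit_nonempty o h) (x n)
  obtain ⟨v, hv⟩ := proj_nonempty hC.2.1 (cyclicOrbit_nonempty o h) (y n)
  obtain ⟨z, hz⟩ := proj_nonempty hC.2.1 (cyclicOrbit_nonempty o h) p
  obtain ⟨i, rfl⟩ := hu.1
  obtain ⟨j, rfl⟩ := hv.1
  obtain ⟨a, rfl⟩ := hz.1
  have hi := hn1 i hu
  have hj := hn2 j hv
  have hKabs := le_abs_self K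
  have hK0 := abs_nonneg K
  obtain ⟨γ₁, hs₁, hγ₁, hm₁⟩ := (hγ n).sub_left hp
  obtain ⟨γ₂, hs₂, hγ₂, hm₂⟩ := (hγ n).sub_right hp
  have hop : dist o p < dist o o' + R := by linarith [dist_triangle o o' p]
  have hDn : 0 ≤ D := by
    obtain ⟨w, -, hw⟩ := hD (h ^ (0 : ℤ) • o) (h ^ |K| • o) _ 0 0 |K|
      (hY _ _).choose_spec (self_mem_proj (zpow_mem_cyclicOrbit o h _))
      (self_mem_proj (zpow_mem_cyclicOrbit o h _)) le_rfl hK0 (by omega)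
    exact dist_nonneg.trans hw
  have haK : a < K₁ := by
    by_contra hle
    push Not at hle
    have h1 := hK₁ 0 a (by rw [zero_sub, abs_neg]; exact hle.trans (le_abs_self a))
    have h2 := proj_lip hY hC (self_mem_proj (zpow_mem_cyclicOrbit o h 0)) hz
    simp only [zpow_zero, one_smul] at h1 h2
    linarith
  -- Both endpoints project far in the positive direction, but `p`, being near `o`, does not. So the
  -- geodesic passes `h ^ K₁ • o` before `p` and again after `p`; since `p` is far from there, this
  -- is a detour.
  obtain ⟨w, hw, hwD⟩ := hD _ _ _ a K₁ i hγ₁.symm hz hu haK.le (by omega) (by omega)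
  obtain ⟨w', hw', hwD'⟩ := hD _ _ _ a K₁ j hγ₂ hz hv haK.le (by omega) (by omega)
  have e1 := (hm₁ w (hs₁ hw)).1 hw
  have e2 := (hm₂ w' (hs₂ hw')).1 hw'
  have e3 := (hγ n).dist_add_of_le (hs₁ hw) hp e1
  have e4 := (hγ n).dist_add_of_le (hs₁ hw) (hs₂ hw') (e1.trans e2)
  have e5 := dist_triangle_right w w' (h ^ K₁ • o)
  have e6 := dist_triangle4 o p w (h ^ K₁ • o)
  rw [dist_comm p w] at e6
  have e7 := hK₁ 0 K₁ (by rw [zero_sub, abs_neg]; exact le_abs_self _)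
  simp only [zpow_zero, one_smul] at e7
  linarith

/-- Otherwise `h ^ (-n) • o` would tend to the attracting class, while its projection to the orbit
has index `-n`. -/
theorem not_rel_of_attracting (hY : IsGeodesicSpace Y)
    (hconv : IsConvergenceBoundary ι S) (hh : IsContractingElt o h)
    (hnp : attracting ι S o h ⊆ nonpinched ι S) {a b : Z} (ha : a ∈ attracting ι S o h)
    (hb : b ∈ attracting ι S o h⁻¹) : ¬ S.r a b := by
  intro hab
  have h1 := accumulatesInto_attracting hY hconv hh.inv hb
  rw [← cls_eq hab] at h1
  obtain ⟨n, hn, hn1⟩ := ((eventually_le_of_accumulatesInto hY hconv hh hnp ha h1 0).and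
    (eventually_gt_atTop 0)).exists
  have := hn (-n) (by
    have := self_mem_proj (zpow_mem_cyclicOrbit o h (-n))
    simpa using this)
  omega

theorem attracting_pow_subset (f : G) {k : ℕ} (hk : k ≠ 0) :
    attracting ι S o (f ^ k) ⊆ attracting ι S o f := by
  rintro ζ ⟨ζ₀, ⟨hcl, hb⟩, hc⟩
  refine ⟨ζ₀, ⟨?_, hb⟩, hc⟩
  have ht : Tendsto (fun n : ℕ => k * n) atTop atTop :=
    tendsto_id.const_mul_atTop' (Nat.pos_of_ne_zero hk)
  refine MapClusterPt.of_comp (u := fun n : ℕ => ι (f ^ n • o)) ht ?_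
  have : (fun n : ℕ => ι ((f ^ k) ^ n • o)) = (fun n : ℕ => ι (f ^ n • o)) ∘ fun n => k * n := by
    funext n; simp [pow_mul]
  rw [← this]
  exact hcl

theorem IsNonpinchedElt.pow {f : G} (hf : IsNonpinchedElt ι S o f) {k : ℕ} (hk : k ≠ 0) :
    IsNonpinchedElt ι S o (f ^ k) :=
  ⟨(attracting_pow_subset f hk).trans hf.1, by
    rw [← inv_pow]; exact (attracting_pow_subset f⁻¹ hk).trans hf.2⟩

end Attracting

section Action

theorem smul_mem_bdry (hcomp : IsCompactification G ι S) (g : G) {ξ : Z} (hξ : ξ ∈ bdry ι) :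
    g • ξ ∈ bdry ι := by
  rintro ⟨y, hy⟩
  exact hξ ⟨g⁻¹ • y, by rw [hcomp.equivariant, hy, inv_smul_smul]⟩

end Action

end Boundary

/-! ### Periodic chains given by one period of two sets -/

section PairChain

variable {G Y : Type*} [Group G] [MetricSpace Y] [MulAction G Y] [IsIsometricSMul G Y]

/-- The sequence `…, a, b, f a, f b, f² a, …`, starting with `a` at the index `0`. -/
def pairSeq {α : Type*} [SMul G α] (f : G) (a b : α) (t : ℤ) : α :=
  f ^ (t / 2) • if t % 2 = 0 then a else b

theorem pairSeq_even {α : Type*} [SMul G α] (f : G) (a b : α) (m : ℤ) :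
    pairSeq f a b (2 * m) = f ^ m • a := by
  rw [pairSeq, if_pos (by omega), show 2 * m / 2 = m by omega]

theorem pairSeq_odd {α : Type*} [SMul G α] (f : G) (a b : α) (m : ℤ) :
    pairSeq f a b (2 * m + 1) = f ^ m • b := by
  rw [pairSeq, if_neg (by omega), show (2 * m + 1) / 2 = m by omega]

theorem pairSeq_zero {α : Type*} [MulAction G α] (f : G) (a b : α) : pairSeq f a b 0 = a := by
  simpa using pairSeq_even f a b 0

theorem pairSeq_one {α : Type*} [MulAction G α] (f : G) (a b : α) : pairSeq f a b 1 = b := by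
  simpa using pairSeq_odd f a b 0

theorem pairSeq_add_two {α : Type*} [MulAction G α] (f : G) (a b : α) (t : ℤ) :
    pairSeq f a b (t + 2) = f • pairSeq f a b t := by
  rw [pairSeq, pairSeq, show (t + 2) / 2 = 1 + t / 2 by omega, show (t + 2) % 2 = t % 2 by omega,
    zpow_add, zpow_one, mul_smul]

theorem periodicChain_of_pair {f : G} {A₀ A₁ : Set Y} {l₀ r₀ l₁ r₁ : Y} {C θ : ℝ}
    (hA₀ : IsContracting C A₀) (hA₁ : IsContracting C A₁) (hne₀ : A₀.Nonempty)
    (hne₁ : A₁.Nonempty) (hθ : 0 ≤ θ) (hl₀ : ∀ y ∈ f⁻¹ • A₁, ProjNear A₀ y l₀ θ)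
    (hr₀ : ∀ y ∈ A₁, ProjNear A₀ y r₀ θ) (hl₁ : ∀ y ∈ A₀, ProjNear A₁ y l₁ θ)
    (hr₁ : ∀ y ∈ f • A₀, ProjNear A₁ y r₁ θ) (hs₀ : 100 * (C + θ) < dist l₀ r₀)
    (hs₁ : 100 * (C + θ) < dist l₁ r₁) :
    PeriodicChain f 2 C θ (pairSeq f A₀ A₁) (pairSeq f l₀ l₁) (pairSeq f r₀ r₁) where
  contr t := by
    obtain ⟨m, rfl | rfl⟩ := Int.even_or_odd' t
    · rw [pairSeq_even]; exact hA₀.smul _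
    · rw [pairSeq_odd]; exact hA₁.smul _
  ne t := by
    obtain ⟨m, rfl | rfl⟩ := Int.even_or_odd' t
    · rw [pairSeq_even]; exact hne₀.smul_set
    · rw [pairSeq_odd]; exact hne₁.smul_set
  nonneg := hθ
  left t y hy := by
    obtain ⟨m, rfl | rfl⟩ := Int.even_or_odd' t
    · rw [show 2 * m - 1 = 2 * (m - 1) + 1 by ring, pairSeq_odd,
        Set.mem_smul_set_iff_inv_smul_mem] at hy
      rw [pairSeq_even, pairSeq_even, projNear_smul_iff, inv_smul_smul]
      refine hl₀ _ ?_
      rw [Set.mem_smul_set_iff_inv_smul_mem, inv_inv, ← mul_smul]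
      rwa [show (f ^ (m - 1))⁻¹ = f * (f ^ m)⁻¹ by rw [zpow_sub_one]; group] at hy
    · rw [show 2 * m + 1 - 1 = 2 * m by ring, pairSeq_even,
        Set.mem_smul_set_iff_inv_smul_mem] at hy
      rw [pairSeq_odd, pairSeq_odd, projNear_smul_iff, inv_smul_smul]
      exact hl₁ _ hy
  right t y hy := by
    obtain ⟨m, rfl | rfl⟩ := Int.even_or_odd' t
    · rw [pairSeq_odd, Set.mem_smul_set_iff_inv_smul_mem] at hy
      rw [pairSeq_even, pairSeq_even, projNear_smul_iff, inv_smul_smul]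
      exact hr₀ _ hy
    · rw [show 2 * m + 1 + 1 = 2 * (m + 1) by ring, pairSeq_even,
        Set.mem_smul_set_iff_inv_smul_mem] at hy
      rw [pairSeq_odd, pairSeq_odd, projNear_smul_iff, inv_smul_smul]
      refine hr₁ _ ?_
      rw [Set.mem_smul_set_iff_inv_smul_mem, ← mul_smul]
      rwa [show (f ^ (m + 1))⁻¹ = f⁻¹ * (f ^ m)⁻¹ by rw [zpow_add_one]; group] at hy
  sep t := by
    obtain ⟨m, rfl | rfl⟩ := Int.even_or_odd' t
    · rw [pairSeq_even, pairSeq_even, dist_smul]; exact hs₀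
    · rw [pairSeq_odd, pairSeq_odd, dist_smul]; exact hs₁
  pos := by norm_num
  smul_set := pairSeq_add_two f A₀ A₁
  smul_left := pairSeq_add_two f l₀ l₁
  smul_right := pairSeq_add_two f r₀ r₁

end PairChain

/-! ### Three translates of an axis, and the extension of arbitrary elements to contracting ones -/

section Frames

variable {G Y : Type*} [Group G] [MetricSpace Y] [MulAction G Y] [IsIsometricSMul G Y]

/-- The translates of the axis of `h` are uniformly contracting and have bounded projection to
each other; and for each point, at most one of the three axes `t i • Ax(h)` sees it far
away from `o`. -/
structure Frame (o : Y) (h : G) (t : Fin 3 → G) (C θ κ₀ κ : ℝ) : Prop where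
  contr : ∀ g : G, IsContracting C (g • axis o h)
  proj_bound : ∀ g g' : G, g • axis o h ≠ g' • axis o h → ∀ x ∈ g' • axis o h,
    ∀ y ∈ g' • axis o h, ∀ u ∈ proj (g • axis o h) x, ∀ v ∈ proj (g • axis o h) y, dist u v ≤ θ
  nonneg : 0 ≤ θ
  base : ∀ i, dist o (t i • o) ≤ κ₀
  nonneg' : 0 ≤ κ
  good : ∀ y : Y, ∃ k, ∀ i, i ≠ k → ProjNear (t i • axis o h) y o κ

/-- Any three distinct translates of the axis will do. By Behrstock, a point seen far from `o` on
one of them projects to each of the others near the projection of the first, hence near `o`; `κ`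
absorbs all the distances between `o` and these gates. -/
theorem exists_frame [ProperSpace Y] (hY : IsGeodesicSpace Y) (hproper : IsProperAction G Y)
    (hnonel : IsNonelementary G) {o : Y} {h : G} (hh : IsContractingElt o h) :
    ∃ (t : Fin 3 → G) (C θ κ₀ κ : ℝ), Frame o h t C θ κ₀ κ := by
  obtain ⟨C, hC⟩ := hh.axis_contracting hY hproper
  have hC1 := hC.1
  obtain ⟨τ, hτ⟩ := hh.exists_boundedIntersection_self hY hproper
  set θ := max C (τ (5 * C)) with hθ
  have hθC : C ≤ θ := le_max_left _ _
  have hne : ∀ g : G, (g • axis o h).Nonempty := fun g => (axis_nonempty o h).smul_set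
  have hpb : ∀ g g' : G, g • axis o h ≠ g' • axis o h → ∀ x ∈ g' • axis o h,
      ∀ y ∈ g' • axis o h, ∀ u ∈ proj (g • axis o h) x, ∀ v ∈ proj (g • axis o h) y,
        dist u v ≤ θ := by
    intro g g' hgg x hx y hy u hu v hv
    by_cases huv : dist u v ≤ C
    · exact huv.trans (le_max_left _ _)
    push Not at huv
    obtain ⟨γ, hγ⟩ := hY x y
    obtain ⟨p, hp, q, hq, hpu, hqv, -⟩ := bgi (hC.smul g) hγ hu hv huv
    -- The radius `5 * C` is `3 * C` from the quasi-convexity of the second axis plus `2 * C` from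
    -- `bgi`.
    have near : ∀ p ∈ γ, ∀ u ∈ g • axis o h, dist p u ≤ 2 * C →
        u ∈ Metric.cthickening (5 * C) (g • axis o h) ∩
          Metric.cthickening (5 * C) (g' • axis o h) := by
      intro p hp u hu hpu
      refine ⟨Metric.self_subset_cthickening _ hu, ?_⟩
      rw [mem_cthickening_iff_infDist_le (hne g') (by linarith)]
      have h1 := quasiconvex (hC.smul g') (hne g') hγ le_rfl
        (by rw [Metric.infDist_zero_of_mem hx]; linarith)
        (by rw [Metric.infDist_zero_of_mem hy]; linarith) hp
      have h2 := Metric.infDist_le_infDist_add_dist (s := g' • axis o h) (x := u) (y := p)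
      rw [dist_comm] at h2
      linarith
    exact (hτ g g' hgg (5 * C) (by linarith) u (near p hp u hu.1 hpu) v
      (near q hq v hv.1 hqv)).trans (le_max_right _ _)
  obtain ⟨T, hTs, hTc⟩ := (hh.infinite_translates hY hproper hnonel).exists_subset_card_eq 3
  let eT := (Finset.equivFinOfCardEq hTc).symm
  have hex : ∀ i : Fin 3, ∃ g : G, g • axis o h = (eT i : Set Y) := fun i => hTs (eT i).2
  choose t ht using hex
  have hdist : ∀ i j, i ≠ j → t i • axis o h ≠ t j • axis o h := by
    intro i j hij heq
    rw [ht, ht] at heq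
    exact hij (eT.injective (Subtype.ext heq))
  have hgate : ∀ i j : Fin 3, ∃ a, a ∈ proj (t i • axis o h) (t j • o) := fun i j =>
    proj_nonempty (hC.smul (t i)).2.1 (hne _) _
  choose a ha using hgate
  set κ := ∑ i, ∑ j, dist (a i j) o + θ + 6 * C with hκ
  have hκ' : ∀ i j, dist (a i j) o + θ + 6 * C ≤ κ := by
    intro i j
    have h1 : dist (a i j) o ≤ ∑ j, dist (a i j) o :=
      Finset.single_le_sum (f := fun j => dist (a i j) o) (fun _ _ => dist_nonneg)
        (Finset.mem_univ j)
    have h2 : ∑ j, dist (a i j) o ≤ ∑ i, ∑ j, dist (a i j) o :=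
      Finset.single_le_sum (f := fun i => ∑ j, dist (a i j) o)
        (fun _ _ => Finset.sum_nonneg fun _ _ => dist_nonneg) (Finset.mem_univ i)
    linarith
  have hproj : ∀ i j, i ≠ j → ∀ y ∈ t j • axis o h, ProjNear (t i • axis o h) y (a i j) θ := by
    intro i j hij y hy u hu
    exact hpb _ _ (hdist i j hij) y hy _ (Set.smul_mem_smul_set (self_mem_axis o h)) u hu _
      (ha i j)
  refine ⟨t, C, θ, ∑ i, dist o (t i • o), κ, fun g => hC.smul g, hpb, by linarith, fun i => ?_,
    by linarith [hκ' 0 0, dist_nonneg (x := a 0 0) (y := o)], fun y => ?_⟩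
  · exact Finset.single_le_sum (f := fun i => dist o (t i • o)) (fun _ _ => dist_nonneg)
      (Finset.mem_univ i)
  · by_cases hbad : ∃ k, ¬ ProjNear (t k • axis o h) y o κ
    swap
    · push Not at hbad
      exact ⟨0, fun i _ => hbad i⟩
    obtain ⟨k, hk⟩ := hbad
    refine ⟨k, fun i hik => ?_⟩
    simp only [ProjNear] at hk
    push Not at hk
    obtain ⟨u, hu, hfar⟩ := hk
    have := behrstock hY (hC.smul (t k)) (hC.smul (t i)) (hne _) (hne _)
      (hproj k i hik.symm) (hproj i k hik) hu
      (by linarith [hκ' k i, dist_triangle u (a k i) o])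
    intro v hv
    linarith [this v hv, hκ' i k, dist_triangle v (a i k) o]

namespace Frame

variable {o : Y} {h : G} {t : Fin 3 → G} {C θ κ₀ κ : ℝ}

theorem one_le (fr : Frame o h t C θ κ₀ κ) : 1 ≤ C := (fr.contr 1).1

theorem nonneg₀ (fr : Frame o h t C θ κ₀ κ) : 0 ≤ κ₀ := dist_nonneg.trans (fr.base 0)

/-- Each point excludes at most one of the axes; with three of them, one is left for any two points.
-/
theorem good₂ (fr : Frame o h t C θ κ₀ κ) (y y' : Y) :
    ∃ i, ProjNear (t i • axis o h) y o κ ∧ ProjNear (t i • axis o h) y' o κ := by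
  obtain ⟨k, hk⟩ := fr.good y
  obtain ⟨k', hk'⟩ := fr.good y'
  have : ∀ k k' : Fin 3, ∃ i, i ≠ k ∧ i ≠ k' := by decide
  obtain ⟨i, hi, hi'⟩ := this k k'
  exact ⟨i, hk i hi, hk' i hi'⟩

variable [ProperSpace Y]

/-- If the axes agreed, `p • o` would be close to the point `p • t i • o` of the axis, hence project
near itself; but it projects near `o`, which is far away. -/
theorem ne_of_far (hY : IsGeodesicSpace Y) (fr : Frame o h t C θ κ₀ κ) {p : G} {i j : Fin 3}
    (hg : ProjNear (t j • axis o h) (p • o) o κ) (hp : 4 * C + 2 * κ₀ + κ < dist o (p • o)) :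
    t j • axis o h ≠ p • t i • axis o h := by
  intro heq
  have hx : p • t i • o ∈ t j • axis o h := by
    rw [heq]; exact Set.smul_mem_smul_set (Set.smul_mem_smul_set (self_mem_axis o h))
  obtain ⟨u, hu⟩ := proj_nonempty (fr.contr (t j)).2.1 ⟨_, hx⟩ (p • o)
  have h1 := hg u hu
  have h2 := proj_lip hY (fr.contr (t j)) hu (self_mem_proj hx)
  have h3 := fr.base i
  rw [dist_smul] at h2
  have h4 := dist_triangle4 o u (p • t i • o) (p • o)
  rw [dist_comm o u, dist_smul, dist_comm (t i • o)] at h4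
  linarith

/-- The other axis has projection of diameter at most `θ`, and its point `p • t i • o` is `κ₀`-close
to `p • o`, which projects near `o`. The resulting sum is the `θ` of the chains below. -/
theorem projNear_of_good (hY : IsGeodesicSpace Y) (fr : Frame o h t C θ κ₀ κ) {p : G}
    {i j : Fin 3} (hg : ProjNear (t j • axis o h) (p • o) o κ)
    (hne : t j • axis o h ≠ p • t i • axis o h) :
    ∀ y ∈ p • t i • axis o h, ProjNear (t j • axis o h) y o (θ + κ₀ + 4 * C + κ) := by
  intro y hy u hu
  have hx : p • t i • o ∈ p • t i • axis o h :=
    Set.smul_mem_smul_set (Set.smul_mem_smul_set (self_mem_axis o h))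
  have hne' : (t j • axis o h).Nonempty := ⟨u, hu.1⟩
  obtain ⟨v, hv⟩ := proj_nonempty (fr.contr (t j)).2.1 hne' (p • t i • o)
  obtain ⟨w, hw⟩ := proj_nonempty (fr.contr (t j)).2.1 hne' (p • o)
  rw [← mul_smul p] at hne hy
  have h1 := fr.proj_bound _ _ hne y hy _ (by rwa [← mul_smul p (t i) (axis o h)] at hx) u hu v hv
  have h2 := proj_lip hY (fr.contr (t j)) hv hw
  have h3 := hg w hw
  have h4 := fr.base i
  rw [dist_smul, dist_comm] at h2
  have h5 := dist_triangle4 u v w o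
  rw [dist_comm w v] at h2
  rw [dist_comm (t i • o)] at h2
  linarith

end Frame

/-- The conjugate `s h ^ N s⁻¹`. -/
def conjPow (s h : G) (N : ℤ) : G := s * h ^ N * s⁻¹

theorem conjPow_neg (s h : G) (N : ℤ) : conjPow s h (-N) = (conjPow s h N)⁻¹ := by
  simp only [conjPow, zpow_neg]; group

theorem conjPow_smul_axis (o : Y) (s h : G) (N : ℤ) :
    conjPow s h N • s • axis o h = s • axis o h := by
  rw [← mul_smul, conjPow, inv_mul_cancel_right, mul_smul, smul_axis (zpow_mem_elemClosure o h N)]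

theorem dist_conjPow (o : Y) (s h : G) (N : ℤ) :
    dist o (h ^ N • o) - 2 * dist o (s • o) ≤ dist o (conjPow s h N • o) := by
  have h1 := dist_triangle4 (s • o) o (conjPow s h N • o) (s • h ^ N • o)
  have h2 : dist (conjPow s h N • o) (s • h ^ N • o) = dist o (s • o) := by
    rw [show s • h ^ N • o = conjPow s h N • s • o by simp [conjPow, mul_smul], dist_smul]
  rw [dist_smul, h2, dist_comm (s • o) o] at h1
  linarith

namespace Frame

variable {o : Y} {h : G} {t : Fin 3 → G} {C θ κ₀ κ : ℝ} [ProperSpace Y]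

/-- The chain of axes crossed by the element `p e₁ p⁻¹ e₂`, for long elements `e₁` and `e₂` along
suitable axes. -/
theorem chain (hY : IsGeodesicSpace Y) (fr : Frame o h t C θ κ₀ κ) {p : G} {i j : Fin 3}
    (hi : ProjNear (t i • axis o h) (p⁻¹ • o) o κ) (hj : ProjNear (t j • axis o h) (p • o) o κ)
    (hp : 4 * C + 2 * κ₀ + κ < dist o (p • o)) {N M : ℤ} {e₁ e₂ : G}
    (he₁ : e₁ = conjPow (t i) h N) (he₂ : e₂ = conjPow (t j) h M)
    (hN : 100 * (C + (θ + κ₀ + 4 * C + κ)) < dist o (e₁ • o))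
    (hM : 100 * (C + (θ + κ₀ + 4 * C + κ)) < dist o (e₂ • o)) :
    PeriodicChain (p * e₁ * p⁻¹ * e₂) 2 C (θ + κ₀ + 4 * C + κ)
      (pairSeq (p * e₁ * p⁻¹ * e₂) (t j • axis o h) (p • t i • axis o h))
      (pairSeq (p * e₁ * p⁻¹ * e₂) (e₂⁻¹ • o) (p • o))
      (pairSeq (p * e₁ * p⁻¹ * e₂) o (p • e₁ • o)) := by
  have hp' : 4 * C + 2 * κ₀ + κ < dist o (p⁻¹ • o) := by
    rwa [← dist_smul p, smul_inv_smul, dist_comm]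
  have n1 := fr.projNear_of_good hY (i := i) hj (fr.ne_of_far hY hj hp)
  have n2 := fr.projNear_of_good hY (i := j) hi (fr.ne_of_far hY hi hp')
  have s1 : e₁ • t i • axis o h = t i • axis o h := by rw [he₁]; exact conjPow_smul_axis o _ h N
  have s2 : e₂ • t j • axis o h = t j • axis o h := by rw [he₂]; exact conjPow_smul_axis o _ h M
  have s2' : e₂⁻¹ • t j • axis o h = t j • axis o h := by rw [inv_smul_eq_iff, s2]
  have hne : ∀ g : G, (g • axis o h).Nonempty := fun g => (axis_nonempty o h).smul_set
  have := fr.one_le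
  have := fr.nonneg
  have := fr.nonneg'
  have := fr.nonneg₀
  refine periodicChain_of_pair (fr.contr _) ((fr.contr _).smul p) (hne _) (hne _).smul_set
    (by linarith) ?_ n1 ?_ ?_ ?_ ?_
  -- The previous member is `e₂⁻¹ • p • t i • axis o h`, because `e₁` preserves `t i • axis o h`.
  -- Since `e₂` preserves `t j • axis o h`, the claim is the `e₂⁻¹`-translate of `n1`.
  · intro y hy
    have e : (p * e₁ * p⁻¹ * e₂)⁻¹ • p • t i • axis o h = e₂⁻¹ • p • t i • axis o h := by
      have : (p * e₁ * p⁻¹ * e₂)⁻¹ * p * e₁ = e₂⁻¹ * p := by group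
      conv_lhs => rw [← s1]
      rw [← mul_smul, ← mul_smul, this, mul_smul]
    rw [e] at hy
    rw [← s2', projNear_smul_iff, inv_smul_smul]
    exact n1 _ (Set.mem_smul_set_iff_inv_smul_mem.1 hy)
  · intro y hy
    rw [projNear_smul_iff, inv_smul_smul]
    exact n2 _ (Set.smul_mem_smul_set hy)
  · intro y hy
    have e : (p * e₁ * p⁻¹ * e₂) • t j • axis o h = (p * e₁) • p⁻¹ • t j • axis o h := by
      conv_rhs => rw [← s2]
      simp only [← mul_smul, mul_assoc]
    rw [e] at hy
    rw [← s1, ← mul_smul, ← mul_smul p e₁ o, projNear_smul_iff, inv_smul_smul]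
    exact n2 _ (Set.mem_smul_set_iff_inv_smul_mem.1 hy)
  · rw [← dist_smul e₂, smul_inv_smul]; exact hM
  · rw [dist_smul]; exact hN

end Frame

end Frames

/-! ### Independence of elements that shift chains -/

section Independence

variable {G Y : Type*} [Group G] [MetricSpace Y] [MulAction G Y] [IsIsometricSMul G Y]
  [ProperSpace Y] {f : G} {P : ℤ} {C θ : ℝ} {B : ℤ → Set Y} {l r : ℤ → Y}

namespace PeriodicChain

theorem exists_gate_zpow (hY : IsGeodesicSpace Y) (ch : PeriodicChain f P C θ B l r) (x : Y)
    {m : ℤ} (hm : m ≠ 0) :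
    ∃ s : ℤ, Gate C θ B r 0 (f ^ (m * s) • x) ∧ Gate C θ B l 0 (f ^ (m * (-s)) • x) := by
  obtain ⟨c, hc, h⟩ := ch.exists_gate_of_near hY x 0
  have hP := ch.pos
  have hmm : 1 ≤ m * m := by have := mul_self_pos.2 hm; omega
  have e1 : c ≤ P * (m * (m * c)) := by
    have : c ≤ m * m * c := by nlinarith
    have : m * m * c ≤ P * (m * m * c) := by nlinarith
    nlinarith
  -- The multiple `m * c` makes the exponent `m * (m * c)` positive whatever the sign of `m`.
  refine ⟨m * c, (h _ _ (dist_self _).le).2 0 (by omega), (h _ _ (dist_self _).le).1 0 ?_⟩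
  have : P * (m * -(m * c)) = -(P * (m * (m * c))) := by ring
  omega

/-- A point of `B 0` near `l 0` is its own projection, but as a point of `B n` it would have to
project near `r 0`. -/
theorem set_ne (hY : IsGeodesicSpace Y) (ch : PeriodicChain f P C θ B l r) {n : ℤ} (hn : 0 < n) :
    B n ≠ B 0 := by
  intro heq
  obtain ⟨y, hy⟩ := ch.ne (0 - 1)
  obtain ⟨u, hu⟩ := ch.proj_nonempty 0 y
  have h1 := ch.left 0 y hy u hu
  have h2 := ch.gate_right_of_mem hY (t := 0) (s := n) (y := u) (by rw [heq]; exact hu.1) hn u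
    (self_mem_proj hu.1)
  have h3 := ch.sep 0
  have h4 := ch.one_le
  have h5 := ch.nonneg
  linarith [dist_triangle_left (l 0) (r 0) u]

/-- An element shifting a chain of translates of the axis of `h` is independent of `h`. -/
theorem independent (hY : IsGeodesicSpace Y) (hproper : IsProperAction G Y)
    (ch : PeriodicChain f P C θ B l r) {o : Y} {h : G} (hh : IsContractingElt o h)
    (hpb : ∀ g : G, B 0 ≠ g • axis o h → ∀ x ∈ g • axis o h, ∀ y ∈ g • axis o h,
      ∀ u ∈ proj (B 0) x, ∀ v ∈ proj (B 0) y, dist u v ≤ θ) :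
    Independent o h f := by
  refine independent_of_not_conj hY hproper hh (ch.isContractingElt hY hproper o)
    fun g m n hm hn e => ?_
  have e' : f ^ m = g⁻¹ * h ^ n * g := by rw [← e]; group
  have hinv : ∀ k : ℤ, f ^ (m * k) = g⁻¹ * h ^ (n * k) * g := by
    intro k
    rw [zpow_mul, e', zpow_mul]
    have := conj_zpow (i := k) (a := g⁻¹) (b := h ^ n)
    rwa [inv_inv] at this
  have hmem : ∀ k : ℤ, f ^ (m * k) • g⁻¹ • o ∈ g⁻¹ • axis o h := by
    intro k
    rw [hinv, ← mul_smul, mul_inv_cancel_right, mul_smul]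
    exact Set.smul_mem_smul_set (cyclicOrbit_subset_axis o h ⟨_, rfl⟩)
  -- The powers of `f ^ m` move a point along `g⁻¹ • axis o h` from one side of `B 0` to the other.
  -- The projection of this axis to `B 0` is then too large, unless the two sets are equal. But in
  -- that case a power of `f` preserves `B 0`, contrary to `set_ne`.
  have hA : B 0 = g⁻¹ • axis o h := by
    by_contra hne
    obtain ⟨s, h1, h2⟩ := ch.exists_gate_zpow hY (g⁻¹ • o) hm
    obtain ⟨u, hu⟩ := ch.proj_nonempty 0 (f ^ (m * s) • g⁻¹ • o)
    obtain ⟨v, hv⟩ := ch.proj_nonempty 0 (f ^ (m * (-s)) • g⁻¹ • o)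
    have h3 := hpb g⁻¹ hne _ (hmem s) _ (hmem (-s)) u hu v hv
    have h4 := h1 u hu
    have h5 := h2 v hv
    have h6 := ch.sep 0
    have h7 := dist_triangle4 (l 0) v u (r 0)
    rw [dist_comm (l 0) v, dist_comm v u] at h7
    have h8 := ch.one_le
    have h9 := ch.nonneg
    linarith
  have hinvB : ∀ k : ℤ, B (P * (m * k)) = B 0 := by
    intro k
    have := ch.set_zpow 0 (m * k)
    rw [zero_add] at this
    rw [this, hA, hinv, ← mul_smul, mul_inv_cancel_right, mul_smul,
      smul_axis (zpow_mem_elemClosure o h _)]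
  have hP := ch.pos
  have hmm : 0 < m * m := mul_self_pos.2 hm
  exact ch.set_ne hY (n := P * (m * m)) (by positivity) (hinvB m)

end PeriodicChain

/-- An element shifting a chain with a sufficiently long member is independent of a given
contracting element. -/
theorem exists_independent_of_long (hY : IsGeodesicSpace Y) (hproper : IsProperAction G Y) {o : Y}
    {h k : G} (hk : IsContractingElt o k) (hind : Independent o h k) (C θ : ℝ) :
    ∃ T : ℝ, ∀ (f : G) (P : ℤ) (B : ℤ → Set Y) (l r : ℤ → Y) (g₀ : G),
      PeriodicChain f P C θ B l r → B 0 = g₀ • axis o h → T < dist (l 0) (r 0) →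
        Independent o k f := by
  obtain ⟨-, τ, hτ, -⟩ := hind
  obtain ⟨C', hC'⟩ := hk.2.1
  have hC'1 := hC'.1
  set R := max (2 * θ + 14 * C) (3 * C') with hR
  refine ⟨τ R + 2 * (θ + 8 * C), fun f P B l r g₀ ch hB hT => ?_⟩
  refine independent_of_not_conj hY hproper hk (ch.isContractingElt hY hproper o)
    fun g m n hm hn e => ?_
  have e' : f ^ m = g⁻¹ * k ^ n * g := by rw [← e]; group
  have hmem : ∀ s : ℤ, f ^ (m * s) • g⁻¹ • o ∈ g⁻¹ • cyclicOrbit o k := by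
    intro s
    have : f ^ (m * s) = g⁻¹ * k ^ (n * s) * g := by
      rw [zpow_mul, e', zpow_mul]
      have := conj_zpow (i := s) (a := g⁻¹) (b := k ^ n)
      rwa [inv_inv] at this
    rw [this, ← mul_smul, mul_inv_cancel_right, mul_smul]
    exact Set.smul_mem_smul_set ⟨_, rfl⟩
  obtain ⟨s, h1, h2⟩ := ch.exists_gate_zpow hY (g⁻¹ • o) hm
  obtain ⟨γ, hγ⟩ := hY (f ^ (m * (-s)) • g⁻¹ • o) (f ^ (m * s) • g⁻¹ • o)
  obtain ⟨p, hp, q, hq, hpl, hqr, -⟩ := ch.crossing hγ h2 h1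
  have hC1 := ch.one_le
  have hθ := ch.nonneg
  have hR0 : 0 ≤ R := le_max_of_le_right (by linarith)
  have hne : (g⁻¹ • cyclicOrbit o k).Nonempty := (cyclicOrbit_nonempty o k).smul_set
  -- A geodesic joining two points of a translate of the orbit of `k` crosses `B 0`. So the
  -- translate of `Ax(k)` stays close to `B 0`, a translate of `Ax(h)`, over almost the whole
  -- distance from `l 0` to `r 0`, which exceeds the overlap allowed by `τ`.
  have near : ∀ p ∈ γ, ∀ x y : Y, dist p x ≤ θ + 8 * C → (∃ u ∈ B 0, dist u x ≤ θ + 6 * C) →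
      p ∈ Metric.cthickening R (g₀ • axis o h) ∩ Metric.cthickening R (g⁻¹ • axis o k) := by
    rintro p hp x y hpx ⟨u, hu, hux⟩
    constructor
    · rw [← hB, mem_cthickening_iff_infDist_le (ch.ne 0) hR0]
      refine (Metric.infDist_le_dist_of_mem hu).trans (le_trans ?_ (le_max_left _ _))
      linarith [dist_triangle_right p u x]
    · have h3 := quasiconvex (hC'.smul g⁻¹) hne hγ le_rfl
        (by rw [Metric.infDist_zero_of_mem (hmem _)]; linarith)
        (by rw [Metric.infDist_zero_of_mem (hmem _)]; linarith) hp
      refine Metric.cthickening_subset_of_subset R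
        (Set.smul_set_mono (cyclicOrbit_subset_axis o k)) ?_
      rw [mem_cthickening_iff_infDist_le hne hR0]
      exact h3.trans (le_trans (by linarith) (le_max_right _ _))
  obtain ⟨u, hu⟩ := ch.proj_nonempty 0 (f ^ (m * (-s)) • g⁻¹ • o)
  obtain ⟨v, hv⟩ := ch.proj_nonempty 0 (f ^ (m * s) • g⁻¹ • o)
  have hpm := near p hp (l 0) (l 0) hpl ⟨u, hu.1, h2 u hu⟩
  have hqm := near q hq (r 0) (r 0) hqr ⟨v, hv.1, h1 v hv⟩
  have h3 := hτ _ ⟨h, rfl, g₀, rfl⟩ _ ⟨k, rfl, g⁻¹, rfl⟩ R hR0 p hpm q hqm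
  have h4 := dist_triangle4 (l 0) p q (r 0)
  rw [dist_comm (l 0) p] at h4
  linarith

end Independence

/-! ### Properties of points of `Y` arbitrarily close to a boundary point -/

section Frequently

variable {Y Z : Type*} [TopologicalSpace Z] {ι : Y → Z} {p : Y → Prop} {ξ : Z}

theorem frequently_comap_iff :
    (∃ᶠ y in comap ι (𝓝 ξ), p y) ↔ ∀ U ∈ 𝓝 ξ, ∃ y, ι y ∈ U ∧ p y := by
  rw [frequently_comap, frequently_iff]
  constructor
  · intro h U hU
    obtain ⟨_, hz, y, rfl, hy⟩ := h hU
    exact ⟨y, hz, hy⟩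
  · intro h U hU
    obtain ⟨y, hz, hy⟩ := h U hU
    exact ⟨_, hz, y, rfl, hy⟩

theorem frequently_comap_of_tendsto {y : ℕ → Y}
    (hy : Tendsto (fun n => ι (y n)) atTop (𝓝 ξ)) (hp : ∀ᶠ n in atTop, p (y n)) :
    ∃ᶠ y in comap ι (𝓝 ξ), p y :=
  (tendsto_comap_iff.2 hy).frequently hp.frequently

end Frequently

/-! ### Non-pinched elements and the construction of independent triples -/

section NonpinchedElements

variable {G Y Z : Type*} [Group G] [MetricSpace Y] [ProperSpace Y] [TopologicalSpace Z]
  [CompactSpace Z] [TopologicalSpace.MetrizableSpace Z] [MulAction G Y] [IsIsometricSMul G Y]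
  [MulAction G Z] [ContinuousConstSMul G Z] {ι : Y → Z} {S : Setoid Z} {o : Y}

theorem frequently_comap_smul (hcomp : IsCompactification G ι S) (g : G) {p : Y → Prop} {ξ : Z}
    (h : ∃ᶠ y in comap ι (𝓝 ξ), p y) : ∃ᶠ y in comap ι (𝓝 (g • ξ)), p (g⁻¹ • y) := by
  rw [frequently_comap_iff] at h ⊢
  intro U hU
  obtain ⟨y, hy, hp⟩ := h ((fun z => g • z) ⁻¹' U) ((continuous_const_smul g).continuousAt hU)
  exact ⟨g • y, by rw [hcomp.equivariant]; exact hy, by rwa [inv_smul_smul]⟩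

/-- If the attracting class of an element shifting a chain is pinched, then some class can be
approached from both sides of each member of the chain. -/
theorem PeriodicChain.exists_rel_of_not_nonpinched (hcomp : IsCompactification G ι S)
    (hY : IsGeodesicSpace Y) (hproper : IsProperAction G Y) (hconv : IsConvergenceBoundary ι S)
    {f : G} {P : ℤ} {C θ : ℝ} {B : ℤ → Set Y} {l r : ℤ → Y} (ch : PeriodicChain f P C θ B l r)
    (hnp : ¬ attracting ι S o f ⊆ nonpinched ι S) (t : ℤ) :
    ∃ η ∈ bdry ι, ∃ η' ∈ bdry ι, S.r η η' ∧ (∃ᶠ x in comap ι (𝓝 η), Gate C θ B l t x) ∧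
      ∃ᶠ y in comap ι (𝓝 η'), Gate C θ B r t y := by
  have hf := ch.isContractingElt hY hproper o
  obtain ⟨ζ, hζ, M, x, hx, hxM⟩ := exists_of_not_nonpinched hY hf hnp
  obtain ⟨c, hc, hg⟩ := ch.exists_gate_of_proj hY o
  have hP := ch.pos
  -- The sequence `x` projects to indices at most `M`, and the powers of `f` applied to `o` tend to
  -- the same class from the far right. The translation by `f ^ (-k)` places `B t` between the two
  -- sequences.
  set k : ℤ := max 0 (M + c - t) + |t| with hk
  have hk1 : P * M + c ≤ t + P * k := by
    have h1 : M + c - t ≤ k := by have := abs_nonneg t; omega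
    have h2 : 0 ≤ k := by positivity
    have h3 : c + |t| ≤ k - M + (t + |t|) := by omega
    have h4 : -|t| ≤ t := neg_abs_le t
    have h5 : c + |t| - t ≤ k - M := by
      have := le_max_right 0 (M + c - t); omega
    have h6 : 0 ≤ k - M := by
      have := le_abs_self t; omega
    nlinarith
  have hy := accumulatesInto_attracting hY hconv hf hζ
  obtain ⟨a, ha, φ, hφ, hlim⟩ := hx.exists_subseq
  obtain ⟨b, hb, ψ, hψ, hlim'⟩ := hy.exists_subseq
  have key : ∀ {z : ℕ → Y} {a : Z}, Tendsto (fun n => ι (z n)) atTop (𝓝 a) →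
      Tendsto (fun n => ι (f ^ (-k) • z n)) atTop (𝓝 (f ^ (-k) • a)) := by
    intro z a hz
    simp only [hcomp.equivariant]
    exact hz.const_smul _
  refine ⟨f ^ (-k) • a, smul_mem_bdry hcomp _ ha.1, f ^ (-k) • b, smul_mem_bdry hcomp _ hb.1,
    hcomp.invariant _ _ _ ha.1 hb.1 (S.trans' ha.2 (S.symm' hb.2)),
    frequently_comap_of_tendsto (key hlim) (Eventually.of_forall fun n => ?_),
    frequently_comap_of_tendsto (key hlim') ?_⟩
  · obtain ⟨i, hi, hix⟩ := hxM (φ n)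
    have h1 := (hg _ _ hix).1 (t + P * k) (by nlinarith)
    rw [← ch.gate_left_zpow (n := k), ← mul_smul, ← zpow_add, add_neg_cancel, zpow_zero, one_smul]
    exact h1
  · filter_upwards [hψ.tendsto_atTop.eventually_ge_atTop (t + P * k + c).toNat] with n hn
    have h1 := (hg (f ^ ψ n • o) (ψ n) (by
      simpa using self_mem_proj (zpow_mem_cyclicOrbit o f (ψ n)))).2 (t + P * k) (by
        have : t + P * k + c ≤ ψ n := by omega
        nlinarith)
    rw [← ch.gate_right_zpow (n := k), ← mul_smul, ← zpow_add, add_neg_cancel, zpow_zero, one_smul]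
    exact h1

/-- If the partition is closed, then no class can be approached both from points projecting to
the axis of `h` close to `o` and from points projecting close to `h ^ N o`, for large `N`. -/
theorem IsContractingElt.exists_not_rel (he : IsOpenEmbedding ι) (hY : IsGeodesicSpace Y)
    (hproper : IsProperAction G Y) (hconv : IsConvergenceBoundary ι S)
    (hclosed : IsClosedPartition ι S) {h : G} (hh : IsContractingElt o h)
    (hnp : attracting ι S o h ⊆ nonpinched ι S) (ρ : ℝ) :
    ∃ N₀ : ℤ, ∀ N ≥ N₀, ∀ η ∈ bdry ι, ∀ η' ∈ bdry ι, S.r η η' →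
      (∃ᶠ x in comap ι (𝓝 η), ProjNear (axis o h) x o ρ) →
      ¬ ∃ᶠ y in comap ι (𝓝 η'), ProjNear (axis o h) y (h ^ N • o) ρ := by
  by_contra hcon
  push Not at hcon
  choose N hN η hη η' hη' hr hx hy using fun k : ℕ => hcon k
  obtain ⟨U, hU, hUlim⟩ := exists_approx Z
  simp only [frequently_comap_iff] at hx hy
  choose x hxU hxp using fun k => hx k (U k (η k)) (hU _ _)
  choose y hyU hyp using fun k => hy k (U k (η' k)) (hU _ _)
  obtain ⟨a, φ₁, hφ₁, ha⟩ := CompactSpace.tendsto_subseq η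
  obtain ⟨b, φ₂, hφ₂, hb⟩ := CompactSpace.tendsto_subseq (η' ∘ φ₁)
  set φ := φ₁ ∘ φ₂ with hφ
  have hφm : StrictMono φ := hφ₁.comp hφ₂
  have ha' : Tendsto (η ∘ φ) atTop (𝓝 a) := ha.comp hφ₂.tendsto_atTop
  have hb' : Tendsto (η' ∘ φ) atTop (𝓝 b) := hb
  have hab : a ∈ bdry ι := (isClosed_bdry he).mem_of_tendsto ha' (Eventually.of_forall fun n => hη _)
  have hbb : b ∈ bdry ι :=
    (isClosed_bdry he).mem_of_tendsto hb' (Eventually.of_forall fun n => hη' _)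
  have hrab : S.r a b := hclosed _ _ a b (fun n => hη (φ n)) (fun n => hη' (φ n))
    (fun n => hr (φ n)) hab hbb ha' hb'
  have hxa : Tendsto (fun n => ι (x (φ n))) atTop (𝓝 a) :=
    (hUlim η (fun n => ι (x n)) (Eventually.of_forall hxU) φ a hφm.tendsto_atTop).1 ha'
  have hyb : Tendsto (fun n => ι (y (φ n))) atTop (𝓝 b) :=
    (hUlim η' (fun n => ι (y n)) (Eventually.of_forall hyU) φ b hφm.tendsto_atTop).1 hb'
  obtain ⟨ζ, -, hζ⟩ := exists_mem_attracting (S := S) he hh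
  obtain ⟨C, hC⟩ := hh.axis_contracting hY hproper
  obtain ⟨C', hC'⟩ := hh.2.1
  have hC1 := hC.1
  have hNt : Tendsto (fun n => (N (φ n)).toNat) atTop atTop :=
    tendsto_atTop_mono (fun n => by have := hN (φ n); omega) hφm.tendsto_atTop
  have hNe : ∀ n, h ^ N (φ n) = h ^ (N (φ n)).toNat := by
    intro n
    rw [← zpow_natCast, Int.toNat_of_nonneg]
    exact (Int.natCast_nonneg _).trans (hN (φ n))
  have hdist : Tendsto (fun n => dist o (h ^ N (φ n) • o) - (ρ + 2 * C)) atTop atTop := by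
    simp only [hNe]
    exact tendsto_atTop_add_const_right _ _ (hh.tendsto_dist.comp hNt)
  -- The points `y (φ n)` project near `h ^ N (φ n) • o`, so they tend to the attracting class. By
  -- closedness of the partition, `a` lies in this class as well; but the `x (φ n)` project near
  -- `o`, contrary to `eventually_le_of_accumulatesInto`.
  have hbζ : b ∈ cls ι S ζ := by
    refine accumulatesInto_of_fellow hY hconv (x := o) (y := fun n => y (φ n))
      (y' := fun n => h ^ N (φ n) • o) (ρ := fun n => dist o (h ^ N (φ n) • o) - (ρ + 2 * C))
      (r := ρ + 2 * C) hdist ?_ ?_ b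
      hyb.mapClusterPt
    · filter_upwards [hdist.eventually_gt_atTop C] with n hn
      obtain ⟨γ, hγ⟩ := hY o (y (φ n))
      obtain ⟨γ', hγ'⟩ := hY o (h ^ N (φ n) • o)
      obtain ⟨v, hv⟩ := proj_nonempty hC.2.1 (axis_nonempty o h) (y (φ n))
      have h1 := hyp (φ n) v hv
      obtain ⟨-, -, q, hq, -, hqv, -⟩ := bgi hC hγ (self_mem_proj (self_mem_axis o h)) hv (by
        linarith [dist_triangle o v (h ^ N (φ n) • o)])
      have h2 := dist_triangle q v (h ^ N (φ n) • o)
      refine ⟨γ, γ', q, _, hγ, hγ', hq, hγ'.right_mem, by linarith, ?_⟩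
      linarith [dist_triangle o q (h ^ N (φ n) • o)]
    · simp only [hNe]
      exact (accumulatesInto_attracting hY hconv hh hζ).comp hNt
  have haζ : a ∈ cls ι S ζ := ⟨hab, S.trans' hrab hbζ.2⟩
  obtain ⟨D, hD1, hD2⟩ := hh.close_axis hY
  obtain ⟨K, hK0, hK⟩ := hh.exists_lt_dist (D + 4 * C' + ρ)
  obtain ⟨n, hn⟩ := (eventually_le_of_accumulatesInto hY hconv hh hnp hζ
    (accumulatesInto_of_tendsto hxa haζ) K).exists
  obtain ⟨u, hu⟩ := proj_nonempty hC'.2.1 (cyclicOrbit_nonempty o h) (x (φ n))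
  obtain ⟨v, hv⟩ := proj_nonempty hC.2.1 (axis_nonempty o h) (x (φ n))
  obtain ⟨i, rfl⟩ := hu.1
  have h1 := hn i hu
  have h2 := proj_dist_of_close hY hC' (cyclicOrbit_nonempty o h) hD1 hD2 hu hv
  have h3 := hxp (φ n) v hv
  have h4 := hK i 0 (by rw [sub_zero]; exact h1.trans (le_abs_self i))
  simp only [zpow_zero, one_smul] at h4 h2
  linarith [dist_triangle (h ^ i • o) v o]

section Frames

variable {h : G} {t : Fin 3 → G} {C θ κ₀ κ : ℝ}

/-- The product of two powers of conjugates of `h`, with axes suitable for joining `o` to `p o`. -/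
def axisProd (t : Fin 3 → G) (h p : G) (i j : Fin 3) (N : ℤ) : G :=
  p * conjPow (t i) h N * p⁻¹ * conjPow (t j) h N

/-- The geodesic from `o` to `p o` can be extended at its end along `p t i • Ax(h)` and at its
beginning along `t j • Ax(h)`. -/
structure Extendable (o : Y) (h : G) (t : Fin 3 → G) (C κ₀ κ : ℝ) (p : G) (i j : Fin 3) : Prop where
  good_end : ProjNear (t i • axis o h) (p⁻¹ • o) o κ
  good_start : ProjNear (t j • axis o h) (p • o) o κ
  far : 4 * C + 2 * κ₀ + κ < dist o (p • o)

theorem Frame.exists_long (fr : Frame o h t C θ κ₀ κ) (hh : IsContractingElt o h) (R : ℝ) :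
    ∃ N₀ : ℤ, 0 < N₀ ∧ ∀ N : ℤ, N₀ ≤ |N| → ∀ i, R < dist o (conjPow (t i) h N • o) := by
  obtain ⟨K, hK0, hK⟩ := hh.exists_lt_dist (R + 2 * κ₀)
  refine ⟨K, hK0, fun N hN i => ?_⟩
  have h1 := hK 0 N (by rwa [zero_sub, abs_neg])
  have h2 := dist_conjPow o (t i) h N
  have h3 := fr.base i
  rw [zpow_zero, one_smul] at h1
  linarith

/-- Transports a gate on a translated axis to `Ax(h)` itself, where `exists_not_rel` applies; moving
the base point from `t i • o` to `o` costs `κ₀`. -/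
theorem Frame.projNear_axis (fr : Frame o h t C θ κ₀ κ) {g : G} {i : Fin 3} {M : ℤ} {y : Y}
    {ρ : ℝ} (hy : ProjNear (g • t i • axis o h) y (g • conjPow (t i) h M • o) ρ) :
    ProjNear (axis o h) ((g * t i)⁻¹ • y) (h ^ M • o) (ρ + κ₀) := by
  rw [← mul_smul g (t i), projNear_smul_iff] at hy
  intro u hu
  have h1 := hy u hu
  have e : (g * t i)⁻¹ • g • conjPow (t i) h M • o = h ^ M • (t i)⁻¹ • o := by
    simp only [← mul_smul, conjPow]; congr 1; group
  rw [e] at h1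
  have h2 : dist (h ^ M • (t i)⁻¹ • o) (h ^ M • o) = dist o (t i • o) := by
    rw [dist_smul, ← dist_smul (t i), smul_inv_smul]
  linarith [dist_triangle u (h ^ M • (t i)⁻¹ • o) (h ^ M • o), fr.base i]

/-- For a closed partition: if the element were pinched, some class could be approached from both
sides of a member of its chain. After translation this means projections near `o` and near `h ^ N •
o` on `Ax(h)`, which is excluded for large `N`. The repelling class is treated with the reversed
chain and `h⁻¹`. -/
theorem Frame.exists_isNonpinchedElt (hcomp : IsCompactification G ι S)
    (hY : IsGeodesicSpace Y) (hproper : IsProperAction G Y) (hconv : IsConvergenceBoundary ι S)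
    (fr : Frame o h t C θ κ₀ κ) (hh : IsContractingElt o h) (hnp : IsNonpinchedElt ι S o h)
    (hpinch : (∀ h : G, IsContractingElt o h → IsNonpinchedElt ι S o h) ∨ IsClosedPartition ι S) :
    ∃ N₀ : ℤ, ∀ N ≥ N₀, ∀ (p : G) (i j : Fin 3), Extendable o h t C κ₀ κ p i j →
      IsNonpinchedElt ι S o (axisProd t h p i j N) := by
  set θ' := θ + κ₀ + 4 * C + κ with hθ'
  obtain ⟨N₁, hN₁, hlong⟩ := fr.exists_long hh (100 * (C + θ'))
  rcases hpinch with hpinch | hclosed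
  · refine ⟨N₁, fun N hN p i j hx => hpinch _ ?_⟩
    have hl := hlong N (hN.trans (le_abs_self N))
    exact (fr.chain hY hx.good_end hx.good_start hx.far rfl rfl (hl i)
      (hl j)).isContractingElt hY hproper o
  obtain ⟨N₂, hN₂⟩ := hh.exists_not_rel hcomp.openEmbedding hY hproper hconv hclosed hnp.1
    (θ' + 6 * C + κ₀)
  obtain ⟨N₃, hN₃⟩ := hh.inv.exists_not_rel hcomp.openEmbedding hY hproper hconv hclosed hnp.2
    (θ' + 6 * C + κ₀)
  refine ⟨max N₁ (max N₂ N₃), fun N hN p i j hx => ?_⟩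
  have hNs : N₁ ≤ N ∧ N₂ ≤ N ∧ N₃ ≤ N := by simpa using hN
  have hl := hlong N (hNs.1.trans (le_abs_self N))
  have ch := fr.chain hY hx.good_end hx.good_start hx.far rfl rfl (hl i) (hl j)
  have zero : ∀ i, conjPow (t i) h 0 = 1 := by intro i; simp [conjPow]
  constructor
  · by_contra hcon
    obtain ⟨η, hη, η', hη', hr, h1, h2⟩ :=
      ch.exists_rel_of_not_nonpinched (o := o) hcomp hY hproper hconv hcon 1
    simp only [Gate, pairSeq_one] at h1 h2
    refine hN₂ N hNs.2.1 _ (smul_mem_bdry hcomp (p * t i)⁻¹ hη) _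
      (smul_mem_bdry hcomp (p * t i)⁻¹ hη') (hcomp.invariant _ _ _ hη hη' hr)
      ((frequently_comap_smul hcomp (p * t i)⁻¹ h1).mono fun y hy => ?_)
      ((frequently_comap_smul hcomp (p * t i)⁻¹ h2).mono fun y hy => ?_)
    · have := fr.projNear_axis (g := p) (i := i) (M := 0) (by rw [zero, one_smul]; exact hy)
      simpa [-mul_inv_rev] using this
    · have := fr.projNear_axis hy
      simpa [-mul_inv_rev] using this
  · by_contra hcon
    obtain ⟨η, hη, η', hη', hr, h1, h2⟩ :=
      ch.reverse.exists_rel_of_not_nonpinched (o := o) hcomp hY hproper hconv hcon 0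
    simp only [Gate, pairSeq_zero, neg_zero] at h1 h2
    refine hN₃ N hNs.2.2 _ (smul_mem_bdry hcomp (t j)⁻¹ hη) _
      (smul_mem_bdry hcomp (t j)⁻¹ hη') (hcomp.invariant _ _ _ hη hη' hr)
      ((frequently_comap_smul hcomp (t j)⁻¹ h1).mono fun y hy => ?_)
      ((frequently_comap_smul hcomp (t j)⁻¹ h2).mono fun y hy => ?_)
    · have := fr.projNear_axis (g := 1) (i := j) (M := 0) (by
        rw [zero, one_smul, one_smul, one_smul]; exact hy)
      simpa [axis_inv] using this
    · rw [← conjPow_neg] at hy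
      have := fr.projNear_axis (g := 1) (i := j) (M := -N) (by
        rw [one_smul, one_smul]; exact hy)
      simpa [axis_inv] using this

/-- All these elements are independent of `h`. Once some exponents are chosen, a much larger one
gives a chain containing a very long piece of a translate of `Ax(h)`, so its element is independent
of the earlier ones by `exists_independent_of_long`. -/
theorem Frame.exists_mem_triples (hcomp : IsCompactification G ι S)
    (hY : IsGeodesicSpace Y) (hproper : IsProperAction G Y) (hconv : IsConvergenceBoundary ι S)
    (fr : Frame o h t C θ κ₀ κ) (hh : IsContractingElt o h) (hnp : IsNonpinchedElt ι S o h)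
    (hpinch : (∀ h : G, IsContractingElt o h → IsNonpinchedElt ι S o h) ∨ IsClosedPartition ι S)
    {p : G} {i j : Fin 3} (hx : Extendable o h t C κ₀ κ p i j) (N₁ : ℤ) :
    ∃ F ∈ triples G ι S o, ∀ f ∈ F, ∃ N ≥ N₁, f = axisProd t h p i j N := by
  classical
  set θ' := θ + κ₀ + 4 * C + κ with hθ'
  obtain ⟨N₂, hN₂, hlong⟩ := fr.exists_long hh (100 * (C + θ'))
  obtain ⟨N₃, hN₃⟩ := fr.exists_isNonpinchedElt hcomp hY hproper hconv hh hnp hpinch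
  set E := axisProd t h p i j with hE
  set A : Set ℤ := {N | N₁ ≤ N ∧ N₂ ≤ N ∧ N₃ ≤ N} with hA
  have ch : ∀ N ∈ A, PeriodicChain (E N) 2 C θ'
      (pairSeq (E N) (t j • axis o h) (p • t i • axis o h))
      (pairSeq (E N) ((conjPow (t j) h N)⁻¹ • o) (p • o))
      (pairSeq (E N) o (p • conjPow (t i) h N • o)) := by
    intro N hN
    have hl := hlong N (hN.2.1.trans (le_abs_self N))
    exact fr.chain hY hx.good_end hx.good_start hx.far rfl rfl (hl i) (hl j)
  have hc : ∀ N ∈ A, IsContractingElt o (E N) := fun N hN =>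
    (ch N hN).isContractingElt hY hproper o
  have hθθ : θ ≤ θ' := by
    linarith [fr.one_le, fr.nonneg', fr.nonneg₀]
  have hind : ∀ N ∈ A, Independent o h (E N) := by
    intro N hN
    refine (ch N hN).independent hY hproper hh fun g hne x hx y hy u hu v hv => ?_
    rw [pairSeq_zero] at hne hu hv
    exact (fr.proj_bound _ _ hne x hx y hy u hu v hv).trans hθθ
  have hT : ∀ N ∈ A, ∃ T : ℤ, ∀ N' ∈ A, T ≤ N' → Independent o (E N) (E N') := by
    intro N hN
    obtain ⟨T, hT⟩ := exists_independent_of_long hY hproper (hc N hN) (hind N hN) C θ'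
    obtain ⟨T', hT'0, hT'⟩ := fr.exists_long hh T
    refine ⟨T', fun N' hN' hTN => hT _ _ _ _ _ (t j) (ch N' hN') (pairSeq_zero _ _ _) ?_⟩
    rw [pairSeq_zero, pairSeq_zero, ← dist_smul (conjPow (t j) h N'), smul_inv_smul]
    exact hT' N' (hTN.trans (le_abs_self N')) j
  have ha : max N₁ (max N₂ N₃) ∈ A := by simp [hA]
  set a := max N₁ (max N₂ N₃)
  obtain ⟨Ta, hTa⟩ := hT a ha
  have hb : max a Ta ∈ A := by
    obtain ⟨h1, h2, h3⟩ := ha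
    exact ⟨h1.trans (le_max_left _ _), h2.trans (le_max_left _ _), h3.trans (le_max_left _ _)⟩
  set b := max a Ta
  obtain ⟨Tb, hTb⟩ := hT b hb
  have hc' : max b Tb ∈ A := by
    obtain ⟨h1, h2, h3⟩ := hb
    exact ⟨h1.trans (le_max_left _ _), h2.trans (le_max_left _ _), h3.trans (le_max_left _ _)⟩
  set c := max b Tb
  have hab : Independent o (E a) (E b) := hTa b hb (le_max_right _ _)
  have hac : Independent o (E a) (E c) := hTa c hc' ((le_max_right _ _).trans (le_max_left _ _))
  have hbc : Independent o (E b) (E c) := hTb c hc' (le_max_right _ _)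
  have ne : ∀ {N M : ℤ}, N ∈ A → Independent o (E N) (E M) → E N ≠ E M := by
    intro N M hN hi heq
    rw [← heq] at hi
    exact (hc N hN).not_independent_self hi
  refine ⟨{E a, E b, E c}, ⟨Finset.card_eq_three.2 ⟨_, _, _, ne ha hab, ne ha hac, ne hb hbc, rfl⟩,
    ?_, ?_⟩, ?_⟩
  · intro f hf
    have : ∃ N ∈ A, f = E N := by
      simp only [Finset.mem_insert, Finset.mem_singleton] at hf
      rcases hf with rfl | rfl | rfl
      exacts [⟨a, ha, rfl⟩, ⟨b, hb, rfl⟩, ⟨c, hc', rfl⟩]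
    obtain ⟨N, hN, rfl⟩ := this
    exact ⟨hc N hN, hN₃ N hN.2.2 p i j hx⟩
  · intro f hf k hk hfk
    simp only [Finset.mem_insert, Finset.mem_singleton] at hf hk
    rcases hf with rfl | rfl | rfl <;> rcases hk with rfl | rfl | rfl <;>
      first
      | exact absurd rfl hfk
      | assumption
      | (apply Independent.symm; assumption)
  · intro f hf
    simp only [Finset.mem_insert, Finset.mem_singleton] at hf
    rcases hf with rfl | rfl | rfl
    exacts [⟨a, ha.1, rfl⟩, ⟨b, hb.1, rfl⟩, ⟨c, hc'.1, rfl⟩]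

end Frames

end NonpinchedElements

/-! ### Myrberg points are conical in both senses -/

section MyrbergPoints

variable {G Y Z : Type*} [Group G] [MetricSpace Y] [ProperSpace Y] [TopologicalSpace Z]
  [CompactSpace Z] [TopologicalSpace.MetrizableSpace Z] [MulAction G Y] [IsIsometricSMul G Y]
  [MulAction G Z] [ContinuousConstSMul G Z] {ι : Y → Z} {S : Setoid Z} {o : Y}

/-- A Myrberg point and a base point can be moved to the two ends of a non-pinched contracting
element. -/
theorem exists_seq_of_mem_myrberg (hcomp : IsCompactification G ι S) (hY : IsGeodesicSpace Y)
    (hconv : IsConvergenceBoundary ι S) {ξ : Z} (hξ : ξ ∈ myrberg G ι S o) {f : G}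
    (hf : IsContractingElt o f) (hnp : IsNonpinchedElt ι S o f) :
    ∃ g : ℕ → G,
      (∀ W : ℤ, ∀ᶠ n in atTop, ∀ᶠ z in comap ι (𝓝 ξ), ∀ i : ℤ,
        f ^ i • o ∈ proj (cyclicOrbit o f) (g n • z) → W ≤ i) ∧
      (∀ (x : Y) (W : ℤ), ∀ᶠ n in atTop, ∀ i : ℤ,
        f ^ i • o ∈ proj (cyclicOrbit o f) (g n • x) → i ≤ W) ∧
      ∀ x : Y, AccumulatesInto (fun n => ι (g n • x)) (bdry ι) := by
  obtain ⟨a, haL, ha⟩ := exists_mem_attracting (S := S) hcomp.openEmbedding hf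
  obtain ⟨b, hbL, hb⟩ := exists_mem_attracting (S := S) hcomp.openEmbedding hf.inv
  obtain ⟨g, hga, hgb⟩ := hξ.2.2 a haL b hbL (not_rel_of_attracting hY hconv hf hnp.1 ha hb)
  refine ⟨g, fun W => ?_, fun x W => ?_, fun x => (hgb x).mono cls_subset_bdry⟩
  · by_contra hcon
    rw [not_eventually] at hcon
    obtain ⟨ψ, hψ, hψz⟩ := extraction_of_frequently_atTop hcon
    obtain ⟨U, hU, hUlim⟩ := exists_approx Z
    have hz : ∀ k, ∃ z, ι (g (ψ k) • z) ∈ U k (g (ψ k) • ξ) ∧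
        ¬ ∀ i : ℤ, f ^ i • o ∈ proj (cyclicOrbit o f) (g (ψ k) • z) → W ≤ i := by
      intro k
      obtain ⟨z, hz, hz'⟩ := frequently_comap_iff.1 (not_eventually.1 (hψz k)) _
        ((continuous_const_smul (g (ψ k))).continuousAt (hU k (g (ψ k) • ξ)))
      exact ⟨z, by rw [hcomp.equivariant]; exact hz, hz'⟩
    choose z hzU hzi using hz
    have h1 : AccumulatesInto (fun k => ι (g (ψ k) • z k)) (cls ι S a) :=
      (hga.comp hψ.tendsto_atTop).of_approx (hUlim _ _ (Eventually.of_forall hzU))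
    obtain ⟨k, hk⟩ := (eventually_le_of_accumulatesInto hY hconv hf hnp.1 ha h1 W).exists
    exact hzi k hk
  · filter_upwards [eventually_le_of_accumulatesInto hY hconv hf.inv hnp.2 hb (hgb x) (-W)]
      with n hn i hi
    have := hn (-i) (by rwa [cyclicOrbit_inv, inv_zpow', neg_neg])
    omega

/-- If `ξ` is not in the locus of the limit set of the contracting set `X`, then points close to
`ξ` have bounded projections to `X`. -/
theorem exists_bound_proj (hY : IsGeodesicSpace Y)
    (hconv : IsConvergenceBoundary ι S) {X : Set Y} {C : ℝ} (hX : IsContracting C X)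
    (hne : X.Nonempty) {ξ : Z} (hξ : ξ ∈ bdry ι) (hn : ξ ∉ locus ι S (limitSet ι X)) (x : Y) :
    ∃ R : ℝ, ∀ᶠ y in comap ι (𝓝 ξ), ∀ p ∈ proj X y, dist x p ≤ R := by
  obtain ⟨x₀, hx₀⟩ := hne
  suffices h : ∃ R : ℝ, ∀ᶠ y in comap ι (𝓝 ξ), ∀ p ∈ proj X y, dist x₀ p ≤ R by
    obtain ⟨R, hR⟩ := h
    refine ⟨dist x x₀ + R, hR.mono fun y hy p hp => ?_⟩
    linarith [hy p hp, dist_triangle x x₀ p]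
  by_contra hcon
  push Not at hcon
  obtain ⟨U, hU, hUlim⟩ := exists_approx Z
  have := fun m : ℕ => frequently_comap_iff.1 (hcon m) (U m ξ) (hU m ξ)
  choose y hyU p hp hdist using this
  have hyξ : Tendsto (fun m => ι (y m)) atTop (𝓝 ξ) :=
    (hUlim (fun _ => ξ) _ (Eventually.of_forall hyU) id ξ tendsto_id).1 tendsto_const_nhds
  have hC1 := hX.1
  -- Geodesics from `x₀` to `y m` pass near the projections `p m`. If these were unbounded, they
  -- would tend to `[ξ]` within `X`.
  have hpξ : AccumulatesInto (fun m => ι (p m)) (cls ι S ξ) := by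
    refine accumulatesInto_of_fellow hY hconv (x := x₀) (y' := y) (ρ := fun m : ℕ => (m : ℝ))
      (r := 2 * C) tendsto_natCast_atTop_atTop ?_ (accumulatesInto_of_tendsto hyξ
        (self_mem_cls hξ))
    filter_upwards [(tendsto_natCast_atTop_atTop (R := ℝ)).eventually_ge_atTop C] with m hm
    obtain ⟨γ, hγ⟩ := hY x₀ (p m)
    obtain ⟨γ', hγ'⟩ := hY x₀ (y m)
    obtain ⟨-, -, q, hq, -, hqp, -⟩ := bgi hX hγ' (self_mem_proj hx₀) (hp m)
      (by linarith [hdist m])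
    exact ⟨γ, γ', p m, q, hγ, hγ', hγ.right_mem, hq, by rwa [dist_comm], (hdist m).le⟩
  obtain ⟨ζ, hζ, φ, hφ, hlim⟩ := hpξ.exists_subseq
  refine hn ⟨ζ, ⟨⟨mem_closure_of_tendsto hlim (Eventually.of_forall fun m => ⟨_, (hp _).1, rfl⟩),
    hζ.1⟩, hζ.1⟩, hξ, S.symm' hζ.2⟩

theorem comap_neBot (hd : DenseRange ι) (ξ : Z) : (comap ι (𝓝 ξ)).NeBot := by
  rw [comap_neBot_iff]
  intro U hU
  obtain ⟨y, hy⟩ := hd.exists_mem_open isOpen_interior ⟨ξ, mem_interior_iff_mem_nhds.2 hU⟩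
  exact ⟨y, interior_subset hy⟩

/-- Only finitely many points of `X` occur as projections of points near `ξ`, so one of them occurs
arbitrarily close to `ξ`. -/
theorem bdryProj_nonempty (hd : DenseRange ι) {X : Set Y} (hX : IsClosed X) (hne : X.Nonempty)
    {ξ : Z} {x : Y} {R : ℝ} (hfin : (X ∩ Metric.closedBall x R).Finite)
    (h : ∀ᶠ y in comap ι (𝓝 ξ), ∀ p ∈ proj X y, dist x p ≤ R) : (bdryProj ι X ξ).Nonempty := by
  by_contra hcon
  have h1 : ∀ p ∈ X ∩ Metric.closedBall x R, ∀ᶠ y in comap ι (𝓝 ξ), p ∉ proj X y := by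
    intro p _
    by_contra hp
    rw [not_eventually] at hp
    refine hcon ⟨p, fun U hU => ?_⟩
    obtain ⟨y, hy, hy'⟩ := frequently_comap_iff.1 hp U hU
    exact ⟨y, hy, not_not.1 hy'⟩
  have := comap_neBot hd ξ
  obtain ⟨y, hy1, hy2⟩ := (((eventually_all_finite hfin).2 h1).and h).exists
  obtain ⟨p, hp⟩ := proj_nonempty hX hne y
  exact hy1 p ⟨hp.1, by rw [Metric.mem_closedBall, dist_comm]; exact hy2 p hp⟩ hp

theorem mem_of_mem_bdryProj {X : Set Y} {ξ : Z} {p : Y} (hp : p ∈ bdryProj ι X ξ) {q : Y → Prop}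
    (h : ∀ᶠ y in comap ι (𝓝 ξ), ∀ p ∈ proj X y, q p) : q p := by
  obtain ⟨U, hU, hq⟩ := mem_comap.1 h
  obtain ⟨y, hy, hpy⟩ := hp U hU
  exact hq hy p hpy

theorem finite_smul_axis_inter (hproper : IsProperAction G Y) (g h : G) (x : Y) (R : ℝ) :
    ((g • axis o h) ∩ Metric.closedBall x R).Finite := by
  refine ((finite_dist_smul_le (o := o) hproper x R).image fun g => g • o).subset ?_
  rintro _ ⟨⟨_, ⟨k, -, rfl⟩, rfl⟩, hy⟩
  refine ⟨g * k, ?_, mul_smul _ _ _⟩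
  rw [Metric.mem_closedBall, dist_comm] at hy
  simpa [mul_smul] using hy

/-- A Myrberg point is not in the locus of the limit set of an axis. -/
theorem not_mem_locus_of_mem_myrberg (hcomp : IsCompactification G ι S) (hY : IsGeodesicSpace Y)
    (hconv : IsConvergenceBoundary ι S)
    {ξ : Z} (hξ : ξ ∈ myrberg G ι S o) {f k : G} (hf : IsContractingElt o f)
    (hnp : IsNonpinchedElt ι S o f)
    (hind : Independent o k f) (g : G) :
    ξ ∉ locus ι S (limitSet ι (g • axis o k)) := by
  rintro ⟨ζ, ⟨⟨hζ, hζb⟩, -⟩, hξζ⟩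
  obtain ⟨⟨C, hC⟩, τ, hτ, -⟩ := hind
  set X := g • axis o k with hXdef
  have hX : IsContracting C X := hC X ⟨k, by simp, g, rfl⟩
  have hC1 := hX.1
  set x := g • o with hx
  have hxX : x ∈ X := Set.smul_mem_smul_set (self_mem_axis o k)
  obtain ⟨D, K, hD⟩ := hf.morse
  set D' := max D 0 with hD'
  obtain ⟨K', hK'0, hK'⟩ := hf.exists_lt_dist (τ (5 * C + D'))
  obtain ⟨v, hv, hvlim⟩ := mem_closure_iff_seq_limit.1 hζ
  choose p hp hpv using hv
  obtain ⟨y, hy⟩ := exists_seq_tendsto hcomp.dense ξ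
  have hpξ : AccumulatesInto (fun m => ι (p m)) (cls ι S ξ) := by
    rw [cls_eq hξζ.2]
    exact accumulatesInto_of_tendsto (by simpa only [hpv] using hvlim) (self_mem_cls hζb)
  have hyξ := accumulatesInto_of_tendsto hy (self_mem_cls (S := S) hξζ.1)
  obtain ⟨gs, h1, h2, -⟩ := exists_seq_of_mem_myrberg hcomp hY hconv hξ hf hnp
  -- With `n` fixed, geodesics from `x` to points near `ξ` follow a piece of `(gs n)⁻¹ • axis o f`
  -- too long for the overlap bound. Only then is `m` chosen: as `ξ` is non-pinched, the geodesics
  -- from `p m` to `y m` exit, so those from `x` to `y m` follow `X` beyond that piece.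
  obtain ⟨n, hn1, hn2⟩ := ((h1 (K' + |K|)).and (h2 x 0)).exists
  choose γ hγ using fun m => hY (p m) (y m)
  have hex := hξ.1.2 p y γ hpξ hyξ hγ x
    (D' + 5 * C + 1 + dist x ((gs n)⁻¹ • o) + dist x ((gs n)⁻¹ • f ^ K' • o))
  have hev := (tendsto_comap_iff.2 hy : Tendsto y atTop (comap ι (𝓝 ξ))).eventually hn1
  obtain ⟨m, hm1, hm2⟩ := (hex.and hev).exists
  obtain ⟨u, hu⟩ := proj_nonempty hX.2.1 ⟨x, hxX⟩ (y m)
  have hux : D' + 3 * C + 1 + dist x ((gs n)⁻¹ • o) + dist x ((gs n)⁻¹ • f ^ K' • o)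
      ≤ dist x u := by
    by_cases hpu : dist (p m) u ≤ C
    · linarith [hm1 (p m) (hγ m).left_mem, dist_triangle x u (p m), dist_comm u (p m)]
    · obtain ⟨-, -, q, hq, -, hqu, -⟩ := bgi hX (hγ m) (self_mem_proj (hp m)) hu (not_le.1 hpu)
      linarith [hm1 q hq, dist_triangle x u q, dist_comm u q]
  have hD'0 : 0 ≤ D' := le_max_right _ _
  have e1 := dist_nonneg (x := x) (y := (gs n)⁻¹ • o)
  have e2 := dist_nonneg (x := x) (y := (gs n)⁻¹ • f ^ K' • o)
  obtain ⟨γ₁, hγ₁⟩ := hY x (y m)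
  obtain ⟨-, -, q, hq, -, hqu, -, hqC, -⟩ := bgi hX hγ₁ (self_mem_proj hxX) hu (by linarith)
  obtain ⟨γ₂, hs₂, hγ₂, hm₂⟩ := hγ₁.sub_left hq
  have hqx := dist_triangle x q u
  obtain ⟨C', hC'⟩ := hf.2.1
  obtain ⟨a, ha⟩ := proj_nonempty hC'.2.1 (cyclicOrbit_nonempty o f) (gs n • x)
  obtain ⟨b, hb⟩ := proj_nonempty hC'.2.1 (cyclicOrbit_nonempty o f) (gs n • y m)
  obtain ⟨i, rfl⟩ := ha.1
  obtain ⟨j, rfl⟩ := hb.1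
  have hi := hn2 i ha
  have hj := hm2 j hb
  have hKabs := le_abs_self K
  have hK0 := abs_nonneg K
  have near : ∀ s : ℤ, 0 ≤ s → s ≤ K' →
      dist x ((gs n)⁻¹ • f ^ s • o) + D' < dist x q →
      (gs n)⁻¹ • f ^ s • o ∈ Metric.cthickening (5 * C + D') X ∩
        Metric.cthickening (5 * C + D') ((gs n)⁻¹ • axis o f) := by
    intro s hs0 hsK hsq
    obtain ⟨w', hw', hwD⟩ := hD _ _ _ i s j (hγ₁.smul (gs n)) ha hb (by omega) (by omega)
      (by omega)
    obtain ⟨w, hw, rfl⟩ := hw'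
    have hwd : dist ((gs n)⁻¹ • f ^ s • o) w ≤ D' := by
      rw [← dist_smul (gs n), smul_inv_smul, dist_comm]
      exact hwD.trans (le_max_left _ _)
    have hw2 : w ∈ γ₂ := (hm₂ w hw).2 (by
      linarith [dist_triangle x ((gs n)⁻¹ • f ^ s • o) w])
    refine ⟨?_, Metric.self_subset_cthickening _
      (Set.smul_mem_smul_set (cyclicOrbit_subset_axis o f ⟨s, rfl⟩))⟩
    rw [mem_cthickening_iff_infDist_le ⟨x, hxX⟩ (by linarith)]
    have h3 := quasiconvex hX ⟨x, hxX⟩ hγ₂ (r := C) le_rfl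
      (by rw [Metric.infDist_zero_of_mem hxX]; linarith) hqC hw2
    linarith [Metric.infDist_le_infDist_add_dist (s := X) (x := (gs n)⁻¹ • f ^ s • o) (y := w)]
  have hm0 := near 0 le_rfl hK'0.le (by rw [zpow_zero, one_smul]; linarith)
  have hmK := near K' hK'0.le le_rfl (by linarith)
  have h3 := hτ X ⟨k, rfl, g, rfl⟩ _ ⟨f, rfl, (gs n)⁻¹, rfl⟩ _ (by linarith) _ hm0 _ hmK
  rw [dist_smul] at h3
  have h4 := hK' 0 K' (by rw [zero_sub, abs_neg]; exact le_abs_self _)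
  linarith

/-- The elements `g n` that carry `ξ` and the base points to the two ends of `f` make the distance
between the projections of `o` and `ξ` to `(g n)⁻¹ • axis o f` tend to infinity. Independence of a
second element of `F` keeps `ξ` away from the limit sets of the axes. -/
theorem myrberg_subset_projConical (hcomp : IsCompactification G ι S) (hY : IsGeodesicSpace Y)
    (hproper : IsProperAction G Y) (hconv : IsConvergenceBoundary ι S) {F : Finset G}
    (hF : F ∈ triples G ι S o) (L : ℝ) :
    myrberg G ι S o ⊆ projConical ι S (axisSystem o (F : Set G)) L := by
  intro ξ hξ
  obtain ⟨hcard, hFc, hFi⟩ := hF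
  have hloc : ∀ X ∈ axisSystem o (F : Set G), ξ ∉ locus ι S (limitSet ι X) := by
    rintro X ⟨k, hk, g, rfl⟩
    obtain ⟨f, hf, hfk⟩ := F.exists_mem_ne (by omega) k
    exact not_mem_locus_of_mem_myrberg hcomp hY hconv hξ (hFc f hf).1 (hFc f hf).2
      (hFi k hk f hf hfk.symm) g
  obtain ⟨f, hf⟩ : F.Nonempty := Finset.card_pos.1 (by omega)
  obtain ⟨hfc, hfn⟩ := hFc f hf
  obtain ⟨g, h1, h2, -⟩ := exists_seq_of_mem_myrberg hcomp hY hconv hξ hfc hfn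
  obtain ⟨C, hC⟩ := hfc.axis_contracting hY hproper
  obtain ⟨C', hC'⟩ := hfc.2.1
  obtain ⟨D, hD1, hD2⟩ := hfc.close_axis hY
  have hne : ∀ g : G, (g • axis o f).Nonempty := fun g => (axis_nonempty o f).smul_set
  have hmem : ∀ n, (g n)⁻¹ • axis o f ∈ axisSystem o (F : Set G) := fun n => ⟨f, hf, _, rfl⟩
  have hbound : ∀ n, ∃ R : ℝ, ∀ᶠ y in comap ι (𝓝 ξ),
      ∀ p ∈ proj ((g n)⁻¹ • axis o f) y, dist o p ≤ R := fun n =>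
    exists_bound_proj hY hconv (hC.smul _) (hne _) hξ.1.1 (hloc _ (hmem n)) o
  have key : ∀ L' : ℝ, ∀ᶠ n in atTop, ∃ u ∈ proj ((g n)⁻¹ • axis o f) o,
      ∃ v ∈ bdryProj ι ((g n)⁻¹ • axis o f) ξ, L' < dist u v := by
    intro L'
    obtain ⟨K, hK0, hK⟩ := hfc.exists_lt_dist (L' + 2 * (D + 4 * C'))
    filter_upwards [h1 K, h2 o 0] with n hn1 hn2
    obtain ⟨R, hR⟩ := hbound n
    obtain ⟨v, hv⟩ := bdryProj_nonempty hcomp.dense (hC.smul _).2.1 (hne _)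
      (finite_smul_axis_inter hproper _ f o R) hR
    obtain ⟨u, hu⟩ := proj_nonempty (hC.smul (g n)⁻¹).2.1 (hne _) o
    refine ⟨u, hu, v, hv, ?_⟩
    have near : ∀ {y u : Y}, u ∈ proj ((g n)⁻¹ • axis o f) y → ∃ i : ℤ,
        f ^ i • o ∈ proj (cyclicOrbit o f) (g n • y) ∧
          dist (f ^ i • o) (g n • u) ≤ D + 4 * C' := by
      intro y u hu
      rw [mem_proj_smul_iff, inv_inv] at hu
      obtain ⟨a, ha⟩ := proj_nonempty hC'.2.1 (cyclicOrbit_nonempty o f) (g n • y)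
      obtain ⟨i, rfl⟩ := ha.1
      exact ⟨i, ha, proj_dist_of_close hY hC' (cyclicOrbit_nonempty o f) hD1 hD2 ha hu⟩
    obtain ⟨i, hi, hiu⟩ := near hu
    have hi0 := hn2 i hi
    obtain ⟨j, hjK, hjv⟩ : ∃ j ≥ K, dist (f ^ j • o) (g n • v) ≤ D + 4 * C' :=
      mem_of_mem_bdryProj (q := fun v => ∃ j ≥ K, dist (f ^ j • o) (g n • v) ≤ D + 4 * C') hv
        (hn1.mono fun y hy p hp => by
          obtain ⟨j, hj, hjp⟩ := near hp
          exact ⟨j, hy j hj, hjp⟩)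
    have h3 := hK i j (by rw [abs_sub_comm]; exact (by omega : K ≤ j - i).trans (le_abs_self _))
    have h4 := dist_triangle4 (f ^ i • o) (g n • u) (g n • v) (f ^ j • o)
    rw [dist_smul, dist_comm (g n • v)] at h4
    linarith
  -- For each single axis the projection distance is finite. So if only finitely many axes
  -- qualified, the distances would be bounded on them, against their growth along the sequence.
  refine ⟨hξ.1, o, fun hfin => ?_⟩
  have hR : ∀ X : Set Y, ∃ R : ℝ, X ∈ axisSystem o (F : Set G) →
      ∀ u ∈ proj X o, ∀ v ∈ bdryProj ι X ξ, dist u v ≤ R := by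
    intro X
    by_cases hX : X ∈ axisSystem o (F : Set G)
    swap
    · exact ⟨0, fun h => absurd h hX⟩
    obtain ⟨k, hk, g', hXk⟩ := id hX
    obtain ⟨Ck, hCk⟩ := (hFc k hk).1.axis_contracting hY hproper
    have hXc : IsContracting Ck X := by rw [hXk]; exact hCk.smul g'
    have hXne : X.Nonempty := by rw [hXk]; exact (axis_nonempty o k).smul_set
    obtain ⟨R, hR⟩ := exists_bound_proj hY hconv hXc hXne hξ.1.1 (hloc X hX) o
    obtain ⟨w, hw⟩ := proj_nonempty hXc.2.1 hXne o
    refine ⟨Metric.infDist o X + R, fun _ u hu v hv => ?_⟩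
    have h3 := mem_of_mem_bdryProj hv hR
    have h4 := hu.2
    linarith [dist_triangle_left u v o]
  choose R hR using hR
  obtain ⟨M, hM⟩ := (hfin.image R).bddAbove
  obtain ⟨n, u, hu, v, hv, huv⟩ := (key (max M L)).exists
  have hXmem := hmem n
  have h3 := hR _ hXmem u hu v hv
  have h4 : R ((g n)⁻¹ • axis o f) ≤ M := hM ⟨_, ⟨hXmem, hloc _ hXmem, u, Or.inl hu, v, Or.inr hv,
    (le_max_right M L).trans huv.le⟩, rfl⟩
  linarith [le_max_left M L]

/-- The constants `R` for which the Myrberg points are `(R, F)`-conical for all triples `F` with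
a given axis system. -/
theorem exists_myrberg_subset_conical (hcomp : IsCompactification G ι S) (hY : IsGeodesicSpace Y)
    (hconv : IsConvergenceBoundary ι S) (𝓕 : Set (Set Y)) :
    ∃ R : ℝ, ∀ r ≥ R, ∀ F ∈ triples G ι S o, axisSystem o (F : Set G) = 𝓕 →
      myrberg G ι S o ⊆ conical ι S o r (F : Set G) := by
  by_cases hex : ∃ F₀ ∈ triples G ι S o, axisSystem o (F₀ : Set G) = 𝓕
  swap
  · exact ⟨0, fun r _ F hF h𝓕 => absurd ⟨F, hF, h𝓕⟩ hex⟩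
  obtain ⟨F₀, ⟨-, hF₀c, -⟩, rfl⟩ := hex
  -- The radius `R` depends on `k ∈ F₀` only; just the window length `W` depends on `q`. Since each
  -- `axis o f`, `f ∈ F`, is a translate of some `axis o k`, these finitely many radii serve every
  -- triple with the same system.
  have hk : ∀ k : G, ∃ R : ℝ, k ∈ F₀ → ∀ q ∈ axis o k, ∃ W : ℤ, ∀ (a b : Y) (γ : Set Y) (i j : ℤ),
      IsGeodSegment γ a b → k ^ i • o ∈ proj (cyclicOrbit o k) a →
      k ^ j • o ∈ proj (cyclicOrbit o k) b → i ≤ -W → W ≤ j → Metric.infDist q γ ≤ R := by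
    intro k
    by_cases hk : k ∈ F₀
    swap
    · exact ⟨0, fun h => absurd h hk⟩
    obtain ⟨D, K, hD⟩ := (hF₀c k hk).1.morse
    obtain ⟨D', hD'⟩ := (hF₀c k hk).1.exists_axis_near hY
    refine ⟨D + D', fun _ q hq => ?_⟩
    obtain ⟨n, hn⟩ := hD' q hq
    refine ⟨|n| + |K|, fun a b γ i j hγ hi hj hiW hjW => ?_⟩
    have h1 := le_abs_self n
    have h2 := neg_abs_le n
    have h3 := le_abs_self K
    have h4 := abs_nonneg K
    obtain ⟨w, hw, hwD⟩ := hD a b γ i n j hγ hi hj (by omega) (by omega) (by omega)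
    refine (Metric.infDist_le_dist_of_mem hw).trans ?_
    linarith [dist_triangle_right q w (k ^ n • o)]
  choose R hR using hk
  obtain ⟨M, hM⟩ := (F₀.finite_toSet.image R).bddAbove
  refine ⟨M, fun r hr F hF h𝓕 ξ hξ => ?_⟩
  obtain ⟨f, hf⟩ : F.Nonempty := Finset.card_pos.1 (by rw [hF.1]; norm_num)
  obtain ⟨k, hk, t, ht⟩ : axis o f ∈ axisSystem o (F₀ : Set G) := by
    rw [← h𝓕]; exact ⟨f, hf, 1, by simp⟩
  change axis o f = t • axis o k at ht
  obtain ⟨hkc, hkn⟩ := hF₀c k hk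
  have hRM : R k ≤ r := (hM ⟨k, hk, rfl⟩).trans hr
  obtain ⟨g, h1, h2, h3⟩ := exists_seq_of_mem_myrberg hcomp hY hconv hξ hkc hkn
  have hq : ∀ y ∈ axis o f, t⁻¹ • y ∈ axis o k := fun y hy => by
    rwa [ht, Set.mem_smul_set_iff_inv_smul_mem] at hy
  have hfo : f • o ∈ axis o f := by
    have := cyclicOrbit_subset_axis o f (zpow_mem_cyclicOrbit o f 1)
    rwa [zpow_one] at this
  obtain ⟨W₁, hW₁⟩ := hR k hk _ (hq _ (self_mem_axis o f))
  obtain ⟨W₂, hW₂⟩ := hR k hk _ (hq _ hfo)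
  obtain ⟨C', hC'⟩ := hkc.2.1
  have hne := comap_neBot hcomp.dense ξ
  have key : ∀ᶠ n in atTop, ξ ∈ partialShadow ι o r (F : Set G) o (((g n)⁻¹ * t⁻¹) • o) := by
    filter_upwards [h1 (max W₁ W₂), h2 o (-max W₁ W₂)] with n hn1 hn2
    refine ⟨?_, hξ.1.1⟩
    rw [mem_closure_iff_nhds]
    intro U hU
    obtain ⟨z, hzU, hz⟩ := frequently_comap_iff.1 hn1.frequently U hU
    refine ⟨ι z, hzU, z, ?_, rfl⟩
    obtain ⟨γ, hγ⟩ := hY o z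
    obtain ⟨a, ha⟩ := proj_nonempty hC'.2.1 (cyclicOrbit_nonempty o k) (g n • o)
    obtain ⟨b, hb⟩ := proj_nonempty hC'.2.1 (cyclicOrbit_nonempty o k) (g n • z)
    obtain ⟨i, rfl⟩ := ha.1
    obtain ⟨j, rfl⟩ := hb.1
    have hi := hn2 i ha
    have hj := hz j hb
    have l1 := le_max_left W₁ W₂
    have l2 := le_max_right W₁ W₂
    have e : ∀ y : Y, Metric.infDist (((g n)⁻¹ * t⁻¹) • y) γ =
        Metric.infDist (t⁻¹ • y) (g n • γ) := by
      intro y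
      have := infDist_smul_set (g n)⁻¹ (g n • γ) (t⁻¹ • y)
      rwa [inv_smul_smul, ← mul_smul] at this
    refine ⟨γ, hγ, f, hf, (g n)⁻¹ * t⁻¹, rfl, ?_, ?_⟩
    · rw [e]
      exact (hW₁ _ _ _ i j (hγ.smul (g n)) ha hb (by omega) (by omega)).trans hRM
    · rw [e]
      exact (hW₂ _ _ _ i j (hγ.smul (g n)) ha hb (by omega) (by omega)).trans hRM
  refine ⟨hξ.1, o, MulAction.mem_orbit_self o, fun hfin => ?_⟩
  have hev : ∀ᶠ n in atTop, ∃ y ∈ {y | y ∈ MulAction.orbit G o ∧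
      ξ ∈ partialShadow ι o r (F : Set G) o y}, ((g n)⁻¹ * t⁻¹) • o = y :=
    key.mono fun n hn => ⟨_, ⟨MulAction.mem_orbit _ _, hn⟩, rfl⟩
  -- Each `y` occurs only finitely often as a barrier of the sequence: otherwise `g n • y` would
  -- return to the point `t⁻¹ • o` of `Y`, while it accumulates only in the boundary.
  have hcontra : ∀ y ∈ {y | y ∈ MulAction.orbit G o ∧
      ξ ∈ partialShadow ι o r (F : Set G) o y}, ∀ᶠ n in atTop, ((g n)⁻¹ * t⁻¹) • o ≠ y := by
    intro y _
    by_contra hcon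
    rw [not_eventually] at hcon
    obtain ⟨ψ, hψ, hψy⟩ := extraction_of_frequently_atTop hcon
    have hcl : MapClusterPt (ι (t⁻¹ • o)) atTop (fun n => ι (g n • y)) := by
      refine mapClusterPt_of_subseq hψ.tendsto_atTop (tendsto_const_nhds.congr fun n => ?_)
      have := not_not.1 (hψy n)
      simp only [Function.comp]
      rw [← this, mul_smul, smul_inv_smul]
    exact h3 y _ hcl ⟨_, rfl⟩
  obtain ⟨n, ⟨y, hy, hny⟩, hn⟩ := (hev.and ((eventually_all_finite hfin).2 hcontra)).exists
  exact hn y hy hny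

end MyrbergPoints

/-! ### Moving a geodesic that follows an axis into a prescribed position -/

section Steering

variable {G Y : Type*} [Group G] [MetricSpace Y] [ProperSpace Y] [MulAction G Y]
  [IsIsometricSMul G Y] {o : Y} {h : G} {t : Fin 3 → G} {C θ κ₀ κ : ℝ}

theorem exists_near_of_projNear {A γ : Set Y} {a z p q : Y} {κ κ' : ℝ} (hA : IsContracting C A)
    (hne : A.Nonempty) (hγ : IsGeodSegment γ a z) (ha : ProjNear A a p κ) (hz : ProjNear A z q κ')
    (hpq : C + κ + κ' < dist p q) : ∃ w ∈ γ, dist w p ≤ 2 * C + κ := by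
  obtain ⟨u, hu⟩ := proj_nonempty hA.2.1 hne a
  obtain ⟨v, hv⟩ := proj_nonempty hA.2.1 hne z
  have h1 := ha u hu
  have h2 := hz v hv
  have h3 := dist_triangle4 p u v q
  rw [dist_comm p u] at h3
  obtain ⟨w, hw, -, -, hwu, -⟩ := bgi hA hγ hu hv (by linarith)
  exact ⟨w, hw, by linarith [dist_triangle w u p]⟩

/-- Up to conjugation by the second factor, the inverse of the product for `N` is the product for
`-N`. So following the axis backwards is following an axis of the same kind forwards. -/
theorem axisProd_zpow (t : Fin 3 → G) (h p : G) (i j : Fin 3) (N a : ℤ) :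
    axisProd t h p i j N ^ a =
      (conjPow (t j) h N)⁻¹ * axisProd t h p i j (-N) ^ (-a) * conjPow (t j) h N := by
  have e : axisProd t h p i j N =
      (conjPow (t j) h N)⁻¹ * (axisProd t h p i j (-N))⁻¹ * (conjPow (t j) h N)⁻¹⁻¹ := by
    simp only [axisProd, conjPow_neg]; group
  conv_lhs => rw [e]
  rw [conj_zpow, inv_inv, inv_zpow']

/-- A geodesic from `x` to `z` that follows a long piece of the axis of `axisProd` can be moved
such that its beginning lies behind `v o` and its end lies behind `u o`, as seen from `o`. -/
theorem Frame.exists_steering_of_le (hY : IsGeodesicSpace Y) (fr : Frame o h t C θ κ₀ κ)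
    {u v : G} {i j : Fin 3} {N : ℤ} (hx : Extendable o h t C κ₀ κ (v⁻¹ * u) i j)
    (hu : ProjNear (t i • axis o h) (u⁻¹ • o) o κ) (hv : ProjNear (t j • axis o h) (v⁻¹ • o) o κ)
    (hN : ∀ i, 100 * (C + (θ + κ₀ + 4 * C + κ)) < dist o (conjPow (t i) h N • o)) (ρ : ℝ) :
    ∃ c : ℤ, ∀ (g : G) (a b : ℤ), c ≤ b - a → ∃ k : G, ∀ (x z : Y) (γ : Set Y) (w₁ w₂ : Y),
      IsGeodSegment γ x z → w₁ ∈ γ → w₂ ∈ γ → dist x w₁ ≤ dist x w₂ →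
      dist w₁ (g • axisProd t h (v⁻¹ * u) i j N ^ a • o) ≤ ρ →
      dist w₂ (g • axisProd t h (v⁻¹ * u) i j N ^ b • o) ≤ ρ →
      (∀ x', dist x x' + 2 * (θ + κ₀ + 4 * C + κ + 8 * C) < dist x w₁ →
        ∀ γ', IsGeodSegment γ' o (k • x') → ∃ q ∈ γ', dist q (v • o) ≤ 2 * C + κ) ∧
      ∀ γ', IsGeodSegment γ' o (k • z) → ∃ q ∈ γ', dist q (u • o) ≤ 2 * C + κ := by
  set θ' := θ + κ₀ + 4 * C + κ with hθ'
  have hC1 := fr.one_le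
  have h0 := fr.nonneg
  have h0' := fr.nonneg₀
  have h0'' := fr.nonneg'
  set p := v⁻¹ * u with hp
  set E := axisProd t h p i j N with hE
  have ch : PeriodicChain E 2 C θ'
      (pairSeq E (t j • axis o h) (p • t i • axis o h))
      (pairSeq E ((conjPow (t j) h N)⁻¹ • o) (p • o))
      (pairSeq E o (p • conjPow (t i) h N • o)) :=
    fr.chain hY hx.good_end hx.good_start hx.far rfl rfl (hN i) (hN j)
  obtain ⟨c, hc⟩ := ch.exists_window hY o ρ
  have hne : ∀ g : G, (g • axis o h).Nonempty := fun g => (axis_nonempty o h).smul_set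
  -- The translation brings a crossed period to the members `v • t j • axis o h` and `u • t i • axis
  -- o h`; the shift by `|c|` and the length `2 * |c| + 1` keep both inside the window.
  refine ⟨2 * |c| + 1, fun g a b hab => ⟨v * E ^ (-(a + |c|)) * g⁻¹,
    fun x z γ w₁ w₂ hγ h₁ h₂ h₁₂ hw₁ hw₂ => ?_⟩⟩
  have hcabs := le_abs_self c
  have hc0 := abs_nonneg c
  have hE1 : ∀ y : Y, E ^ (a + |c|) • E ^ (-(a + |c|)) • y = y := fun y => by
    rw [← mul_smul, ← zpow_add, add_neg_cancel, zpow_zero, one_smul]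
  have tr : ∀ {w y : Y}, dist w (g • y) ≤ ρ → dist (g⁻¹ • w) y ≤ ρ := fun hw => by
    rwa [← dist_smul g, smul_inv_smul]
  have win := fun s => hc (g⁻¹ • x) (g⁻¹ • z) (g⁻¹ • γ) (g⁻¹ • w₁) (g⁻¹ • w₂) a b s
    (hγ.smul g⁻¹) (Set.smul_mem_smul_set h₁) (Set.smul_mem_smul_set h₂)
    (by simpa only [dist_smul] using h₁₂) (tr hw₁) (tr hw₂)
  constructor
  · intro x' hx' γ' hγ'
    have g1 := (win (0 + 2 * (a + |c|)) (by omega) (by omega)).2 (g⁻¹ • x')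
      (by simpa only [dist_smul] using hx')
    rw [← hE1 (g⁻¹ • x'), ch.gate_left_zpow, Gate, pairSeq_zero, pairSeq_zero] at g1
    have s1 := hγ'.smul v⁻¹
    rw [mul_smul, mul_smul, inv_smul_smul] at s1
    -- Seen from `t j • axis o h`, the point `v⁻¹ • o` projects near `o` by the choice of `j`, and
    -- the translate of `x'` projects near the other end of the piece. So the geodesic between them
    -- passes near `o`.
    obtain ⟨w, ⟨q, hq, rfl⟩, hw⟩ := exists_near_of_projNear (fr.contr (t j)) (hne _) s1 hv g1 (by
      rw [← dist_smul (conjPow (t j) h N), smul_inv_smul, dist_comm]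
      linarith [hN j])
    exact ⟨q, hq, by rwa [← dist_smul v⁻¹, inv_smul_smul]⟩
  · intro γ' hγ'
    have g1 := (win (1 + 2 * (a + |c|)) (by omega) (by omega)).1
    rw [← hE1 (g⁻¹ • z), ch.gate_right_zpow, Gate, pairSeq_one, pairSeq_one, projNear_smul_iff,
      inv_smul_smul] at g1
    have s1 := hγ'.smul u⁻¹
    rw [mul_smul, mul_smul, show ∀ y : Y, u⁻¹ • v • y = p⁻¹ • y from fun y => by
      rw [← mul_smul, hp, mul_inv_rev, inv_inv]] at s1
    obtain ⟨w, ⟨q, hq, rfl⟩, hw⟩ := exists_near_of_projNear (fr.contr (t i)) (hne _) s1 hu g1 (by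
      linarith [hN i])
    exact ⟨q, hq, by rwa [← dist_smul u⁻¹, inv_smul_smul]⟩

/-- The version of `Frame.exists_steering_of_le` for geodesics following the axis in either
direction. -/
theorem Frame.exists_steering (hY : IsGeodesicSpace Y) (fr : Frame o h t C θ κ₀ κ)
    {u v : G} {i j : Fin 3} {N : ℤ} (hx : Extendable o h t C κ₀ κ (v⁻¹ * u) i j)
    (hu : ProjNear (t i • axis o h) (u⁻¹ • o) o κ) (hv : ProjNear (t j • axis o h) (v⁻¹ • o) o κ)
    (hN : ∀ i, 100 * (C + (θ + κ₀ + 4 * C + κ)) < dist o (conjPow (t i) h N • o)) (ρ : ℝ) :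
    ∃ c : ℤ, ∀ (g : G) (a b : ℤ), c ≤ |a - b| → ∃ k : G, ∀ (x z : Y) (γ : Set Y) (w₁ w₂ : Y),
      IsGeodSegment γ x z → w₁ ∈ γ → w₂ ∈ γ → dist x w₁ ≤ dist x w₂ →
      dist w₁ (g • axisProd t h (v⁻¹ * u) i j N ^ a • o) ≤ ρ →
      dist w₂ (g • axisProd t h (v⁻¹ * u) i j N ^ b • o) ≤ ρ →
      (∀ x', dist x x' + 2 * (θ + κ₀ + 4 * C + κ + 8 * C) < dist x w₁ →
        ∀ γ', IsGeodSegment γ' o (k • x') → ∃ q ∈ γ', dist q (v • o) ≤ 2 * C + κ) ∧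
      ∀ γ', IsGeodSegment γ' o (k • z) → ∃ q ∈ γ', dist q (u • o) ≤ 2 * C + κ := by
  obtain ⟨c₁, h₁⟩ := fr.exists_steering_of_le hY hx hu hv hN ρ
  have hN' : ∀ i, 100 * (C + (θ + κ₀ + 4 * C + κ)) < dist o (conjPow (t i) h (-N) • o) := by
    intro i
    rw [conjPow_neg, ← dist_smul (conjPow (t i) h N), smul_inv_smul, dist_comm]
    exact hN i
  set e := conjPow (t j) h N with he
  obtain ⟨c₂, h₂⟩ := fr.exists_steering_of_le hY hx hu hv hN' (ρ + dist (e • o) o)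
  refine ⟨max c₁ c₂, fun g a b hab => ?_⟩
  have m1 := le_max_left c₁ c₂
  have m2 := le_max_right c₁ c₂
  rcases le_total a b with hle | hle
  · rw [abs_sub_comm, abs_of_nonneg (by omega)] at hab
    exact h₁ g a b (by omega)
  · rw [abs_of_nonneg (by omega)] at hab
    obtain ⟨k, hk⟩ := h₂ (g * e⁻¹) (-a) (-b) (by omega)
    refine ⟨k, fun x z γ w₁ w₂ hγ hw₁ hw₂ hw hd₁ hd₂ => hk x z γ w₁ w₂ hγ hw₁ hw₂ hw ?_ ?_⟩
    all_goals
      rw [axisProd_zpow, ← he] at hd₁ hd₂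
      first
      | refine (dist_triangle _ _ _).trans (add_le_add hd₁ (le_of_eq ?_))
      | refine (dist_triangle _ _ _).trans (add_le_add hd₂ (le_of_eq ?_))
      simp only [mul_smul, dist_smul]

end Steering

/-! ### Recurrent points are Myrberg points -/

section Recurrence

variable {G Y Z : Type*} [Group G] [MetricSpace Y] [ProperSpace Y] [TopologicalSpace Z]
  [CompactSpace Z] [TopologicalSpace.MetrizableSpace Z] [MulAction G Y] [IsIsometricSMul G Y]
  [MulAction G Z] [ContinuousConstSMul G Z] {ι : Y → Z} {S : Setoid Z} {o : Y}

/-- Geodesics from some point `x` to points close to `ξ` follow arbitrarily long pieces of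
translates of the orbits of the elements of `F`, arbitrarily far away from `x`. -/
def Recurrent (ι : Y → Z) (o : Y) (F : Set G) (ξ : Z) : Prop :=
  ∃ ρ : ℝ, ∀ L : ℤ, ∃ x : Y, ∀ T : ℝ, ∃ f ∈ F, ∃ (g : G) (i j : ℤ), L ≤ |i - j| ∧
    ∃ᶠ z in comap ι (𝓝 ξ), ∃ (γ : Set Y) (w₁ w₂ : Y), IsGeodSegment γ x z ∧ w₁ ∈ γ ∧ w₂ ∈ γ ∧
      dist x w₁ ≤ dist x w₂ ∧ T ≤ dist x w₁ ∧ dist w₁ (g • f ^ i • o) ≤ ρ ∧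
      dist w₂ (g • f ^ j • o) ≤ ρ

theorem exists_forall_mem_finset {α β : Type*} [LinearOrder β] [Nonempty β] (F : Finset α)
    {p : α → β → Prop}
    (hp : ∀ a c c', c ≤ c' → p a c → p a c') (h : ∀ a ∈ F, ∃ c, p a c) : ∃ c, ∀ a ∈ F, p a c := by
  classical
  induction F using Finset.induction_on with
  | empty => exact ⟨Classical.arbitrary β, by simp⟩
  | insert a s _ ih =>
    obtain ⟨c, hc⟩ := ih fun a ha => h a (Finset.mem_insert_of_mem ha)
    obtain ⟨c', hc'⟩ := h a (Finset.mem_insert_self _ _)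
    refine ⟨max c c', fun b hb => ?_⟩
    rcases Finset.mem_insert.1 hb with rfl | hb
    · exact hp _ _ _ (le_max_right _ _) hc'
    · exact hp _ _ _ (le_max_left _ _) (hc b hb)

/-- The triple is built from `v⁻¹ * u`, with `i` and `j` usable at both ends of the period and for
`u⁻¹ • o`, `v⁻¹ • o`. The required length depends on `ρ`, so `Recurrent` must fix `ρ` before the
length; the radius `R` enters only through the distance `T`. -/
theorem exists_steering_of_recurrent (hcomp : IsCompactification G ι S)
    (hY : IsGeodesicSpace Y) (hproper : IsProperAction G Y) (hconv : IsConvergenceBoundary ι S)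
    {h : G} {t : Fin 3 → G} {C θ κ₀ κ : ℝ}
    (fr : Frame o h t C θ κ₀ κ) (hh : IsContractingElt o h) (hnp : IsNonpinchedElt ι S o h)
    (hpinch : (∀ h : G, IsContractingElt o h → IsNonpinchedElt ι S o h) ∨ IsClosedPartition ι S)
    {ξ : Z} (hrec : ∀ F ∈ triples G ι S o, Recurrent ι o (F : Set G) ξ) {u v : G}
    (huv : 4 * C + 2 * κ₀ + κ < dist (v • o) (u • o)) (R : ℝ) :
    ∃ k : G, (∀ x', dist o x' ≤ R → ∀ γ', IsGeodSegment γ' o (k • x') →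
        ∃ q ∈ γ', dist q (v • o) ≤ 2 * C + κ) ∧
      ∃ᶠ z in comap ι (𝓝 ξ), ∀ γ', IsGeodSegment γ' o (k • z) →
        ∃ q ∈ γ', dist q (u • o) ≤ 2 * C + κ := by
  set θ' := θ + κ₀ + 4 * C + κ with hθ'
  obtain ⟨i, hi, hi'⟩ := fr.good₂ ((v⁻¹ * u)⁻¹ • o) (u⁻¹ • o)
  obtain ⟨j, hj, hj'⟩ := fr.good₂ ((v⁻¹ * u) • o) (v⁻¹ • o)
  have hx : Extendable o h t C κ₀ κ (v⁻¹ * u) i j :=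
    ⟨hi, hj, by rwa [← dist_smul v, ← mul_smul, mul_inv_cancel_left]⟩
  obtain ⟨N₀, -, hN₀⟩ := fr.exists_long hh (100 * (C + θ'))
  obtain ⟨F, hF, hFN⟩ := fr.exists_mem_triples hcomp hY hproper hconv hh hnp hpinch hx N₀
  obtain ⟨ρ, hρ⟩ := hrec F hF
  obtain ⟨L, hL⟩ := exists_forall_mem_finset F
    (p := fun f c => ∀ (g : G) (a b : ℤ), c ≤ |a - b| → ∃ k : G,
      ∀ (x z : Y) (γ : Set Y) (w₁ w₂ : Y), IsGeodSegment γ x z → w₁ ∈ γ → w₂ ∈ γ →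
      dist x w₁ ≤ dist x w₂ → dist w₁ (g • f ^ a • o) ≤ ρ → dist w₂ (g • f ^ b • o) ≤ ρ →
      (∀ x', dist x x' + 2 * (θ' + 8 * C) < dist x w₁ →
        ∀ γ', IsGeodSegment γ' o (k • x') → ∃ q ∈ γ', dist q (v • o) ≤ 2 * C + κ) ∧
      ∀ γ', IsGeodSegment γ' o (k • z) → ∃ q ∈ γ', dist q (u • o) ≤ 2 * C + κ)
    (fun f c c' hcc H g a b hab => H g a b (hcc.trans hab)) (fun f hf => by
      obtain ⟨N, hN, rfl⟩ := hFN f hf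
      exact fr.exists_steering hY hx hi' hj' (hN₀ N (hN.trans (le_abs_self N))) ρ)
  obtain ⟨x, hxT⟩ := hρ L
  obtain ⟨f, hf, g, a, b, hab, hfr⟩ := hxT (dist x o + R + 2 * (θ' + 8 * C) + 1)
  obtain ⟨k, hk⟩ := hL f hf g a b hab
  refine ⟨k, fun x' hx' => ?_, hfr.mono ?_⟩
  · obtain ⟨z, γ, w₁, w₂, hγ, h₁, h₂, h₁₂, hT, hd₁, hd₂⟩ := hfr.exists
    exact (hk x z γ w₁ w₂ hγ h₁ h₂ h₁₂ hd₁ hd₂).1 x' (by linarith [dist_triangle x o x'])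
  · rintro z ⟨γ, w₁, w₂, hγ, h₁, h₂, h₁₂, hT, hd₁, hd₂⟩
    exact (hk x z γ w₁ w₂ hγ h₁ h₂ h₁₂ hd₁ hd₂).2

theorem exists_seq_of_mem_limitSet {ζ : Z} (hξ : ζ ∈ limitSet ι (MulAction.orbit G o)) :
    ∃ u : ℕ → G, Tendsto (fun n => ι (u n • o)) atTop (𝓝 ζ) := by
  obtain ⟨v, hv, hlim⟩ := mem_closure_iff_seq_limit.1 hξ.1
  choose y hy hyv using hv
  choose u hu using hy
  refine ⟨u, by simpa only [hu, hyv] using hlim⟩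

theorem mem_myrberg_of_recurrent (hcomp : IsCompactification G ι S)
    (hY : IsGeodesicSpace Y) (hproper : IsProperAction G Y) (hconv : IsConvergenceBoundary ι S)
    (hnonel : IsNonelementary G) {h : G} (hh : IsContractingElt o h)
    (hnp : IsNonpinchedElt ι S o h)
    (hpinch : (∀ h : G, IsContractingElt o h → IsNonpinchedElt ι S o h) ∨ IsClosedPartition ι S)
    {ξ : Z} (hξ : ξ ∈ nonpinched ι S)
    (hrec : ∀ F ∈ triples G ι S o, Recurrent ι o (F : Set G) ξ) : ξ ∈ myrberg G ι S o := by
  refine ⟨hξ, isVisual hcomp.openEmbedding hcomp.dense hY hconv hξ.1, fun a ha b hb hab => ?_⟩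
  obtain ⟨t, C, θ, κ₀, κ, fr⟩ := exists_frame hY hproper hnonel hh
  obtain ⟨u, hu⟩ := exists_seq_of_mem_limitSet ha
  obtain ⟨v, hv⟩ := exists_seq_of_mem_limitSet hb
  have hua := accumulatesInto_of_tendsto hu (self_mem_cls (S := S) ha.2)
  have hvb := accumulatesInto_of_tendsto hv (self_mem_cls (S := S) hb.2)
  have hud := tendsto_dist_of_accumulatesInto hcomp.openEmbedding cls_subset_bdry hua o
  have hvd := tendsto_dist_of_accumulatesInto hcomp.openEmbedding cls_subset_bdry hvb o
  -- If the two sequences stayed close along a subsequence, their limits would be in one class. For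
  -- the remaining indices arbitrary values of `k` and `z` do no harm.
  have hfar : ∀ᶠ n in atTop, 4 * C + 2 * κ₀ + κ < dist (v n • o) (u n • o) := by
    by_contra hcon
    rw [not_eventually] at hcon
    obtain ⟨ψ, hψ, hψd⟩ := extraction_of_frequently_atTop hcon
    have h1 := accumulatesInto_of_fellow hY hconv (x := o) (y := fun n => v (ψ n) • o)
      (y' := fun n => u (ψ n) • o) (r := 4 * C + 2 * κ₀ + κ) (hvd.comp hψ.tendsto_atTop)
      (Eventually.of_forall fun n => by
        obtain ⟨γ, hγ⟩ := hY o (v (ψ n) • o)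
        obtain ⟨γ', hγ'⟩ := hY o (u (ψ n) • o)
        exact ⟨γ, γ', _, _, hγ, hγ', hγ.right_mem, hγ'.right_mem, not_lt.1 (hψd n), le_rfl⟩)
      (hua.comp hψ.tendsto_atTop)
    exact hab (S.symm' (h1 b (hv.comp hψ.tendsto_atTop).mapClusterPt).2)
  have hk : ∀ n : ℕ, ∃ k : G, 4 * C + 2 * κ₀ + κ < dist (v n • o) (u n • o) →
      (∀ x', dist o x' ≤ n → ∀ γ', IsGeodSegment γ' o (k • x') →
        ∃ q ∈ γ', dist q (v n • o) ≤ 2 * C + κ) ∧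
      ∃ᶠ z in comap ι (𝓝 ξ), ∀ γ', IsGeodSegment γ' o (k • z) →
        ∃ q ∈ γ', dist q (u n • o) ≤ 2 * C + κ := by
    intro n
    by_cases hd : 4 * C + 2 * κ₀ + κ < dist (v n • o) (u n • o)
    · obtain ⟨k, hk⟩ := exists_steering_of_recurrent hcomp hY hproper hconv fr hh hnp hpinch hrec
        hd n
      exact ⟨k, fun _ => hk⟩
    · exact ⟨1, fun h => absurd h hd⟩
  choose k hk using hk
  obtain ⟨U, hU, hUlim⟩ := exists_approx Z
  have hz : ∀ n : ℕ, ∃ z : Y, 4 * C + 2 * κ₀ + κ < dist (v n • o) (u n • o) →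
      ι (k n • z) ∈ U n (k n • ξ) ∧ ∀ γ', IsGeodSegment γ' o (k n • z) →
        ∃ q ∈ γ', dist q (u n • o) ≤ 2 * C + κ := by
    intro n
    by_cases hd : 4 * C + 2 * κ₀ + κ < dist (v n • o) (u n • o)
    · obtain ⟨z, hz, hz'⟩ := frequently_comap_iff.1 (hk n hd).2 _
        ((continuous_const_smul (k n)).continuousAt (hU n (k n • ξ)))
      exact ⟨z, fun _ => ⟨by rw [hcomp.equivariant]; exact hz, hz'⟩⟩
    · exact ⟨o, fun h => absurd h hd⟩
  choose z hz using hz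
  have fellow : ∀ {y w : ℕ → Y} {ζ : Z}, Tendsto (fun n => dist o (w n)) atTop atTop →
      (∀ᶠ n in atTop, ∀ γ', IsGeodSegment γ' o (y n) → ∃ q ∈ γ', dist q (w n) ≤ 2 * C + κ) →
      AccumulatesInto (fun n => ι (w n)) (cls ι S ζ) →
      AccumulatesInto (fun n => ι (y n)) (cls ι S ζ) := by
    intro y w ζ hw hyw hacc
    refine accumulatesInto_of_fellow hY hconv (x := o) (y' := w)
      (ρ := fun n => dist o (w n) - (2 * C + κ)) (r := 2 * C + κ)
      (tendsto_atTop_add_const_right _ _ hw) ?_ hacc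
    filter_upwards [hyw] with n hn
    obtain ⟨γ, hγ⟩ := hY o (y n)
    obtain ⟨γ', hγ'⟩ := hY o (w n)
    obtain ⟨q, hq, hqw⟩ := hn γ hγ
    exact ⟨γ, γ', q, w n, hγ, hγ', hq, hγ'.right_mem, hqw, by
      linarith [dist_triangle o q (w n)]⟩
  refine ⟨k, ?_, fun x => fellow hvd ?_ hvb⟩
  · have h1 : AccumulatesInto (fun n => ι (k n • z n)) (cls ι S a) :=
      fellow hud (hfar.mono fun n hn => (hz n hn).2) hua
    exact h1.of_approx fun φ p hφ =>
      (hUlim (fun n => k n • ξ) _ (hfar.mono fun n hn => (hz n hn).1) φ p hφ).symm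
  · filter_upwards [hfar, (tendsto_natCast_atTop_atTop (R := ℝ)).eventually_ge_atTop (dist o x)]
      with n hn hn'
    exact (hk n hn).1 x hn'

/-- Without a triple both intersections would be all of `Z`, and `ξ` could not be shown to be
non-pinched. -/
theorem triples_nonempty (hcomp : IsCompactification G ι S)
    (hY : IsGeodesicSpace Y) (hproper : IsProperAction G Y) (hconv : IsConvergenceBoundary ι S)
    (hnonel : IsNonelementary G) {h : G} (hh : IsContractingElt o h)
    (hnp : IsNonpinchedElt ι S o h)
    (hpinch : (∀ h : G, IsContractingElt o h → IsNonpinchedElt ι S o h) ∨ IsClosedPartition ι S) :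
    (triples G ι S o).Nonempty := by
  obtain ⟨t, C, θ, κ₀, κ, fr⟩ := exists_frame hY hproper hnonel hh
  obtain ⟨n, hn⟩ := (hh.tendsto_dist.eventually_gt_atTop (4 * C + 2 * κ₀ + κ)).exists
  obtain ⟨i, hi, -⟩ := fr.good₂ ((h ^ n)⁻¹ • o) o
  obtain ⟨j, hj, -⟩ := fr.good₂ (h ^ n • o) o
  obtain ⟨F, hF, -⟩ := fr.exists_mem_triples hcomp hY hproper hconv hh hnp hpinch ⟨hi, hj, hn⟩ 0
  exact ⟨F, hF⟩

end Recurrence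

/-! ### Conical points are recurrent -/

section ConicalPoints

variable {G Y Z : Type*} [Group G] [MetricSpace Y] [ProperSpace Y] [TopologicalSpace Z]
  [CompactSpace Z] [TopologicalSpace.MetrizableSpace Z] [MulAction G Y] [IsIsometricSMul G Y]
  [MulAction G Z] [ContinuousConstSMul G Z] {ι : Y → Z} {S : Setoid Z} {o : Y}

theorem finite_axisSystem_inter (hproper : IsProperAction G Y) (F : Finset G) (x : Y) (R : ℝ) :
    {X ∈ axisSystem o (F : Set G) | (X ∩ Metric.closedBall x R).Nonempty}.Finite := by
  refine (((finite_dist_smul_le (o := o) hproper x R).prod F.finite_toSet).image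
    fun q => q.1 • axis o q.2).subset ?_
  rintro X ⟨⟨f, hf, g, rfl⟩, y, ⟨_, ⟨e, he, rfl⟩, rfl⟩, hy⟩
  rw [Metric.mem_closedBall, dist_comm] at hy
  refine ⟨(g * e, f), ⟨by simpa [mul_smul] using hy, hf⟩, ?_⟩
  change (g * e) • axis o f = g • axis o f
  rw [mul_smul, smul_axis he]

theorem recurrent_of_projConical (hY : IsGeodesicSpace Y) (hproper : IsProperAction G Y)
    {F : Finset G} (hF : ∀ f ∈ F, IsContractingElt o f) {ξ : Z} {L₀ : ℕ}
    (hξ : ∀ L : ℕ, L₀ ≤ L → ξ ∈ projConical ι S (axisSystem o (F : Set G)) L) :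
    Recurrent ι o (F : Set G) ξ := by
  obtain ⟨C, hC⟩ := exists_forall_mem_finset F (p := fun f C => IsContracting C (axis o f))
    (fun f c c' hcc h => h.mono hcc) fun f hf => (hF f hf).axis_contracting hY hproper
  obtain ⟨D, hD⟩ := exists_forall_mem_finset F
    (p := fun f D => ∀ y ∈ axis o f, ∃ n : ℤ, dist y (f ^ n • o) ≤ D)
    (fun f c c' hcc h y hy => (h y hy).imp fun n hn => hn.trans hcc)
    fun f hf => (hF f hf).exists_axis_near hY
  obtain ⟨M, hM⟩ := exists_forall_mem_finset F (p := fun f M => dist o (f • o) ≤ M)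
    (fun f c c' hcc h => h.trans hcc) fun f hf => ⟨_, le_rfl⟩
  refine ⟨2 * C + D, fun L => ?_⟩
  obtain ⟨B, hB⟩ := exists_nat_gt (|(L : ℝ)| * M + 2 * D + 4 * C)
  obtain ⟨-, x, hinf⟩ := hξ (max L₀ (2 * B)) (le_max_left _ _)
  have hBL : 2 * (B : ℝ) ≤ ((max L₀ (2 * B) : ℕ) : ℝ) := by
    exact_mod_cast le_max_right L₀ (2 * B)
  refine ⟨x, fun T => ?_⟩
  obtain ⟨X, ⟨hX, -, hdist⟩, hXfar⟩ :=
    (hinf.sdiff (finite_axisSystem_inter (o := o) hproper F x (T + 2 * C))).nonempty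
  obtain ⟨f, hf, g, hXg⟩ := id hX
  change X = g • axis o f at hXg
  have hXc : IsContracting C X := by rw [hXg]; exact (hC f hf).smul g
  have hXne : X.Nonempty := by rw [hXg]; exact (axis_nonempty o f).smul_set
  have hC1 := hXc.1
  have hM0 : 0 ≤ M := dist_nonneg.trans (hM f hf)
  have hD0 : 0 ≤ D := by
    obtain ⟨n, hn⟩ := hD f hf o (self_mem_axis o f)
    exact dist_nonneg.trans hn
  have hLM : 0 ≤ |(L : ℝ)| * M := by positivity
  have hfar : ∀ y ∈ X, T + 2 * C < dist x y := by
    intro y hy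
    by_contra hle
    refine hXfar ⟨hX, y, hy, ?_⟩
    rw [Metric.mem_closedBall, dist_comm]
    exact not_lt.1 hle
  -- The two distant points may both be projections of `ξ`. Then one of them is at least half as far
  -- from a projection of `x`; this explains the threshold `2 * B`.
  obtain ⟨u, hu, v, hv, huv⟩ :
      ∃ u ∈ proj X x, ∃ v ∈ bdryProj ι X ξ, |(L : ℝ)| * M + 2 * D + 4 * C < dist u v := by
    obtain ⟨u, hu, v, hv, huv⟩ := hdist
    rcases hu with hu | hu <;> rcases hv with hv | hv
    · have := proj_lip hY hXc hu hv
      rw [dist_self] at this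
      linarith
    · exact ⟨u, hu, v, hv, by linarith⟩
    · exact ⟨v, hv, u, hu, by rw [dist_comm]; linarith⟩
    · obtain ⟨w, hw⟩ := proj_nonempty hXc.2.1 hXne x
      rcases lt_or_ge (|(L : ℝ)| * M + 2 * D + 4 * C) (dist w u) with h1 | h1
      · exact ⟨w, hw, u, hu, h1⟩
      · exact ⟨w, hw, v, hv, by linarith [dist_triangle_left u v w]⟩
  have near : ∀ y ∈ X, ∃ n : ℤ, dist y (g • f ^ n • o) ≤ D := by
    intro y hy
    rw [hXg] at hy
    obtain ⟨y', hy', rfl⟩ := hy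
    obtain ⟨n, hn⟩ := hD f hf y' hy'
    exact ⟨n, by rwa [dist_smul]⟩
  have hvX : v ∈ X := by
    obtain ⟨y, -, hy⟩ := hv univ univ_mem
    exact hy.1
  obtain ⟨i, hi⟩ := near u hu.1
  obtain ⟨j, hj⟩ := near v hvX
  refine ⟨f, hf, g, i, j, ?_, ?_⟩
  · by_contra hlt
    have h1 : |(i : ℝ) - j| ≤ |(L : ℝ)| := by
      have : |i - j| ≤ |L| := (not_le.1 hlt).le.trans (le_abs_self L)
      exact_mod_cast this
    have h2 := dist_zpow_le o f i j
    have h3 := dist_triangle4 u (g • f ^ i • o) (g • f ^ j • o) v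
    rw [dist_smul, dist_comm (g • f ^ j • o) v] at h3
    have h4 : |(i : ℝ) - j| * dist o (f • o) ≤ |(L : ℝ)| * M :=
      mul_le_mul h1 (hM f hf) dist_nonneg (abs_nonneg _)
    linarith
  · rw [frequently_comap_iff]
    intro U hU
    obtain ⟨z, hzU, hvz⟩ := hv U hU
    obtain ⟨γ, hγ⟩ := hY x z
    obtain ⟨p, hp, q, hq, hpu, hqv, -, -, hpq⟩ := bgi hXc hγ hu hvz (by linarith)
    refine ⟨z, hzU, γ, p, q, hγ, hp, hq, hpq, ?_, ?_, ?_⟩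
    · linarith [hfar u hu.1, dist_triangle x p u]
    · linarith [dist_triangle p u (g • f ^ i • o)]
    · linarith [dist_triangle q v (g • f ^ j • o)]

theorem exists_frequently_of_finite {α β : Type*} {l : Filter α} {Q : Set β} (hQ : Q.Finite)
    {p : α → β → Prop} (h : ∃ᶠ z in l, ∃ q ∈ Q, p z q) : ∃ q ∈ Q, ∃ᶠ z in l, p z q := by
  by_contra hcon
  push Not at hcon
  obtain ⟨z, ⟨q, hq, hz⟩, hz'⟩ := (h.and_eventually ((eventually_all_finite hQ).2 hcon)).exists
  exact hz' q hq hz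

/-- A barrier for `f ^ k` marks the two ends of a piece of length `k` of a translated orbit of `f`,
with the same radius `r` for all `k`. -/
theorem recurrent_of_conical (hproper : IsProperAction G Y) [DecidableEq G]
    {F : Finset G} {ξ : Z} {r : ℝ}
    (hξ : ∀ᶠ k : ℕ in atTop, ξ ∈ conical ι S o r ((F.image fun f => f ^ k : Finset G) : Set G)) :
    Recurrent ι o (F : Set G) ξ := by
  refine ⟨r, fun L => ?_⟩
  obtain ⟨k, ⟨-, x, -, hinf⟩, hkL⟩ := (hξ.and (eventually_ge_atTop L.toNat)).exists
  obtain ⟨M, hM⟩ := exists_forall_mem_finset F (p := fun f M => dist o (f ^ k • o) ≤ M)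
    (fun f c c' hcc h => h.trans hcc) fun f hf => ⟨_, le_rfl⟩
  refine ⟨x, fun T => ?_⟩
  have hfin : {y | y ∈ MulAction.orbit G o ∧ dist x y ≤ T + r + max M 0}.Finite := by
    refine ((finite_dist_smul_le (o := o) hproper x (T + r + max M 0)).image
      fun g => g • o).subset ?_
    rintro _ ⟨⟨g, rfl⟩, hy⟩
    exact ⟨g, hy, rfl⟩
  obtain ⟨y, ⟨hyo, hyξ, -⟩, hyfar⟩ := (hinf.sdiff hfin).nonempty
  have hd : T + r + max M 0 < dist x y := by
    by_contra hle
    exact hyfar ⟨hyo, not_lt.1 hle⟩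
  have hM0 := le_max_right M 0
  have hfr : ∃ᶠ z in comap ι (𝓝 ξ), z ∈ partialCone o r
      ((F.image fun f => f ^ k : Finset G) : Set G) x y := by
    rw [frequently_comap_iff]
    intro U hU
    obtain ⟨_, hzU, z, hz, rfl⟩ := mem_closure_iff_nhds.1 hyξ U hU
    exact ⟨z, hzU, hz⟩
  -- By properness `y` has finitely many representatives `g • o`. Hence one `g`, one `f` and one
  -- order of passing the two ends occur for points `z` arbitrarily close to `ξ`.
  have hQ : ({g : G | dist x (g • o) ≤ dist x y} ×ˢ (F : Set G) ×ˢ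
      ({(0, (k : ℤ)), ((k : ℤ), 0)} : Set (ℤ × ℤ))).Finite :=
    (finite_dist_smul_le hproper x _).prod (F.finite_toSet.prod (by simp))
  obtain ⟨⟨g, f, i, j⟩, ⟨-, hf, hij⟩, hz⟩ := exists_frequently_of_finite hQ
    (p := fun z q => ∃ (γ : Set Y) (w₁ w₂ : Y), IsGeodSegment γ x z ∧ w₁ ∈ γ ∧ w₂ ∈ γ ∧
      dist x w₁ ≤ dist x w₂ ∧ T ≤ dist x w₁ ∧ dist w₁ (q.1 • q.2.1 ^ q.2.2.1 • o) ≤ r ∧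
      dist w₂ (q.1 • q.2.1 ^ q.2.2.2 • o) ≤ r) (hfr.mono fun z hz => by
    obtain ⟨γ, hγ, f', hf', g, rfl, h1, h2⟩ := hz
    obtain ⟨f, hf, rfl⟩ := Finset.mem_image.1 (Finset.mem_coe.1 hf')
    obtain ⟨w₁, hw₁, e₁⟩ := hγ.isCompact.exists_infDist_eq_dist ⟨x, hγ.left_mem⟩ (g • o)
    obtain ⟨w₂, hw₂, e₂⟩ := hγ.isCompact.exists_infDist_eq_dist ⟨x, hγ.left_mem⟩ (g • f ^ k • o)
    rw [e₁, dist_comm] at h1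
    rw [e₂, dist_comm] at h2
    have t1 : T ≤ dist x w₁ := by linarith [dist_triangle x w₁ (g • o)]
    have t2 : T ≤ dist x w₂ := by
      have := dist_triangle4 x w₂ (g • f ^ k • o) (g • o)
      rw [dist_smul, dist_comm (f ^ k • o)] at this
      linarith [hM f hf, le_max_left M 0]
    rcases le_total (dist x w₁) (dist x w₂) with hle | hle
    · exact ⟨(g, f, 0, k), ⟨(le_rfl : dist x (g • o) ≤ _), hf, by simp⟩, γ, w₁, w₂, hγ, hw₁, hw₂, hle, t1,
        by simpa using h1, by simpa using h2⟩
    · exact ⟨(g, f, k, 0), ⟨(le_rfl : dist x (g • o) ≤ _), hf, by simp⟩, γ, w₂, w₁, hγ, hw₂, hw₁, hle, t2,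
        by simpa using h2, by simpa using h1⟩)
  refine ⟨f, hf, g, i, j, ?_, hz⟩
  have hk : L ≤ k := by omega
  rcases hij with hij | hij <;> obtain ⟨rfl, rfl⟩ := Prod.mk.inj hij <;> simpa using hk

theorem axisSystem_pow [DecidableEq G] (F : Finset G) {k : ℕ} (hk : k ≠ 0) :
    axisSystem o ((F.image fun f => f ^ k : Finset G) : Set G) = axisSystem o (F : Set G) := by
  ext X
  constructor
  · rintro ⟨f', hf', g, rfl⟩
    obtain ⟨f, hf, rfl⟩ := Finset.mem_image.1 (Finset.mem_coe.1 hf')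
    exact ⟨f, hf, g, by rw [axis_pow o f hk]⟩
  · rintro ⟨f, hf, g, rfl⟩
    exact ⟨f ^ k, Finset.mem_coe.2 (Finset.mem_image_of_mem _ hf), g, by rw [axis_pow o f hk]⟩

theorem Independent.pow {f g : G} (h : Independent o f g) {k : ℕ} (hk : k ≠ 0) :
    Independent o (f ^ k) (g ^ k) := by
  simpa [Independent, axisSystem, axis_pow o _ hk] using h

theorem pow_mem_triples (hY : IsGeodesicSpace Y) (hproper : IsProperAction G Y) [DecidableEq G]
    {F : Finset G} (hF : F ∈ triples G ι S o) {k : ℕ} (hk : k ≠ 0) :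
    (F.image fun f => f ^ k) ∈ triples G ι S o := by
  obtain ⟨hcard, hFc, hFi⟩ := hF
  -- Independence passes to powers because it depends only on the axes, so equal powers would make
  -- an element independent of itself.
  have hinj : Set.InjOn (fun f => f ^ k) (F : Set G) := by
    intro f hf g hg hfg
    by_contra hne
    have h1 := (hFi f hf g hg hne).pow hk
    simp only at hfg
    rw [hfg] at h1
    exact ((hFc g hg).1.pow hY hproper hk).not_independent_self h1
  refine ⟨by rw [Finset.card_image_of_injOn hinj, hcard], ?_, ?_⟩
  · simp only [Finset.forall_mem_image]
    exact fun f hf => ⟨(hFc f hf).1.pow hY hproper hk, (hFc f hf).2.pow hk⟩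
  · simp only [Finset.forall_mem_image]
    exact fun f hf g hg hne => (hFi f hf g hg fun h => hne (by rw [h])).pow hk

theorem countable_of_isProperAction (hproper : IsProperAction G Y) (o : Y) : Countable G := by
  rw [← Set.countable_univ_iff]
  refine (Set.countable_iUnion fun n : ℕ =>
    (finite_dist_smul_le (o := o) hproper o n).countable).mono fun g _ => ?_
  obtain ⟨n, hn⟩ := exists_nat_ge (dist o (g • o))
  exact mem_iUnion.2 ⟨n, hn⟩

end ConicalPoints

end ConvBdry

/-! ### The two equalities -/

theorem mainTheorem9 {G Y Z : Type*} [Group G] [MetricSpace Y] [ProperSpace Y]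
    [TopologicalSpace Z] [CompactSpace Z] [TopologicalSpace.MetrizableSpace Z]
    [MulAction G Y] [IsIsometricSMul G Y] [MulAction G Z] [ContinuousConstSMul G Z]
    (ι : Y → Z) (S : Setoid Z) (o : Y)
    (hgeod : ConvBdry.IsGeodesicSpace Y)
    (hproper : ConvBdry.IsProperAction G Y)
    (hnonel : ConvBdry.IsNonelementary G)
    (hcontr : ∃ h : G, ConvBdry.IsContractingElt o h)
    (hcomp : ConvBdry.IsCompactification G ι S)
    (hconv : ConvBdry.IsConvergenceBoundary ι S)
    (hpinch : (∀ h : G, ConvBdry.IsContractingElt o h → ConvBdry.IsNonpinchedElt ι S o h) ∨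
      (ConvBdry.IsClosedPartition ι S ∧
        ∃ h : G, ConvBdry.IsContractingElt o h ∧ ConvBdry.IsNonpinchedElt ι S o h)) :
    (ConvBdry.triples G ι S o).Countable ∧
    (∀ L₀ : Set (Set Y) → ℕ,
      ConvBdry.myrberg G ι S o =
        ⋂ F ∈ ConvBdry.triples G ι S o, ⋂ L : ℕ,
          ⋂ (_ : L₀ (ConvBdry.axisSystem o (F : Set G)) ≤ L),
            ConvBdry.projConical ι S (ConvBdry.axisSystem o (F : Set G)) (L : ℝ)) ∧
    ∃ R : Set (Set Y) → ℝ, ∀ r : Set (Set Y) → ℝ, (∀ 𝓕, R 𝓕 ≤ r 𝓕) →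
      ∀ ℓ : Set (Set Y) → ℝ,
        ConvBdry.myrberg G ι S o =
          ⋂ F ∈ ConvBdry.triples G ι S o,
            ⋂ (_ : ∀ f ∈ F, ℓ (ConvBdry.axisSystem o (F : Set G)) ≤ dist o (f • o)),
              ConvBdry.conical ι S o (r (ConvBdry.axisSystem o (F : Set G))) (F : Set G) := by
  classical
  have hctx : ∃ h : G, ConvBdry.IsContractingElt o h ∧ ConvBdry.IsNonpinchedElt ι S o h ∧
      ((∀ h : G, ConvBdry.IsContractingElt o h → ConvBdry.IsNonpinchedElt ι S o h) ∨
        ConvBdry.IsClosedPartition ι S) := by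
    rcases hpinch with hp | ⟨hcl, h, hh, hn⟩
    · obtain ⟨h, hh⟩ := hcontr
      exact ⟨h, hh, hp h hh, Or.inl hp⟩
    · exact ⟨h, hh, hn, Or.inr hcl⟩
  obtain ⟨h, hh, hn, hpinch'⟩ := hctx
  obtain ⟨F₀, hF₀⟩ := ConvBdry.triples_nonempty hcomp hgeod hproper hconv hnonel hh hn hpinch'
  have of_recurrent : ∀ {ξ : Z}, ξ ∈ ConvBdry.nonpinched ι S →
      (∀ F ∈ ConvBdry.triples G ι S o, ConvBdry.Recurrent ι o (F : Set G) ξ) →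
        ξ ∈ ConvBdry.myrberg G ι S o := fun hξ hrec =>
    ConvBdry.mem_myrberg_of_recurrent hcomp hgeod hproper hconv hnonel hh hn hpinch' hξ hrec
  refine ⟨?_, fun L₀ => Subset.antisymm ?_ fun ξ hξ => ?_, ?_⟩
  · have := ConvBdry.countable_of_isProperAction hproper o
    exact Set.to_countable _
  · exact subset_iInter₂ fun F hF => subset_iInter₂ fun L _ =>
      ConvBdry.myrberg_subset_projConical hcomp hgeod hproper hconv hF L
  · simp only [mem_iInter] at hξ
    exact of_recurrent (hξ F₀ hF₀ _ le_rfl).1 fun F hF =>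
      ConvBdry.recurrent_of_projConical hgeod hproper (fun f hf => (hF.2.1 f hf).1) (hξ F hF)
  choose R hR using ConvBdry.exists_myrberg_subset_conical (o := o) hcomp hgeod hconv
  refine ⟨R, fun r hr ℓ => Subset.antisymm ?_ fun ξ hξ => ?_⟩
  · exact subset_iInter₂ fun F hF => subset_iInter fun _ => hR _ _ (hr _) F hF rfl
  simp only [mem_iInter] at hξ
  -- Large powers of `F` meet the threshold `ℓ` and have the same axis system, so the hypothesis
  -- applies to them with an unchanged radius.
  have key : ∀ F ∈ ConvBdry.triples G ι S o, ∀ᶠ k : ℕ in atTop,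
      ξ ∈ ConvBdry.conical ι S o (r (ConvBdry.axisSystem o (F : Set G)))
        ((F.image fun f => f ^ k : Finset G) : Set G) := by
    intro F hF
    have hlong : ∀ᶠ k : ℕ in atTop, ∀ f ∈ F,
        ℓ (ConvBdry.axisSystem o (F : Set G)) ≤ dist o (f ^ k • o) :=
      (Filter.eventually_all_finset F).2 fun f hf =>
        (hF.2.1 f hf).1.tendsto_dist.eventually_ge_atTop _
    filter_upwards [hlong, eventually_ne_atTop 0] with k hk hk0
    have h1 := hξ _ (ConvBdry.pow_mem_triples hgeod hproper hF hk0)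
    rw [ConvBdry.axisSystem_pow F hk0] at h1
    exact h1 (by simpa only [Finset.forall_mem_image] using hk)
  obtain ⟨k, hk⟩ := (key F₀ hF₀).exists
  exact of_recurrent hk.1 fun F hF => ConvBdry.recurrent_of_conical hproper (key F hF)
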